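/- **Setting.** Let $M$ be an open smooth manifold of dimension $m+1\ge 1$ and $g:M\to\mathbb R$ a smooth function without critical points. Let $T^*M$ carry the Liouville form $p\,dq=\sum_i p_i\,dq_i$ and the symplectic form $\omega=\sum_i dp_i\wedge dq_i$, and put $h^T_t(q,p)=(q,p+tT\,dg(q))$. Let $\Sigma\subset T^*M$ be a closed hypersurface, $Z$ a smooth vector field on an open neighbourhood $U$ of $\Sigma$, transversal to $\Sigma$, with $L_Z\omega=\omega$, and $\lambda=i_Z\omega|_\Sigma$ the induced contact form, with Reeb vector field $X_\lambda$ and Reeb flow $\eta_s$. Assume $[p\,dq|_\Sigma-\lambda]=0$ in $H^1(\Sigma)$. Let $Q:\mathcal L\to\Sigma$ be a closed Legendrian submanifold. Let $0<\varepsilon<\varepsilon_0$ be such that $(a,x)\mapsto f_a(x)$, with $f_a$ the flow of $Z$, is defined on $(-\varepsilon_0,\varepsilon_0)\times\Sigma$ with values in $U$ and identifies it with a neighbourhood of $\Sigma$; write $(a,x)$ for $f_a(x)$. Let $S^1=\mathbb R/2\mathbb Z$, parametrized by $[-1,1]$. **Proposition.** There is $T>0$ such that $h^T_1([0,\varepsilon]\times\Sigma)\cap([0,\varepsilon]\times\Sigma)=\emptyset$.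 Fix any $T\in\mathbb R$ with this property, any $0<\delta<1$, and any smooth $\rho:S^1\to[0,1]$ that equals $0$ on the open $\delta$-neighbourhood $I_0$ of $0$ and $1$ on the open $\delta$-neighbourhood $I_1$ of $\pm1$. Then there is a constant $M_0>0$ with the following property. Let $\ell\in[0,\infty]$ be such that there is no Reeb chord of length in $(0,\ell]$ from $\mathcal L$ to $\mathcal L$ (for $\ell=\infty$: no Reeb chord at all), and let $E=\{(s(t'),a(t')):t'\in S^1\}\subset\mathbb R\times[0,\varepsilon]$ be a smoothly embedded closed curve (for example an ellipse) with $s(t')-s(t'')\le\ell$ for all $t',t''$. Let $W'=\mathcal L\times S^1$, and for $t\in[0,1]$ let $$F'(l,t',t)=h^T_t\bigl(a(t'),\eta_{s(t')}(Q(l))\bigr).$$ Let $\psi=Tg$ be evaluated at the base point in $M$ of $F'(w',0)$, $w'\in W'$, and let $\Phi(w',\Theta)=\psi(w')\rho'(\Theta)$. Then $|\psi|\le M_0$ on $W'$, and there are $\Phi_-<0<\Phi_+$ such that $\Phi$ takes its values in $(\Phi_-,\Phi_+)$, and a smooth map $\alpha:S^1\times(\Phi_-,\Phi_+)\to\mathbb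 R^2$ such that 1. $\alpha^*(dx\wedge dy)=d\Phi\wedge d\Theta$, where on the left $x,y$ are the coordinates of $\mathbb R^2$ and on the right $\Theta,\Phi$ are those of the annulus; 2. $\alpha$ is injective on $I\times(\Phi_-,\Phi_+)$ for some closed $I\subset S^1$ with $I\cup I_0\cup I_1=S^1$; $\alpha(0,0)=\alpha(\pm1,0)=0$, and $\alpha$ has no other double point on $S^1\times\{0\}$; 3. the curve $\alpha|_{S^1\times\{0\}}$ bounds zero area: $\int_{S^1\times 0}\alpha^*(x\,dy)=0$; and such that $$F:W'\times S^1\to T^*M\times\mathbb R^2,\qquad F(w',\Theta)=\bigl(F'(w',\rho(\Theta)),\,\alpha(\Theta,\Phi(w',\Theta))\bigr)$$ is a Lagrangian embedding for $\omega\oplus dx\wedge dy$ which is exact relative to $W'$, that is, $$F^*(p\,dq+x\,dy)=e^{a(t')}\,ds(t')+dh$$ for some smooth function $h$ on $W'\times S^1$. Its image $W=F(W'\times S^1)$ lies in $T^*M\times B_{r_0}(0)$, where $B_{r_0}(0)$ is the open disc of radius $r_0>0$ given by $4\pi r_0^2=8M_0$. The constant $M_0$ depends neither on $E$ (in particular not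 on $\mathrm{area}(E)$) nor on $\ell$. -/

import Mathlib

open scoped Manifold ContDiff ENNReal
open Set Bundle

noncomputable section

namespace FigureEight

/-! ### Differential forms of degree one on manifolds -/

section Forms

variable {E : Type*} [NormedAddCommGroup E] [NormedSpace ℝ E]
  {H : Type*} [TopologicalSpace H]
  {E' : Type*} [NormedAddCommGroup E'] [NormedSpace ℝ E']
  {H' : Type*} [TopologicalSpace H']

/-- A (not necessarily smooth) 1-form on a manifold `X`. -/
abbrev OneForm (I : ModelWithCorners ℝ E H) (X : Type*) [TopologicalSpace X]
    [ChartedSpace H X] : Type _ :=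
  ∀ x : X, TangentSpace I x →L[ℝ] ℝ

variable (I : ModelWithCorners ℝ E H) (I' : ModelWithCorners ℝ E' H')
  {X : Type*} [TopologicalSpace X] [ChartedSpace H X]
  {Y : Type*} [TopologicalSpace Y] [ChartedSpace H' Y]

/-- The differential `df` of a real function, as a 1-form. -/
def dform (f : X → ℝ) : OneForm I X := fun x => mfderiv I 𝓘(ℝ, ℝ) f x

/-- The pull-back `f^* ζ` of a 1-form. -/
def pullbackForm (f : X → Y) (ζ : OneForm I' Y) : OneForm I X :=
  fun x => (ζ (f x)).comp (mfderiv I I' f x)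

/-- The coordinate expression of the 1-form `ζ` in the chart at `x₀`: the pull-back of `ζ` by the
inverse of that chart, a map from the model space to its dual. -/
def chartForm (ζ : OneForm I X) (x₀ : X) (y : E) : E →L[ℝ] ℝ :=
  (ζ ((extChartAt I x₀).symm y)).comp (mfderiv 𝓘(ℝ, E) I (extChartAt I x₀).symm y)

/-- The exterior derivative of a 1-form on a manifold without boundary, computed in the chart at
`x`:  `dζ (u, v) = (D_u w) v - (D_v w) u`, where `w` is the coordinate expression of `ζ`. -/
def extDer (ζ : OneForm I X) (x : X) :
    TangentSpace I x →L[ℝ] TangentSpace I x →L[ℝ] ℝ :=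
  let D : E →L[ℝ] E →L[ℝ] ℝ := fderiv ℝ (chartForm I ζ x) (extChartAt I x x)
  let φ : E →L[ℝ] E := mfderiv I 𝓘(ℝ, E) (extChartAt I x) x
  show E →L[ℝ] E →L[ℝ] ℝ from (D - D.flip).bilinearComp φ φ

/-- Smooth embeddings: smooth injective immersions that are homeomorphisms onto their image. -/
structure IsSmoothEmb (f : X → Y) : Prop where
  contMDiff : ContMDiff I I' ∞ f
  isEmbedding : Topology.IsEmbedding f
  injective_mfderiv : ∀ x, Function.Injective (mfderiv I I' f x)

/-- `η` is the (global) flow of the smooth vector field `V`. -/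
structure IsFlow [IsManifold I ∞ X] (V : ∀ x : X, TangentSpace I x) (η : ℝ → X → X) : Prop where
  contMDiff_field : ContMDiff I I.tangent ∞ (fun x => (⟨x, V x⟩ : TangentBundle I X))
  contMDiff : ContMDiff (𝓘(ℝ, ℝ).prod I) I ∞ (fun p : ℝ × X => η p.1 p.2)
  zero : ∀ x, η 0 x = x
  integral : ∀ x, IsMIntegralCurve (I := I) (fun s => η s x) V

/-- `R` is the Reeb vector field of the contact form `lam`:
`lam R = 1` and `i_R (d lam) = 0`. -/
structure IsReebField (lam : OneForm I X) (R : ∀ x : X, TangentSpace I x) : Prop where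
  apply_eq_one : ∀ x, lam x (R x) = 1
  contract_eq_zero : ∀ x v, extDer I lam x (R x) v = 0

end Forms

/-! ### The cotangent bundle -/

/-- `ℝ^n` with its Euclidean norm. -/
abbrev Eu (n : ℕ) : Type := EuclideanSpace ℝ (Fin n)

section Cotangent

variable {n : ℕ} (M : Type*) [TopologicalSpace M] [ChartedSpace (Eu n) M]
  [IsManifold (𝓡 n) ∞ M]

/-- The total space of the cotangent bundle `T^*M` of an `n`-manifold `M`; a point is a pair
`⟨q, p⟩` with `q : M` and `p` a linear functional on the tangent space at `q`. -/
abbrev Cot : Type _ :=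
  TotalSpace (Eu n →L[ℝ] ℝ) (fun q : M => TangentSpace (𝓡 n) q →L[ℝ] Trivial M ℝ q)

variable (n)

/-- The model with corners of the manifold `T^*M`. -/
abbrev cotModel : ModelWithCorners ℝ (Eu n × (Eu n →L[ℝ] ℝ)) (ModelProd (Eu n) (Eu n →L[ℝ] ℝ)) :=
  (𝓡 n).prod 𝓘(ℝ, Eu n →L[ℝ] ℝ)

variable {M}

/-- The Liouville form `∑ p_i dq_i`: at `⟨q, p⟩` it is `p` composed with the differential of the
projection `T^*M → M`. -/
def liouville : OneForm (cotModel n) (Cot (n := n) M) := fun z =>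
  ContinuousLinearMap.comp (show TangentSpace (𝓡 n) z.1 →L[ℝ] ℝ from z.2)
    (mfderiv (cotModel n) (𝓡 n) (fun y : Cot (n := n) M => y.1) z)

/-- The symplectic form `∑ dp_i ∧ dq_i` of `T^*M`. -/
def omega (z : Cot (n := n) M) :
    TangentSpace (cotModel n) z →L[ℝ] TangentSpace (cotModel n) z →L[ℝ] ℝ :=
  extDer (cotModel n) (liouville n) z

/-- The contraction `i_Z ω`. -/
def contractOmega (Z : ∀ z : Cot (n := n) M, TangentSpace (cotModel n) z) :
    OneForm (cotModel n) (Cot (n := n) M) := fun z => omega n z (Z z)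

/-- The fibre translation `(q, p) ↦ (q, p + τ dg(q))`. -/
def translate (g : M → ℝ) (τ : ℝ) (z : Cot (n := n) M) : Cot (n := n) M :=
  ⟨z.1, (show TangentSpace (𝓡 n) z.1 →L[ℝ] ℝ from z.2) + τ • dform (𝓡 n) g z.1⟩

/-- `Z` is a smooth vector field on the open set `U` with `L_Z ω = ω`. As `ω` is closed,
`L_Z ω = d (i_Z ω)`. -/
structure IsLiouvilleField (U : Set (Cot (n := n) M))
    (Z : ∀ z : Cot (n := n) M, TangentSpace (cotModel n) z) : Prop where
  isOpen : IsOpen U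
  contMDiffOn : ContMDiffOn (cotModel n) (cotModel n).tangent ∞
    (fun z => (⟨z, Z z⟩ : TangentBundle (cotModel n) (Cot (n := n) M))) U
  lie_eq : ∀ z ∈ U, extDer (cotModel n) (contractOmega n Z) z = omega n z

/-- The contact form `λ = i_Z ω` induced on a hypersurface `j : S → T^*M` of dimension `k`. -/
def contactForm {k : ℕ} {S : Type*} [TopologicalSpace S] [ChartedSpace (Eu k) S]
    (Z : ∀ z : Cot (n := n) M, TangentSpace (cotModel n) z) (j : S → Cot (n := n) M) :
    OneForm (𝓡 k) S :=
  pullbackForm (𝓡 k) (cotModel n) j (contractOmega n Z)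

/-- `c (a, x)`, for `|a| < ε₀` and `x ∈ S`, is the image of `j x` under the flow of `Z` at time `a`,
and `c` identifies `(-ε₀, ε₀) × S` with a neighbourhood of the hypersurface inside `U`. -/
structure IsFlowCollar {k : ℕ} {S : Type*} [TopologicalSpace S] [ChartedSpace (Eu k) S]
    (U : Set (Cot (n := n) M)) (Z : ∀ z : Cot (n := n) M, TangentSpace (cotModel n) z)
    (j : S → Cot (n := n) M) (ε₀ : ℝ) (c : ℝ × S → Cot (n := n) M) : Prop where
  contMDiffOn : ContMDiffOn (𝓘(ℝ, ℝ).prod (𝓡 k)) (cotModel n) ∞ c (Ioo (-ε₀) ε₀ ×ˢ univ)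
  mapsTo : MapsTo c (Ioo (-ε₀) ε₀ ×ˢ univ) U
  zero : ∀ x, c (0, x) = j x
  integral : ∀ x, IsMIntegralCurveOn (I := cotModel n) (fun a => c (a, x)) Z (Ioo (-ε₀) ε₀)
  injOn : InjOn c (Ioo (-ε₀) ε₀ ×ˢ univ)
  injective_mfderiv : ∀ p ∈ Ioo (-ε₀) ε₀ ×ˢ (univ : Set S),
    Function.Injective (mfderiv (𝓘(ℝ, ℝ).prod (𝓡 k)) (cotModel n) c p)

/-- The model with corners of `T^*M × ℝ²`. -/
abbrev cotPlaneModel : ModelWithCorners ℝ ((Eu n × (Eu n →L[ℝ] ℝ)) × Eu 2)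
    (ModelProd (ModelProd (Eu n) (Eu n →L[ℝ] ℝ)) (Eu 2)) :=
  (cotModel n).prod (𝓡 2)

/-- The 1-form `∑ p_i dq_i + x dy` on `T^*M × ℝ²`. -/
def liouvillePlane : OneForm (cotPlaneModel n) (Cot (n := n) M × Eu 2) := fun z =>
  (liouville n z.1).comp
      (ContinuousLinearMap.fst ℝ (Eu n × (Eu n →L[ℝ] ℝ)) (Eu 2)) +
    (z.2 0) • (EuclideanSpace.proj (𝕜 := ℝ) (1 : Fin 2)).comp
      (ContinuousLinearMap.snd ℝ (Eu n × (Eu n →L[ℝ] ℝ)) (Eu 2))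

/-- The symplectic form `ω ⊕ dx ∧ dy` on `T^*M × ℝ²`; tangent vectors are pairs. -/
def omegaPlane (z : Cot (n := n) M × Eu 2)
    (u v : (Eu n × (Eu n →L[ℝ] ℝ)) × Eu 2) : ℝ :=
  omega n z.1 u.1 v.1 + (u.2 0 * v.2 1 - u.2 1 * v.2 0)

end Cotangent

/-! ### The circle `S¹ = ℝ / 2ℤ`, parametrized by `[-1, 1]` -/

/-- The circle `ℝ / 2ℤ`. -/
abbrev S1 : Type := AddCircle (2 : ℝ)

/-- Smoothness of a function on the circle `ℝ / 2ℤ`: its 2-periodic lift is smooth. -/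
def SmoothOnS1 (f : S1 → ℝ) : Prop := ContDiff ℝ ∞ (fun t : ℝ => f (t : S1))

/-- The derivative of a function on `ℝ / 2ℤ`, at (the class of) the real number `t`. -/
def derivS1 (f : S1 → ℝ) (t : ℝ) : ℝ := deriv (fun t : ℝ => f (t : S1)) t

theorem derivS1_periodic (f : S1 → ℝ) : Function.Periodic (derivS1 f) 2 := by
  intro t
  have h : (fun t : ℝ => f ((t + 2 : ℝ) : S1)) = fun t : ℝ => f (t : S1) := by
    funext t
    rw [AddCircle.coe_add_period]
  unfold derivS1
  rw [← deriv_comp_add_const, h]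

/-- The derivative `f'` as a function on the circle. -/
def primeS1 (f : S1 → ℝ) : S1 → ℝ := (derivS1_periodic f).lift

/-- `t ↦ (s t, a t)` is a smoothly embedded closed curve in the strip `ℝ × [0, ε]`. -/
structure IsStripCurve (ε : ℝ) (s a : S1 → ℝ) : Prop where
  smooth_s : SmoothOnS1 s
  smooth_a : SmoothOnS1 a
  mem_strip : ∀ t, a t ∈ Icc 0 ε
  injective : Function.Injective (fun t => (s t, a t))
  regular : ∀ t : ℝ, derivS1 s t ≠ 0 ∨ derivS1 a t ≠ 0

/-- The `δ`-neighbourhood `I₀` of `0` in the circle. -/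
def I0 (δ : ℝ) : Set S1 := {Θ | ‖Θ‖ < δ}

/-- The `δ`-neighbourhood `I₁` of `±1` in the circle. -/
def I1 (δ : ℝ) : Set S1 := {Θ | ‖Θ - ((1 : ℝ) : S1)‖ < δ}

/-- Smooth `ρ : S¹ → [0, 1]` with `ρ = 0` on `I₀` and `ρ = 1` on `I₁`. -/
structure IsCutoff (δ : ℝ) (ρ : S1 → ℝ) : Prop where
  smooth : SmoothOnS1 ρ
  mem : ∀ Θ, ρ Θ ∈ Icc (0 : ℝ) 1
  eq_zero : ∀ Θ ∈ I0 δ, ρ Θ = 0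
  eq_one : ∀ Θ ∈ I1 δ, ρ Θ = 1

/-- A figure-eight map `α` of the annulus `S¹ × (Φm, Φp)` into the plane. -/
structure IsFigureEight (δ Φm Φp : ℝ) (α : S1 × ℝ → Eu 2) : Prop where
  neg : Φm < 0
  pos : 0 < Φp
  smooth : ContDiffOn ℝ ∞ (fun p : ℝ × ℝ => α ((p.1 : S1), p.2)) (univ ×ˢ Ioo Φm Φp)
  /-- `α^* (dx ∧ dy) = dΦ ∧ dΘ` -/
  area : ∀ Θ : ℝ, ∀ φ ∈ Ioo Φm Φp, ∀ u v : ℝ × ℝ,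
    let D := fderiv ℝ (fun p : ℝ × ℝ => α ((p.1 : S1), p.2)) (Θ, φ)
    D u 0 * D v 1 - D u 1 * D v 0 = u.2 * v.1 - v.2 * u.1
  /-- injectivity away from the crossing arcs -/
  injOn : ∃ A : Set S1, IsClosed A ∧ A ∪ I0 δ ∪ I1 δ = univ ∧ InjOn α (A ×ˢ Ioo Φm Φp)
  map_zero : α (0, 0) = 0
  map_one : α (((1 : ℝ) : S1), 0) = 0
  /-- the origin is the only double point of `α` on `S¹ × {0}` -/
  double : ∀ Θ Θ' : S1, α (Θ, 0) = α (Θ', 0) → Θ = Θ' ∨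
    (Θ ∈ ({0, ((1 : ℝ) : S1)} : Set S1) ∧ Θ' ∈ ({0, ((1 : ℝ) : S1)} : Set S1))
  /-- the curve `α (S¹ × {0})` bounds zero area: `∫ x dy = 0` -/
  area_zero : ∫ Θ in (-1 : ℝ)..1,
    α ((Θ : S1), 0) 0 * deriv (fun t : ℝ => α ((t : S1), 0) 1) Θ = 0

/-! ### The construction -/

section Construction

variable {m : ℕ} {M : Type*} [TopologicalSpace M] [ChartedSpace (Eu (m + 1)) M]
  [IsManifold (𝓡 (m + 1)) ∞ M]
  {S : Type*} {L : Type*}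

/-- There is no Reeb chord of length at most `ℓ` with both end points on the Legendrian `Q : L → S`,
where `η` is the Reeb flow. For `ℓ = ∞` there is no Reeb chord at all. -/
def NoReebChord (η : ℝ → S → S) (Q : L → S) (ℓ : ℝ≥0∞) : Prop :=
  ∀ τ : ℝ, 0 < τ → ENNReal.ofReal τ ≤ ℓ → ∀ l l' : L, η τ (Q l) ≠ Q l'

/-- The time-one map of the translation by `t T dg` displaces `c ([0, ε] × S)`. -/
def Displaces (c : ℝ × S → Cot (n := m + 1) M) (ε : ℝ) (g : M → ℝ) (T : ℝ) : Prop :=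
  Disjoint (c '' (Icc 0 ε ×ˢ univ)) (translate (m + 1) g T '' (c '' (Icc 0 ε ×ˢ univ)))

/-- The parametrization `(l, t') ↦ (a(t'), η_{s(t')}(Q l))` of `W' ⊂ T^*M`. -/
def baseMap (c : ℝ × S → Cot (n := m + 1) M) (η : ℝ → S → S) (Q : L → S) (s a : S1 → ℝ)
    (w : L × S1) : Cot (n := m + 1) M :=
  c (a w.2, η (s w.2) (Q w.1))

/-- The isotopy `F'_t (l, t') = h^T_t (a(t'), η_{s(t')}(Q l))`, where `h^T_t` is the translation by
`t T dg`. -/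
def isotopy (c : ℝ × S → Cot (n := m + 1) M) (η : ℝ → S → S) (Q : L → S) (s a : S1 → ℝ)
    (g : M → ℝ) (T : ℝ) (w : L × S1) (t : ℝ) : Cot (n := m + 1) M :=
  translate (m + 1) g (t * T) (baseMap c η Q s a w)

/-- The function `ψ = T g` along `W'`. -/
def psi (c : ℝ × S → Cot (n := m + 1) M) (η : ℝ → S → S) (Q : L → S) (s a : S1 → ℝ)
    (g : M → ℝ) (T : ℝ) (w : L × S1) : ℝ :=
  T * g (baseMap c η Q s a w).1

/-- The function `Φ = T g ρ'(Θ)` on `W' × S¹`. -/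
def Phi (c : ℝ × S → Cot (n := m + 1) M) (η : ℝ → S → S) (Q : L → S) (s a : S1 → ℝ)
    (g : M → ℝ) (T : ℝ) (ρ : S1 → ℝ) (w : L × S1) (Θ : S1) : ℝ :=
  psi c η Q s a g T w * primeS1 ρ Θ

/-- The map `F (w', Θ) = (F'(w', ρ(Θ)), α(Θ, Φ(w', Θ)))` from `W' × S¹` to `T^*M × ℝ²`. -/
def figureEightMap (c : ℝ × S → Cot (n := m + 1) M) (η : ℝ → S → S) (Q : L → S) (s a : S1 → ℝ)
    (g : M → ℝ) (T : ℝ) (ρ : S1 → ℝ) (α : S1 × ℝ → Eu 2) (p : (L × S1) × S1) :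
    Cot (n := m + 1) M × Eu 2 :=
  (isotopy c η Q s a g T p.1 (ρ p.2), α (p.2, Phi c η Q s a g T ρ p.1 p.2))

/-- The lift to `(L × ℝ) × ℝ` of a map defined on `(L × S¹) × S¹`. -/
def lift {Y : Type*} (F : (L × S1) × S1 → Y) (p : (L × ℝ) × ℝ) : Y :=
  F ((p.1.1, (p.1.2 : S1)), (p.2 : S1))

variable (m)

/-- The model with corners of `(L × ℝ) × ℝ`, where `L` has dimension `m`. -/
abbrev liftModel : ModelWithCorners ℝ ((Eu m × ℝ) × ℝ) (ModelProd (ModelProd (Eu m) ℝ) ℝ) :=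
  ((𝓡 m).prod 𝓘(ℝ, ℝ)).prod 𝓘(ℝ, ℝ)

variable {m} [TopologicalSpace L] [ChartedSpace (Eu m) L]

/-- `F` is a Lagrangian embedding of the `(m + 2)`-manifold `(L × S¹) × S¹` into the symplectic
manifold `T^*M × ℝ²` of dimension `2 (m + 2)`. -/
structure IsLagrangianEmb (F : (L × S1) × S1 → Cot (n := m + 1) M × Eu 2) : Prop where
  isEmbedding : Topology.IsEmbedding F
  smooth : ContMDiff (liftModel m) (cotPlaneModel (m + 1)) ∞ (lift F)
  injective_mfderiv : ∀ p,
    Function.Injective (mfderiv (liftModel m) (cotPlaneModel (m + 1)) (lift F) p)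
  isotropic : ∀ p, ∀ u v : (Eu m × ℝ) × ℝ,
    omegaPlane (m + 1) (lift F p)
      (mfderiv (liftModel m) (cotPlaneModel (m + 1)) (lift F) p u)
      (mfderiv (liftModel m) (cotPlaneModel (m + 1)) (lift F) p v) = 0

/-- The 1-form `e^{a(t')} ds(t')` on `(L × S¹) × S¹`, written on `(L × ℝ) × ℝ`. It is the pull-back
of a form on the factor `L × S¹`. -/
def curveForm (s a : S1 → ℝ) : OneForm (liftModel m) ((L × ℝ) × ℝ) := fun p =>
  (Real.exp (a (p.1.2 : S1)) * derivS1 s p.1.2) •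
    (ContinuousLinearMap.snd ℝ (Eu m) ℝ).comp (ContinuousLinearMap.fst ℝ (Eu m × ℝ) ℝ)

/-- `F` is exact relative to `W'`: the pull-back of `∑ p_i dq_i + x dy` by `F` is
`e^{a(t')} ds(t') + dh` for a smooth function `h` on `(L × S¹) × S¹`. -/
def IsExactRel (s a : S1 → ℝ) (F : (L × S1) × S1 → Cot (n := m + 1) M × Eu 2) : Prop :=
  ∃ h : (L × S1) × S1 → ℝ, ContMDiff (liftModel m) 𝓘(ℝ, ℝ) ∞ (lift h) ∧
    ∀ p, pullbackForm (liftModel m) (cotPlaneModel (m + 1)) (lift F)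
        (liouvillePlane (m + 1)) p =
      curveForm s a p + dform (liftModel m) (lift h) p

end Construction

end FigureEight

end

/-! `F` is a Lagrangian suspension of the isotopy `h^T_t`, closed up over an immersed figure eight.
Translation of the fibres by `τ dg` changes `p dq` by `τ dg`. Hence the first component of `F` pulls
`p dq` back to its pull-back to `W'` plus `ρ dψ = d(ρψ) - Φ dΘ`, because `Φ = ψ ρ'`. The map `α`
takes `dx ∧ dy` to `dΦ ∧ dΘ` and its core bounds no area, so `α^*(x dy) = Φ dΘ + dk` with `k` single
valued on the annulus. The two terms `Φ dΘ` cancel, and only the form on `W'` and an exact form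
remain (`pb_localIsotopy`, `IsFigureEight.exists_primitive`, `exact_local`).

On `W'` the form `i_Z ω` restricts to `e^a ds`. The Reeb flow-out of a Legendrian pulls `λ` back to
`ds` since `i_X dλ = 0`, and the flow of `Z` multiplies this by `e^a`; both facts are instances of
the transport equation `transport_form`. As `d(i_Z ω) = ω`, the forms `p dq` and `i_Z ω` differ by a
closed form, which is `dβ` on the hypersurface and therefore exact along the collar, with the
explicit primitive `corePrimitive`. The form `e^{a(t')} ds(t')` depends on the single variable `t'`
and is closed, so differentiating the exactness relation shows that `F` is isotropic
(`isotropic_local`).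

Injectivity (`figureEightMap_injective`): double points of a thin annulus around the figure eight
lie over `I₀ ∪ I₁`, where `ρ' = 0`, so that `Φ = 0` and only the crossing of the core itself counts.
There the two sheets are `W'` and its image under `h^T_1`, which are disjoint by the choice of `T`.
On one sheet, two points can coincide only along a Reeb chord of length at most `ℓ`
(`baseMap_injective`). The immersion property is the infinitesimal version of the same argument
(`injective_mD_lift`). The required `T` exists because `dg` has no zeros, so large multiples of it
move a compact set off itself (`exists_disjoint_translate`).

The figure eight is `(sin πt, sin 2πt)`, thickened along its normal by the amount that preserves
area and then rescaled to an annulus of the required width. The width depends only on bounds for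
`Tg` on the compact collar and for `ρ'`, so `α` and `M₀` are fixed before `ℓ` and the curve. `M₀` is
taken large enough that `r₀` exceeds the radius of the image of `α`. -/

noncomputable section

namespace FigureEight

/-! ### Pull-backs of 1-forms to normed spaces and naturality of the exterior derivative -/

section LocalForms

open Filter Topology

variable {E : Type*} [NormedAddCommGroup E] [NormedSpace ℝ E]
  {H : Type*} [TopologicalSpace H] {I : ModelWithCorners ℝ E H}
  {X : Type*} [TopologicalSpace X] [ChartedSpace H X]
  {E' : Type*} [NormedAddCommGroup E'] [NormedSpace ℝ E']
  {H' : Type*} [TopologicalSpace H'] {J : ModelWithCorners ℝ E' H'}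
  {Y : Type*} [TopologicalSpace Y] [ChartedSpace H' Y]
  {E'' : Type*} [NormedAddCommGroup E''] [NormedSpace ℝ E'']
  {H'' : Type*} [TopologicalSpace H''] {K : ModelWithCorners ℝ E'' H''}
  {W : Type*} [TopologicalSpace W] [ChartedSpace H'' W]
  {V : Type*} [NormedAddCommGroup V] [NormedSpace ℝ V]
  {V' : Type*} [NormedAddCommGroup V'] [NormedSpace ℝ V']

/-- A 1-form at a point, as a functional on the model space. -/
def frm (ζ : OneForm I X) (x : X) : E →L[ℝ] ℝ := ζ x

variable (I J) in
/-- The differential of a map of manifolds, as a map of the model spaces. -/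
def mD (f : X → Y) (x : X) : E →L[ℝ] E' := mfderiv I J f x

theorem mD_comp {g : Y → W} {f : X → Y} (x : X) (hg : MDifferentiableAt J K g (f x))
    (hf : MDifferentiableAt I J f x) :
    mD I K (fun x => g (f x)) x = (mD J K g (f x)).comp (mD I J f x) :=
  mfderiv_comp x hg hf

theorem mD_congr {f f' : X → Y} {x : X} (h : f =ᶠ[𝓝 x] f') : mD I J f x = mD I J f' x :=
  h.mfderiv_eq

theorem mD_eq_fderiv (f : V → V') (x : V) : mD 𝓘(ℝ, V) 𝓘(ℝ, V') f x = fderiv ℝ f x :=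
  mfderiv_eq_fderiv

/-- The pull-back of a 1-form to a normed space, as a map into the dual space. -/
def pb (f : V → X) (ζ : OneForm I X) (v : V) : V →L[ℝ] ℝ :=
  (frm ζ (f v)).comp (mD 𝓘(ℝ, V) I f v)

theorem frm_pullbackForm (f : X → Y) (ζ : OneForm J Y) (x : X) :
    frm (pullbackForm I J f ζ) x = (frm ζ (f x)).comp (mD I J f x) := rfl

theorem chartForm_eq_pb (ζ : OneForm I X) (x₀ : X) :
    chartForm I ζ x₀ = pb (extChartAt I x₀).symm ζ := rfl

/-- A 1-form is smooth at `x` if its expression in the chart at `x` is. -/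
def FormSmoothAt (ζ : OneForm I X) (x : X) : Prop :=
  ContDiffAt ℝ ∞ (chartForm I ζ x) (extChartAt I x x)

theorem two_le_infty : (2 : WithTop ℕ∞) ≤ ((⊤ : ℕ∞) : WithTop ℕ∞) :=
  WithTop.coe_le_coe.2 (le_top : (2 : ℕ∞) ≤ ⊤)

variable [IsManifold I ∞ X]

theorem isManifold_one : IsManifold I 1 X := .of_le (n := ∞) (by simp)

theorem contDiffAt_extChartAt_comp {f : V → X} {v₀ : V} (hf : ContMDiffAt 𝓘(ℝ, V) I ∞ f v₀)
    {x₀ : X} (hx : f v₀ ∈ (extChartAt I x₀).source) :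
    ContDiffAt ℝ ∞ (fun v => extChartAt I x₀ (f v)) v₀ := by
  rw [← contMDiffAt_iff_contDiffAt]
  exact (contMDiffAt_extChartAt' (by simpa using hx)).comp v₀ hf

/-- The tangent space at `x` is identified with the model space by the preferred chart at `x`
itself. -/
theorem mD_extChartAt_self (x : X) :
    mD I 𝓘(ℝ, E) (extChartAt I x) x = ContinuousLinearMap.id ℝ E := by
  have : IsManifold I 1 X := isManifold_one
  exact mfderiv_extChartAt_self (I := I) (x := x)

theorem fderiv_extChartAt_comp {f : V → X} {v : V} (hf : MDifferentiableAt 𝓘(ℝ, V) I f v)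
    {x₀ : X} (hx : f v ∈ (extChartAt I x₀).source) :
    fderiv ℝ (fun v => extChartAt I x₀ (f v)) v =
      (mD I 𝓘(ℝ, E) (extChartAt I x₀) (f v)).comp (mD 𝓘(ℝ, V) I f v) := by
  have : IsManifold I 1 X := isManifold_one
  rw [← mD_eq_fderiv]
  exact mD_comp v (mdifferentiableAt_extChartAt (by simpa using hx)) hf

variable [I.Boundaryless]

theorem contMDiffAt_extChartAt_symm' (x₀ : X) {y : E} (hy : y ∈ (extChartAt I x₀).target) :
    ContMDiffAt 𝓘(ℝ, E) I ∞ (extChartAt I x₀).symm y :=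
  (contMDiffOn_extChartAt_symm x₀).contMDiffAt ((isOpen_extChartAt_target x₀).mem_nhds hy)

theorem mD_extChartAt_symm_comp (x₀ : X) {x : X} (hx : x ∈ (extChartAt I x₀).source) :
    (mD 𝓘(ℝ, E) I (extChartAt I x₀).symm (extChartAt I x₀ x)).comp
      (mD I 𝓘(ℝ, E) (extChartAt I x₀) x) = ContinuousLinearMap.id ℝ E := by
  have : IsManifold I 1 X := isManifold_one
  have h := mfderivWithin_extChartAt_symm_comp_mfderiv_extChartAt' (I := I) hx
  rw [ModelWithCorners.range_eq_univ, mfderivWithin_univ] at h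
  exact h

theorem mD_extChartAt_symm_self (x : X) :
    mD 𝓘(ℝ, E) I (extChartAt I x).symm (extChartAt I x x) = ContinuousLinearMap.id ℝ E := by
  have : IsManifold I 1 X := isManifold_one
  have h := mfderivWithin_range_extChartAt_symm (I := I) (x := x)
  rw [ModelWithCorners.range_eq_univ, mfderivWithin_univ] at h
  exact h

theorem pb_eq_chartForm_comp {f : V → X} {v : V} (hf : MDifferentiableAt 𝓘(ℝ, V) I f v)
    (ζ : OneForm I X) (x₀ : X) (hx : f v ∈ (extChartAt I x₀).source) :
    pb f ζ v = (chartForm I ζ x₀ (extChartAt I x₀ (f v))).comp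
      (fderiv ℝ (fun v => extChartAt I x₀ (f v)) v) := by
  rw [fderiv_extChartAt_comp hf hx, chartForm_eq_pb, pb, pb, ContinuousLinearMap.comp_assoc,
    ← ContinuousLinearMap.comp_assoc (mD 𝓘(ℝ, E) I _ _), mD_extChartAt_symm_comp x₀ hx,
    ContinuousLinearMap.id_comp, (extChartAt I x₀).left_inv hx]

theorem eventually_pb_eq {f : V → X} {v₀ : V} (hf : ContMDiffAt 𝓘(ℝ, V) I ∞ f v₀)
    (ζ : OneForm I X) {x₀ : X} (hx : f v₀ ∈ (extChartAt I x₀).source) :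
    pb f ζ =ᶠ[𝓝 v₀] fun v => (chartForm I ζ x₀ (extChartAt I x₀ (f v))).comp
      (fderiv ℝ (fun v => extChartAt I x₀ (f v)) v) := by
  have : IsManifold I 1 X := isManifold_one
  have h1 : ContMDiffAt 𝓘(ℝ, V) I 1 f v₀ := hf.of_le (by simp)
  have h2 := (contMDiffAt_iff_contMDiffAt_nhds (by simp)).1 h1
  have h3 := hf.continuousAt.preimage_mem_nhds ((isOpen_extChartAt_source x₀).mem_nhds hx)
  filter_upwards [h2, h3] with v hv hv'
  exact pb_eq_chartForm_comp (hv.mdifferentiableAt (by simp)) ζ x₀ hv'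

theorem contDiffAt_pb {f : V → X} {v₀ : V} (hf : ContMDiffAt 𝓘(ℝ, V) I ∞ f v₀)
    {ζ : OneForm I X} {x₀ : X} (hx : f v₀ ∈ (extChartAt I x₀).source)
    (hζ : ContDiffAt ℝ ∞ (chartForm I ζ x₀) (extChartAt I x₀ (f v₀))) :
    ContDiffAt ℝ ∞ (pb f ζ) v₀ := by
  refine ContDiffAt.congr_of_eventuallyEq ?_ (eventually_pb_eq hf ζ hx)
  have hF := contDiffAt_extChartAt_comp hf hx
  exact (hζ.comp v₀ hF).clm_comp (hF.fderiv_right (m := ∞) (by simp))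

theorem FormSmoothAt.contDiffAt_pb {f : V → X} {v₀ : V} (hf : ContMDiffAt 𝓘(ℝ, V) I ∞ f v₀)
    {ζ : OneForm I X} (hζ : FormSmoothAt ζ (f v₀)) : ContDiffAt ℝ ∞ (pb f ζ) v₀ :=
  FigureEight.contDiffAt_pb hf (mem_extChartAt_source _) hζ

/-- In the product rule for the coordinate expression, the terms with the second derivative of `f`
are symmetric and cancel. This is the naturality of `d`. -/
theorem fderiv_pb_antisymm_chart {f : V → X} {v₀ : V} (hf : ContMDiffAt 𝓘(ℝ, V) I ∞ f v₀)
    {ζ : OneForm I X} {x₀ : X} (hx : f v₀ ∈ (extChartAt I x₀).source)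
    (hζ : ContDiffAt ℝ ∞ (chartForm I ζ x₀) (extChartAt I x₀ (f v₀))) (u v : V) :
    fderiv ℝ (pb f ζ) v₀ u v - fderiv ℝ (pb f ζ) v₀ v u =
      fderiv ℝ (chartForm I ζ x₀) (extChartAt I x₀ (f v₀))
          (fderiv ℝ (fun v => extChartAt I x₀ (f v)) v₀ u)
          (fderiv ℝ (fun v => extChartAt I x₀ (f v)) v₀ v) -
        fderiv ℝ (chartForm I ζ x₀) (extChartAt I x₀ (f v₀))
          (fderiv ℝ (fun v => extChartAt I x₀ (f v)) v₀ v)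
          (fderiv ℝ (fun v => extChartAt I x₀ (f v)) v₀ u) := by
  have hF := contDiffAt_extChartAt_comp hf hx
  set F := fun v => extChartAt I x₀ (f v) with hFdef
  have hF' : DifferentiableAt ℝ (fderiv ℝ F) v₀ :=
    (hF.fderiv_right (m := 1) two_le_infty).differentiableAt (by simp)
  have hw : DifferentiableAt ℝ (chartForm I ζ x₀) (F v₀) := hζ.differentiableAt (by simp)
  have hwF := hw.hasFDerivAt.comp v₀ (hF.differentiableAt (by simp)).hasFDerivAt
  have hD := hwF.clm_comp hF'.hasFDerivAt
  rw [(eventually_pb_eq hf ζ hx).fderiv_eq]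
  have hsymm : fderiv ℝ (fderiv ℝ F) v₀ u v = fderiv ℝ (fderiv ℝ F) v₀ v u :=
    (hF.isSymmSndFDerivAt (by simpa [minSmoothness_of_isRCLikeNormedField] using two_le_infty)) u v
  have hD' : fderiv ℝ (fun v => (chartForm I ζ x₀ (extChartAt I x₀ (f v))).comp (fderiv ℝ F v)) v₀
      = _ := hD.fderiv
  rw [hD']
  have e : extChartAt I x₀ (f v₀) = F v₀ := rfl
  rw [e]
  simp [hsymm]

/-- The bridge from `extDer` to ordinary calculus: every later use of `dλ`, `ω` or `d(i_Z ω)` passes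
through the antisymmetrised derivative of a map into a dual space. -/
theorem fderiv_pb_antisymm {f : V → X} {v₀ : V} (hf : ContMDiffAt 𝓘(ℝ, V) I ∞ f v₀)
    {ζ : OneForm I X} (hζ : FormSmoothAt ζ (f v₀)) (u v : V) :
    fderiv ℝ (pb f ζ) v₀ u v - fderiv ℝ (pb f ζ) v₀ v u =
      extDer I ζ (f v₀) (mfderiv 𝓘(ℝ, V) I f v₀ u) (mfderiv 𝓘(ℝ, V) I f v₀ v) := by
  have : IsManifold I 1 X := isManifold_one
  rw [fderiv_pb_antisymm_chart hf (mem_extChartAt_source _) hζ,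
    fderiv_extChartAt_comp (hf.mdifferentiableAt (by simp)) (mem_extChartAt_source _)]
  rfl

end LocalForms

end FigureEight

end

noncomputable section

namespace FigureEight

/-! ### Canonical coordinates on the cotangent bundle -/

section CotangentCharts

open Filter Topology

variable {n : ℕ} {M : Type*} [TopologicalSpace M] [ChartedSpace (Eu n) M]
  [IsManifold (𝓡 n) ∞ M]

/-- The model vector space of the cotangent bundle. -/
abbrev CotE (n : ℕ) : Type := Eu n × (Eu n →L[ℝ] ℝ)

namespace CotInstances

scoped instance : NormedAddCommGroup (CotE n →L[ℝ] ℝ) := ContinuousLinearMap.toNormedAddCommGroup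

scoped instance : NormedSpace ℝ (CotE n →L[ℝ] ℝ) := ContinuousLinearMap.toNormedSpace

scoped instance : AddCommGroup (CotE n →L[ℝ] ℝ) := NormedAddCommGroup.toAddCommGroup

scoped instance : AddGroup (CotE n →L[ℝ] ℝ) := AddCommGroup.toAddGroup

scoped instance : NormedAddCommGroup (CotE n →L[ℝ] CotE n →L[ℝ] ℝ) :=
  ContinuousLinearMap.toNormedAddCommGroup

scoped instance : AddCommGroup (CotE n →L[ℝ] CotE n →L[ℝ] ℝ) := NormedAddCommGroup.toAddCommGroup

scoped instance : AddGroup (CotE n →L[ℝ] CotE n →L[ℝ] ℝ) := AddCommGroup.toAddGroup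

scoped instance : TopologicalSpace (Cot (n := n) M) :=
  Bundle.ContinuousLinearMap.topologicalSpaceTotalSpace _ _ _ _ _

scoped instance : ChartedSpace (ModelProd (Eu n) (Eu n →L[ℝ] ℝ)) (Cot (n := n) M) :=
  FiberBundle.chartedSpace

scoped instance : IsManifold (cotModel n) ∞ (Cot (n := n) M) := inferInstance

scoped instance : SeminormedAddCommGroup (CotE n →L[ℝ] ℝ) := NormedAddCommGroup.toSeminormedAddCommGroup

scoped instance : SeminormedAddCommGroup (CotE n →L[ℝ] CotE n →L[ℝ] ℝ) :=
  NormedAddCommGroup.toSeminormedAddCommGroup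

scoped instance : NormedSpace ℝ (CotE n →L[ℝ] CotE n →L[ℝ] ℝ) := ContinuousLinearMap.toNormedSpace

end CotInstances

open scoped CotInstances

/-- The covector of a point of the cotangent bundle. -/
def covec (z : Cot (n := n) M) : Eu n →L[ℝ] ℝ := z.2

/-- The covector in the trivialization of the cotangent bundle at `q₀`. -/
def covecAt (q₀ : M) (z : Cot (n := n) M) : Eu n →L[ℝ] ℝ :=
  (trivializationAt (Eu n →L[ℝ] ℝ)
    (fun q : M => TangentSpace (𝓡 n) q →L[ℝ] Trivial M ℝ q) q₀ z).2

/-- The trivialization of a bundle of homomorphisms is composition with the inverse trivialization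
of the tangent bundle, which is the differential of the inverse chart. -/
theorem covecAt_eq (q₀ : M) (z : Cot (n := n) M) (hz : z.1 ∈ (chartAt (Eu n) q₀).source) :
    covecAt q₀ z =
      (covec z).comp (mD 𝓘(ℝ, Eu n) (𝓡 n) (extChartAt (𝓡 n) q₀).symm (extChartAt (𝓡 n) q₀ z.1)) := by
  have : IsManifold (𝓡 n) 1 M := isManifold_one
  have h := TangentBundle.symmL_trivializationAt (I := 𝓡 n) hz
  rw [ModelWithCorners.range_eq_univ, mfderivWithin_univ] at h
  unfold mD
  rw [← h]
  ext v
  simp [covecAt, hom_trivializationAt_apply, ContinuousLinearMap.inCoordinates]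
  rfl

theorem extChartAt_cot (z₀ z : Cot (n := n) M) :
    extChartAt (cotModel n) z₀ z = (extChartAt (𝓡 n) z₀.1 z.1, covecAt z₀.1 z) := by
  rw [FiberBundle.extChartAt]
  rfl

theorem mem_extChartAt_cot_source (z₀ z : Cot (n := n) M) :
    z ∈ (extChartAt (cotModel n) z₀).source ↔ z.1 ∈ (chartAt (Eu n) z₀.1).source := by
  rw [FiberBundle.extChartAt]
  simp only [PartialEquiv.trans_source, PartialEquiv.prod_source, PartialEquiv.refl_source]
  simp
  exact fun h => h

theorem contMDiff_cot_proj : ContMDiff (cotModel n) (𝓡 n) ∞ (fun z : Cot (n := n) M => z.1) :=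
  contMDiff_proj _

/-- The tautological property of `p dq`: only the motion of the base point matters. -/
theorem pb_liouville {V : Type*} [NormedAddCommGroup V] [NormedSpace ℝ V] {f : V → Cot (n := n) M}
    {v : V} (hf : MDifferentiableAt 𝓘(ℝ, V) (cotModel n) f v) :
    pb f (liouville n) v = (covec (f v)).comp (mD 𝓘(ℝ, V) (𝓡 n) (fun v => (f v).1) v) := by
  rw [mD_comp (J := cotModel n) v (contMDiff_cot_proj.mdifferentiableAt (by simp)) hf]
  rfl

theorem proj_extChartAt_symm (z₀ : Cot (n := n) M) {y : CotE n}
    (hy : y ∈ (extChartAt (cotModel n) z₀).target) :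
    ((extChartAt (cotModel n) z₀).symm y).1 = (extChartAt (𝓡 n) z₀.1).symm y.1 := by
  have h1 := (extChartAt (cotModel n) z₀).right_inv hy
  have h2 := (extChartAt (cotModel n) z₀).map_target hy
  rw [mem_extChartAt_cot_source] at h2
  rw [extChartAt_cot] at h1
  rw [← (congrArg Prod.fst h1 : _), (extChartAt (𝓡 n) z₀.1).left_inv (by simpa using h2)]

theorem mem_target_of_mem_extChartAt_cot_target (z₀ : Cot (n := n) M) {y : CotE n}
    (hy : y ∈ (extChartAt (cotModel n) z₀).target) : y.1 ∈ (extChartAt (𝓡 n) z₀.1).target := by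
  have h1 := (extChartAt (cotModel n) z₀).right_inv hy
  have h2 := (extChartAt (cotModel n) z₀).map_target hy
  rw [mem_extChartAt_cot_source] at h2
  rw [extChartAt_cot] at h1
  rw [← (congrArg Prod.fst h1 : _)]
  exact (extChartAt (𝓡 n) z₀.1).map_source (by simpa using h2)

/-- The Liouville form in the charts of the cotangent bundle is `∑ p_i dq_i`. -/
theorem chartForm_liouville (z₀ : Cot (n := n) M) {y : CotE n}
    (hy : y ∈ (extChartAt (cotModel n) z₀).target) :
    chartForm (cotModel n) (liouville n) z₀ y =
      y.2.comp (ContinuousLinearMap.fst ℝ (Eu n) (Eu n →L[ℝ] ℝ)) := by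
  have h1 := (extChartAt (cotModel n) z₀).right_inv hy
  have h2 := (extChartAt (cotModel n) z₀).map_target hy
  rw [mem_extChartAt_cot_source] at h2
  rw [extChartAt_cot] at h1
  have hs := contMDiffAt_extChartAt_symm' z₀ hy
  rw [chartForm_eq_pb, pb_liouville (hs.mdifferentiableAt (by simp))]
  have h3 : (fun v => ((extChartAt (cotModel n) z₀).symm v).1) =ᶠ[𝓝 y]
      fun v => (extChartAt (𝓡 n) z₀.1).symm v.1 := by
    filter_upwards [(isOpen_extChartAt_target z₀).mem_nhds hy] with v hv
    exact proj_extChartAt_symm z₀ hv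
  rw [mD_congr h3, mD_comp (J := 𝓘(ℝ, Eu n)) (g := (extChartAt (𝓡 n) z₀.1).symm) (f := Prod.fst) y
    ((contMDiffAt_extChartAt_symm' z₀.1
      (mem_target_of_mem_extChartAt_cot_target z₀ hy)).mdifferentiableAt (by simp))
    (differentiableAt_fst.mdifferentiableAt), mD_eq_fderiv, fderiv_fst,
    ← ContinuousLinearMap.comp_assoc]
  congr 1
  have h4 := covecAt_eq z₀.1 _ h2
  have h5 := congrArg Prod.fst h1
  have h6 := congrArg Prod.snd h1
  dsimp only at h5 h6
  rw [h5, h6] at h4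
  exact h4.symm

theorem chartForm_liouville_eventuallyEq (z₀ : Cot (n := n) M) {y : CotE n}
    (hy : y ∈ (extChartAt (cotModel n) z₀).target) :
    chartForm (cotModel n) (liouville n) z₀ =ᶠ[𝓝 y] fun y =>
      y.2.comp (ContinuousLinearMap.fst ℝ (Eu n) (Eu n →L[ℝ] ℝ)) := by
  filter_upwards [(isOpen_extChartAt_target z₀).mem_nhds hy] with v hv
  exact chartForm_liouville z₀ hv

/-- The standard symplectic form of `ℝⁿ × (ℝⁿ)*`. -/
def stdOmega (n : ℕ) : CotE n →L[ℝ] CotE n →L[ℝ] ℝ :=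
  let D := ((ContinuousLinearMap.compL ℝ (CotE n) (Eu n) ℝ).flip
    (ContinuousLinearMap.fst ℝ (Eu n) (Eu n →L[ℝ] ℝ))).comp
      (ContinuousLinearMap.snd ℝ (Eu n) (Eu n →L[ℝ] ℝ))
  D - D.flip

theorem stdOmega_apply (u v : CotE n) :
    stdOmega n u v = u.2 v.1 - v.2 u.1 := by
  simp [stdOmega]

theorem fderiv_chartForm_liouville (z₀ : Cot (n := n) M) {y : CotE n}
    (hy : y ∈ (extChartAt (cotModel n) z₀).target) (u v : CotE n) :
    fderiv ℝ (chartForm (cotModel n) (liouville n) z₀) y u v = u.2 v.1 := by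
  rw [(chartForm_liouville_eventuallyEq z₀ hy).fderiv_eq]
  have h : HasFDerivAt (fun y : CotE n =>
      y.2.comp (ContinuousLinearMap.fst ℝ (Eu n) (Eu n →L[ℝ] ℝ))) _ y :=
    (((ContinuousLinearMap.compL ℝ (CotE n) (Eu n) ℝ).flip
    (ContinuousLinearMap.fst ℝ (Eu n) (Eu n →L[ℝ] ℝ))).comp
      (ContinuousLinearMap.snd ℝ (Eu n) (Eu n →L[ℝ] ℝ))).hasFDerivAt
  rw [h.fderiv]
  simp

theorem formSmoothAt_liouville (z : Cot (n := n) M) : FormSmoothAt (liouville n) z := by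
  refine ContDiffAt.congr_of_eventuallyEq ?_
    (chartForm_liouville_eventuallyEq z (mem_extChartAt_target z))
  exact contDiffAt_snd.clm_comp contDiffAt_const

/-- The symplectic form as a bilinear form on the model space. -/
def om (z : Cot (n := n) M) :
    CotE n →L[ℝ] CotE n →L[ℝ] ℝ := omega n z

/-- Bundle charts are canonical coordinates, and the chart at `z` has the identity as its
differential at `z`. So `ω` at `z` is the constant form on the model space, with no change of basis.
-/
theorem om_eq (z : Cot (n := n) M) : om z = stdOmega n := by
  refine ContinuousLinearMap.ext fun u => ContinuousLinearMap.ext fun v => ?_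
  have h1 : om z u v = fderiv ℝ (chartForm (cotModel n) (liouville n) z) (extChartAt (cotModel n) z z)
      (mD (cotModel n) 𝓘(ℝ, CotE n) (extChartAt (cotModel n) z) z u)
      (mD (cotModel n) 𝓘(ℝ, CotE n) (extChartAt (cotModel n) z) z v) -
      fderiv ℝ (chartForm (cotModel n) (liouville n) z) (extChartAt (cotModel n) z z)
      (mD (cotModel n) 𝓘(ℝ, CotE n) (extChartAt (cotModel n) z) z v)
      (mD (cotModel n) 𝓘(ℝ, CotE n) (extChartAt (cotModel n) z) z u) := rfl
  rw [h1, mD_extChartAt_self, fderiv_chartForm_liouville z (mem_extChartAt_target z),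
    fderiv_chartForm_liouville z (mem_extChartAt_target z), stdOmega_apply]
  rfl

theorem fderiv_pb_liouville_antisymm {V : Type*} [NormedAddCommGroup V] [NormedSpace ℝ V]
    {f : V → Cot (n := n) M} {v₀ : V} (hf : ContMDiffAt 𝓘(ℝ, V) (cotModel n) ∞ f v₀) (u v : V) :
    fderiv ℝ (pb f (liouville n)) v₀ u v - fderiv ℝ (pb f (liouville n)) v₀ v u =
      stdOmega n (mD 𝓘(ℝ, V) (cotModel n) f v₀ u) (mD 𝓘(ℝ, V) (cotModel n) f v₀ v) := by
  rw [fderiv_pb_antisymm hf (formSmoothAt_liouville _), ← om_eq (f v₀)]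
  rfl

/-- Charts are symplectic. This complements `om_eq`, which uses a different chart at each point,
whereas smoothness has to be tested in one fixed chart. -/
theorem stdOmega_mD_extChartAt_symm (z₀ : Cot (n := n) M) {y : CotE n}
    (hy : y ∈ (extChartAt (cotModel n) z₀).target) (u v : CotE n) :
    stdOmega n (mD 𝓘(ℝ, CotE n) (cotModel n) (extChartAt (cotModel n) z₀).symm y u)
      (mD 𝓘(ℝ, CotE n) (cotModel n) (extChartAt (cotModel n) z₀).symm y v) = stdOmega n u v := by
  rw [← fderiv_pb_liouville_antisymm (contMDiffAt_extChartAt_symm' z₀ hy), ← chartForm_eq_pb,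
    fderiv_chartForm_liouville z₀ hy, fderiv_chartForm_liouville z₀ hy, stdOmega_apply]

/-- A vector field at a point, as an element of the model space. -/
def fld {E : Type*} [NormedAddCommGroup E] [NormedSpace ℝ E]
    {H : Type*} [TopologicalSpace H] {I : ModelWithCorners ℝ E H}
    {X : Type*} [TopologicalSpace X] [ChartedSpace H X]
    (Z : ∀ x : X, TangentSpace I x) (x : X) : E := Z x

theorem frm_contractOmega (Z : ∀ z : Cot (n := n) M, TangentSpace (cotModel n) z)
    (z : Cot (n := n) M) : frm (contractOmega n Z) z = stdOmega n (fld Z z) := by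
  rw [← om_eq z]
  rfl

theorem contDiffAt_field_chart {E : Type*} [NormedAddCommGroup E] [NormedSpace ℝ E]
    {H : Type*} [TopologicalSpace H] {I : ModelWithCorners ℝ E H} [I.Boundaryless]
    {X : Type*} [TopologicalSpace X] [ChartedSpace H X] [IsManifold I ∞ X]
    {Z : ∀ x : X, TangentSpace I x} {x₀ : X}
    (hZ : ContMDiffAt I I.tangent ∞ (fun x => (⟨x, Z x⟩ : TangentBundle I X)) x₀) :
    ContDiffAt ℝ ∞ (fun y => mD I 𝓘(ℝ, E) (extChartAt I x₀) ((extChartAt I x₀).symm y)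
      (fld Z ((extChartAt I x₀).symm y))) (extChartAt I x₀ x₀) := by
  have : IsManifold I 1 X := isManifold_one
  have h1 := (contMDiffAt_section (F := E) (E := TangentSpace I) x₀).1 hZ
  have h2 : ContMDiffAt I 𝓘(ℝ, E) ∞ (fun x => mD I 𝓘(ℝ, E) (extChartAt I x₀) x (fld Z x)) x₀ := by
    refine h1.congr_of_eventuallyEq ?_
    filter_upwards [(chartAt H x₀).open_source.mem_nhds (mem_chart_source H x₀)] with x hx
    have h := TangentBundle.continuousLinearMapAt_trivializationAt (I := I) hx
    rw [mD, ← h]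
    exact (Trivialization.continuousLinearMapAt_apply_of_mem ℝ
      (trivializationAt E (TangentSpace I) x₀) (by simpa using hx) _)
  rw [← contMDiffAt_iff_contDiffAt]
  have h3 := contMDiffAt_extChartAt_symm' (I := I) x₀ (mem_extChartAt_target x₀)
  exact ContMDiffAt.comp (extChartAt I x₀ x₀) (by rwa [extChartAt_to_inv]) h3

/-- Since the chart is symplectic, `i_Z ω` is in coordinates the constant form contracted with the
coordinate expression of `Z`. -/
theorem formSmoothAt_contractOmega {Z : ∀ z : Cot (n := n) M, TangentSpace (cotModel n) z}
    {z₀ : Cot (n := n) M} (hZ : ContMDiffAt (cotModel n) (cotModel n).tangent ∞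
      (fun z => (⟨z, Z z⟩ : TangentBundle (cotModel n) (Cot (n := n) M))) z₀) :
    FormSmoothAt (contractOmega n Z) z₀ := by
  have h := contDiffAt_field_chart hZ
  refine ContDiffAt.congr_of_eventuallyEq (f := fun y => stdOmega n
    (mD (cotModel n) 𝓘(ℝ, CotE n) (extChartAt (cotModel n) z₀) ((extChartAt (cotModel n) z₀).symm y)
      (fld Z ((extChartAt (cotModel n) z₀).symm y)))) ?_ ?_
  · exact ((stdOmega n).contDiff.contDiffAt).comp _ h
  · filter_upwards [(isOpen_extChartAt_target z₀).mem_nhds (mem_extChartAt_target z₀)] with y hy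
    refine ContinuousLinearMap.ext fun v => ?_
    have h1 := mD_extChartAt_symm_comp z₀ ((extChartAt (cotModel n) z₀).map_target hy)
    rw [(extChartAt (cotModel n) z₀).right_inv hy] at h1
    rw [← stdOmega_mD_extChartAt_symm z₀ hy,
      ← ContinuousLinearMap.comp_apply (mD 𝓘(ℝ, CotE n) (cotModel n) _ y) _ (fld Z _), h1,
      chartForm_eq_pb, pb, frm_contractOmega]
    rfl

end CotangentCharts
end FigureEight
end

noncomputable section

set_option linter.unusedSectionVars false

namespace FigureEight

/-! ### Fibre translations and displacement of compact sets -/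

section CotangentTranslation

open Filter Topology
open scoped CotInstances

variable {n : ℕ} {M : Type*} [TopologicalSpace M] [ChartedSpace (Eu n) M]
  [IsManifold (𝓡 n) ∞ M]

/-- Points of one fibre are separated in a trivialization, all others in the base. The Hausdorff
property later turns a continuous injection of a compact space into an embedding. -/
instance [T2Space M] : T2Space (Cot (n := n) M) := by
  refine ⟨fun z w hzw => ?_⟩
  by_cases h : z.1 = w.1
  · set e := trivializationAt (Eu n →L[ℝ] ℝ)
      (fun q : M => TangentSpace (𝓡 n) q →L[ℝ] Trivial M ℝ q) z.1 with he
    have hz : z ∈ e.source := by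
      rw [e.mem_source]; exact FiberBundle.mem_baseSet_trivializationAt' _
    have hw : w ∈ e.source := by
      rw [e.mem_source, ← show z.1 = w.1 from h]; exact FiberBundle.mem_baseSet_trivializationAt' _
    have hne : e z ≠ e w := fun h' => hzw (e.injOn hz hw h')
    obtain ⟨A, B, hA, hB, hzA, hwB, hAB⟩ := t2_separation hne
    exact ⟨e.source ∩ e ⁻¹' A, e.source ∩ e ⁻¹' B,
      e.continuousOn.isOpen_inter_preimage e.open_source hA,
      e.continuousOn.isOpen_inter_preimage e.open_source hB, ⟨hz, hzA⟩, ⟨hw, hwB⟩,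
      (hAB.preimage e).mono inter_subset_right inter_subset_right⟩
  · obtain ⟨A, B, hA, hB, hzA, hwB, hAB⟩ := t2_separation h
    have hc : Continuous (fun z : Cot (n := n) M => z.1) := contMDiff_cot_proj.continuous
    exact ⟨_, _, hA.preimage hc, hB.preimage hc, hzA, hwB, hAB.preimage _⟩

theorem covec_translate (g : M → ℝ) (τ : ℝ) (z : Cot (n := n) M) :
    covec (translate n g τ z) = covec z + τ • mD (𝓡 n) 𝓘(ℝ, ℝ) g z.1 := rfl

theorem covecAt_translate {g : M → ℝ} (hg : ContMDiff (𝓡 n) 𝓘(ℝ, ℝ) ∞ g) (τ : ℝ) (q₀ : M)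
    (z : Cot (n := n) M) (hz : z.1 ∈ (chartAt (Eu n) q₀).source) :
    covecAt q₀ (translate n g τ z) = covecAt q₀ z +
      τ • fderiv ℝ (fun y => g ((extChartAt (𝓡 n) q₀).symm y)) (extChartAt (𝓡 n) q₀ z.1) := by
  have hz' : z.1 ∈ (extChartAt (𝓡 n) q₀).source := by simpa using hz
  rw [covecAt_eq q₀ (translate n g τ z) hz, covecAt_eq q₀ z hz, covec_translate, ← mD_eq_fderiv,
    mD_comp (J := 𝓡 n) _ (hg.mdifferentiableAt (by simp))
    ((contMDiffAt_extChartAt_symm' q₀ ((extChartAt (𝓡 n) q₀).map_source hz')).mdifferentiableAt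
      (by simp)), (extChartAt (𝓡 n) q₀).left_inv hz', ContinuousLinearMap.add_comp,
    ContinuousLinearMap.smul_comp]
  rfl

theorem contDiffAt_comp_extChartAt_symm {g : M → ℝ} (hg : ContMDiff (𝓡 n) 𝓘(ℝ, ℝ) ∞ g) {q₀ q : M}
    (hq : q ∈ (chartAt (Eu n) q₀).source) :
    ContDiffAt ℝ ∞ (fun y => g ((extChartAt (𝓡 n) q₀).symm y)) (extChartAt (𝓡 n) q₀ q) := by
  rw [← contMDiffAt_iff_contDiffAt]
  exact hg.contMDiffAt.comp _ (contMDiffAt_extChartAt_symm' q₀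
    ((extChartAt (𝓡 n) q₀).map_source (by simpa using hq)))

theorem contMDiff_translate {g : M → ℝ} (hg : ContMDiff (𝓡 n) 𝓘(ℝ, ℝ) ∞ g) :
    ContMDiff (𝓘(ℝ, ℝ).prod (cotModel n)) (cotModel n) ∞
      (fun p : ℝ × Cot (n := n) M => translate n g p.1 p.2) := by
  rintro ⟨τ₀, z₀⟩
  rw [contMDiffAt_totalSpace]
  have h1 : ContMDiffAt (𝓘(ℝ, ℝ).prod (cotModel n)) (cotModel n) ∞
    (fun p : ℝ × Cot (n := n) M => p.2) (τ₀, z₀) := contMDiffAt_snd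
  have h2 := contMDiffAt_totalSpace.1 h1
  refine ⟨h2.1, ?_⟩
  have h3 : ContMDiffAt (𝓘(ℝ, ℝ).prod (cotModel n)) 𝓘(ℝ, ℝ) ∞
    (fun p : ℝ × Cot (n := n) M => p.1) (τ₀, z₀) := contMDiffAt_fst
  have hz₀ := mem_chart_source (Eu n) z₀.1
  have h4 : ContMDiffAt (𝓡 n) 𝓘(ℝ, Eu n →L[ℝ] ℝ) ∞ (fun q => fderiv ℝ
      (fun y => g ((extChartAt (𝓡 n) z₀.1).symm y)) (extChartAt (𝓡 n) z₀.1 q)) z₀.1 :=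
    (((contDiffAt_comp_extChartAt_symm hg hz₀).fderiv_right (m := ∞) (by simp)).contMDiffAt).comp
      z₀.1 contMDiffAt_extChartAt
  have h5 := h2.2.add (h3.smul (h4.comp (τ₀, z₀) h2.1))
  refine h5.congr_of_eventuallyEq ?_
  have h6 := h2.1.continuousAt.preimage_mem_nhds
    ((chartAt (Eu n) z₀.1).open_source.mem_nhds hz₀)
  filter_upwards [h6] with p hp
  exact covecAt_translate hg p.1 z₀.1 p.2 hp

theorem translate_add (g : M → ℝ) (τ τ' : ℝ) (z : Cot (n := n) M) :
    translate n g τ (translate n g τ' z) = translate n g (τ + τ') z := by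
  have : covec z + τ' • mD (𝓡 n) 𝓘(ℝ, ℝ) g z.1 + τ • mD (𝓡 n) 𝓘(ℝ, ℝ) g z.1 =
      covec z + (τ + τ') • mD (𝓡 n) 𝓘(ℝ, ℝ) g z.1 := by
    rw [add_smul]; abel
  exact congrArg (TotalSpace.mk z.1) this

theorem translate_zero (g : M → ℝ) (z : Cot (n := n) M) : translate n g 0 z = z := by
  have : covec z + (0 : ℝ) • mD (𝓡 n) 𝓘(ℝ, ℝ) g z.1 = covec z := by simp
  exact congrArg (TotalSpace.mk z.1) this

theorem continuousAt_covecAt (z : Cot (n := n) M) : ContinuousAt (covecAt z.1) z :=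
  (contMDiffAt_totalSpace.1 (contMDiffAt_id (I := cotModel n) (n := ∞) (x := z))).2.continuousAt

/-- A function without critical points displaces compact sets of the cotangent bundle. -/
theorem exists_disjoint_translate [T2Space M] {g : M → ℝ} (hg : ContMDiff (𝓡 n) 𝓘(ℝ, ℝ) ∞ g)
    (hg_crit : ∀ q, mfderiv (𝓡 n) 𝓘(ℝ, ℝ) g q ≠ 0) {K : Set (Cot (n := n) M)} (hK : IsCompact K) :
    ∃ T : ℝ, 0 < T ∧ Disjoint K (translate n g T '' K) := by
  by_contra! hcon
  -- The translation times are `k + 1`, positive and unbounded.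
  have h1 : ∀ k : ℕ, ∃ z ∈ K, translate n g (k + 1) z ∈ K := by
    intro k
    obtain ⟨_, hw, z, hz, rfl⟩ := Set.not_disjoint_iff.1 (hcon (k + 1) (by positivity))
    exact ⟨z, hz, hw⟩
  choose z hz hz' using h1
  -- A free ultrafilter replaces the choice of convergent subsequences in the compact set.
  let F : Ultrafilter ℕ := hyperfilter ℕ
  have hF : (F : Filter ℕ) ≤ atTop := Nat.hyperfilter_le_atTop
  obtain ⟨w, -, hw⟩ := hK.ultrafilter_le_nhds (F.map z)
    (le_principal_iff.2 (Ultrafilter.mem_map.2 (mem_of_superset univ_mem fun k _ => hz k)))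
  obtain ⟨w', -, hw'⟩ := hK.ultrafilter_le_nhds
    (F.map fun k : ℕ => translate n g (k + 1) (z k))
    (le_principal_iff.2 (Ultrafilter.mem_map.2 (mem_of_superset univ_mem fun k _ => hz' k)))
  replace hw : Tendsto z F (𝓝 w) := hw
  replace hw' : Tendsto (fun k : ℕ => translate n g (k + 1) (z k)) F (𝓝 w') := hw'
  have hproj : Continuous (fun z : Cot (n := n) M => z.1) := contMDiff_cot_proj.continuous
  have h2 : Tendsto (fun k => (z k).1) F (𝓝 w.1) := (hproj.tendsto w).comp hw
  have h3 : Tendsto (fun k => (z k).1) F (𝓝 w'.1) := ((hproj.tendsto w').comp hw' :)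
  -- Translations preserve fibres, so both limits lie over the same point and one trivialization
  -- serves for both.
  have h4 : w.1 = w'.1 := tendsto_nhds_unique h2 h3
  have h5 := (continuousAt_covecAt w).tendsto.comp hw
  have h6 := (continuousAt_covecAt w').tendsto.comp hw'
  rw [← h4] at h6
  have hq := mem_chart_source (Eu n) w.1
  have h7 : Tendsto (fun k => fderiv ℝ (fun y => g ((extChartAt (𝓡 n) w.1).symm y))
      (extChartAt (𝓡 n) w.1 (z k).1)) F
      (𝓝 (fderiv ℝ (fun y => g ((extChartAt (𝓡 n) w.1).symm y)) (extChartAt (𝓡 n) w.1 w.1))) :=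
    (((contDiffAt_comp_extChartAt_symm hg hq).fderiv_right (m := ∞) (by simp)).continuousAt.tendsto.comp
      (continuousAt_extChartAt w.1).tendsto).comp h2
  have h8 : fderiv ℝ (fun y => g ((extChartAt (𝓡 n) w.1).symm y)) (extChartAt (𝓡 n) w.1 w.1) ≠ 0 := by
    rw [← mD_eq_fderiv, mD_comp (J := 𝓡 n) _ (hg.mdifferentiableAt (by simp))
      ((contMDiffAt_extChartAt_symm' w.1 (mem_extChartAt_target w.1)).mdifferentiableAt (by simp)),
      mD_extChartAt_symm_self, extChartAt_to_inv, ContinuousLinearMap.comp_id]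
    exact hg_crit w.1
  have h9 := (h6.sub h5).norm
  have h10 : Tendsto (fun k : ℕ => ((k : ℝ) + 1)) F atTop :=
    (tendsto_atTop_add_const_right _ _ tendsto_natCast_atTop_atTop).mono_left hF
  have h11 := h10.atTop_mul_pos (norm_pos_iff.2 h8) h7.norm
  -- In this trivialization the two covectors differ by `(k + 1) dg`. The norm of the difference
  -- would converge and also tend to infinity, as `dg ≠ 0` at the limit point.
  refine not_tendsto_nhds_of_tendsto_atTop h11 _ (h9.congr' ?_)
  filter_upwards [h2.eventually ((chartAt (Eu n) w.1).open_source.mem_nhds hq)] with k hk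
  simp only [Function.comp]
  rw [covecAt_translate hg _ _ _ hk, add_sub_cancel_left, norm_smul, Real.norm_of_nonneg]
  positivity

end CotangentTranslation
end FigureEight
end

noncomputable section

set_option linter.unusedSectionVars false

namespace FigureEight

/-! ### The transport equation for 1-forms along a flow direction -/

section Transport

open Filter Topology

variable {W : Type*} [NormedAddCommGroup W] [NormedSpace ℝ W]

/-- A 1-form `κ` on `J × B` with `κ(∂_t)` constant and `i_{∂_t} dκ = μ κ` in the directions of `B` is
determined along `J` by its restriction to `t = 0`. -/
theorem transport_form {J : Set ℝ} (hJ : IsOpen J) (hJc : IsPreconnected J) (h0 : (0 : ℝ) ∈ J)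
    {B : Set W} (hB : IsOpen B) {κ : ℝ × W → (ℝ × W) →L[ℝ] ℝ} {c₀ μ : ℝ}
    (hκ : ∀ p ∈ J ×ˢ B, DifferentiableAt ℝ κ p)
    (h1 : ∀ p ∈ J ×ˢ B, κ p (1, 0) = c₀)
    (h2 : ∀ p ∈ J ×ˢ B, ∀ w : W,
      fderiv ℝ κ p (1, 0) (0, w) - fderiv ℝ κ p (0, w) (1, 0) = μ * κ p (0, w))
    {t : ℝ} (ht : t ∈ J) {y : W} (hy : y ∈ B) (w : W) :
    κ (t, y) (0, w) = Real.exp (μ * t) * κ (0, y) (0, w) := by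
  -- As `κ(∂_t)` is constant, one half of `dκ(∂_t, w)` vanishes and the hypothesis becomes the
  -- linear equation `∂_t κ(w) = μ κ(w)`. It is solved below with the integrating factor `exp(-μt)`.
  have h3 : ∀ p ∈ J ×ˢ B, fderiv ℝ κ p (0, w) (1, 0) = 0 := by
    intro p hp
    have h4 : HasFDerivAt (fun p => κ p (1, 0)) ((fderiv ℝ κ p).flip (1, 0)) p := by
      simpa using (hκ p hp).hasFDerivAt.clm_apply (hasFDerivAt_const ((1, 0) : ℝ × W) p)
    have h5 : (fun p => κ p (1, 0)) =ᶠ[𝓝 p] fun _ => c₀ := by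
      filter_upwards [(hJ.prod hB).mem_nhds hp] with q hq using h1 q hq
    have h6 := h4.fderiv
    rw [h5.fderiv_eq, fderiv_const_apply] at h6
    exact (congrArg (fun D : (ℝ × W) →L[ℝ] ℝ => D (0, w)) h6).symm
  have h4 : ∀ t ∈ J, HasDerivAt (fun t => Real.exp (-(μ * t)) * κ (t, y) (0, w)) 0 t := by
    intro t ht
    have hp : (t, y) ∈ J ×ˢ B := ⟨ht, hy⟩
    have h5 : HasDerivAt (fun t : ℝ => ((t, y) : ℝ × W)) (1, 0) t :=
      (hasDerivAt_id t).prodMk (hasDerivAt_const t y)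
    have h6 : HasDerivAt (fun t => κ (t, y)) (fderiv ℝ κ (t, y) (1, 0)) t :=
      (hκ _ hp).hasFDerivAt.comp_hasDerivAt t h5
    have h7 := h6.clm_apply (hasDerivAt_const t ((0, w) : ℝ × W))
    have h8 := (((hasDerivAt_id t).const_mul μ).neg.exp).mul h7
    have h9 := h2 _ hp w
    rw [h3 _ hp, sub_zero] at h9
    refine HasDerivAt.congr_deriv h8 ?_
    rw [h9]
    simp
    ring
  have h5 := hJ.is_const_of_deriv_eq_zero hJc
    (fun t ht => (h4 t ht).differentiableAt.differentiableWithinAt) (fun t ht => (h4 t ht).deriv) ht h0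
  simp only [mul_zero, neg_zero, Real.exp_zero, one_mul] at h5
  rw [← h5, ← mul_assoc, ← Real.exp_add]
  simp

end Transport

/-! ### The Reeb flow-out of the Legendrian and the flow of the Liouville field -/

section Core

open Filter Topology
open scoped CotInstances

variable {m : ℕ} {M : Type*} [TopologicalSpace M] [ChartedSpace (Eu (m + 1)) M]
  [IsManifold (𝓡 (m + 1)) ∞ M]
  {S : Type*} [TopologicalSpace S] [ChartedSpace (Eu (2 * m + 1)) S]
  [IsManifold (𝓡 (2 * m + 1)) ∞ S]
  {L : Type*} [TopologicalSpace L] [ChartedSpace (Eu m) L] [IsManifold (𝓡 m) ∞ L]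
  {U : Set (Cot (n := m + 1) M)} {Z : ∀ z : Cot (n := m + 1) M, TangentSpace (cotModel (m + 1)) z}
  {j : S → Cot (n := m + 1) M} {R : ∀ x : S, TangentSpace (𝓡 (2 * m + 1)) x} {η : ℝ → S → S}
  {Q : L → S} {ε₀ : ℝ} {c : ℝ × S → Cot (n := m + 1) M}

/-- The Reeb flow-out of the Legendrian in the chart of `L` at `l₀`. -/
def reebMap (η : ℝ → S → S) (Q : L → S) (l₀ : L) (u : ℝ × Eu m) : S :=
  η u.1 (Q ((extChartAt (𝓡 m) l₀).symm u.2))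

/-- The map `(a, s, y) ↦ (a, η_s (Q y))` in the chart of `L` at `l₀`. -/
def coreMap (c : ℝ × S → Cot (n := m + 1) M) (η : ℝ → S → S) (Q : L → S) (l₀ : L)
    (v : ℝ × (ℝ × Eu m)) : Cot (n := m + 1) M :=
  c (v.1, reebMap η Q l₀ v.2)

/-- A primitive of `p dq - e^a ds` along `(a, η_s (Q l))`. -/
def corePrimitive (Z : ∀ z : Cot (n := m + 1) M, TangentSpace (cotModel (m + 1)) z)
    (c : ℝ × S → Cot (n := m + 1) M) (β : S → ℝ) (a : ℝ) (x : S) : ℝ :=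
  β x + ∫ b in (0 : ℝ)..a, frm (liouville (m + 1)) (c (b, x)) (fld Z (c (b, x)))

theorem contMDiffAt_reebMap (hη : IsFlow (𝓡 (2 * m + 1)) R η)
    (hQ : IsSmoothEmb (𝓡 m) (𝓡 (2 * m + 1)) Q) (l₀ : L) {u : ℝ × Eu m}
    (hu : u.2 ∈ (extChartAt (𝓡 m) l₀).target) :
    ContMDiffAt 𝓘(ℝ, ℝ × Eu m) (𝓡 (2 * m + 1)) ∞ (reebMap η Q l₀) u := by
  have h1 : ContMDiffAt 𝓘(ℝ, ℝ × Eu m) 𝓘(ℝ, ℝ) ∞ (fun u : ℝ × Eu m => u.1) u :=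
    contDiffAt_fst.contMDiffAt
  have h2 : ContMDiffAt 𝓘(ℝ, ℝ × Eu m) 𝓘(ℝ, Eu m) ∞ (fun u : ℝ × Eu m => u.2) u :=
    contDiffAt_snd.contMDiffAt
  exact (hη.contMDiff.contMDiffAt).comp u (h1.prodMk
    ((hQ.contMDiff.contMDiffAt).comp u ((contMDiffAt_extChartAt_symm' l₀ hu).comp u h2)))

theorem contMDiffAt_coreMap (hη : IsFlow (𝓡 (2 * m + 1)) R η)
    (hQ : IsSmoothEmb (𝓡 m) (𝓡 (2 * m + 1)) Q)
    (hc : IsFlowCollar (m + 1) (k := 2 * m + 1) U Z j ε₀ c) (l₀ : L) {v : ℝ × (ℝ × Eu m)}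
    (hv : v.1 ∈ Ioo (-ε₀) ε₀) (hu : v.2.2 ∈ (extChartAt (𝓡 m) l₀).target) :
    ContMDiffAt 𝓘(ℝ, ℝ × (ℝ × Eu m)) (cotModel (m + 1)) ∞ (coreMap c η Q l₀) v := by
  have h1 : ContMDiffAt 𝓘(ℝ, ℝ × (ℝ × Eu m)) 𝓘(ℝ, ℝ) ∞ (fun u : ℝ × (ℝ × Eu m) => u.1) v :=
    contDiffAt_fst.contMDiffAt
  have h2 : ContMDiffAt 𝓘(ℝ, ℝ × (ℝ × Eu m)) 𝓘(ℝ, ℝ × Eu m) ∞ (fun u : ℝ × (ℝ × Eu m) => u.2) v :=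
    contDiffAt_snd.contMDiffAt
  have h3 : ContMDiffAt (𝓘(ℝ, ℝ).prod (𝓡 (2 * m + 1))) (cotModel (m + 1)) ∞ c
      (v.1, reebMap η Q l₀ v.2) :=
    hc.contMDiffOn.contMDiffAt ((isOpen_Ioo.prod isOpen_univ).mem_nhds ⟨hv, mem_univ _⟩)
  exact ContMDiffAt.comp v h3 (h1.prodMk ((contMDiffAt_reebMap hη hQ l₀ hu).comp v h2))

theorem mD_reebMap (hη : IsFlow (𝓡 (2 * m + 1)) R η)
    (hQ : IsSmoothEmb (𝓡 m) (𝓡 (2 * m + 1)) Q) (l₀ : L) {u : ℝ × Eu m}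
    (hu : u.2 ∈ (extChartAt (𝓡 m) l₀).target) :
    mD 𝓘(ℝ, ℝ × Eu m) (𝓡 (2 * m + 1)) (reebMap η Q l₀) u (1, 0) = fld R (reebMap η Q l₀ u) := by
  have h1 : HasFDerivAt (fun s : ℝ => ((s, u.2) : ℝ × Eu m)) _ u.1 := hasFDerivAt_prodMk_left (𝕜 := ℝ) u.1 u.2
  have h2 := mD_comp (K := 𝓡 (2 * m + 1)) (g := reebMap η Q l₀) (f := fun s : ℝ => ((s, u.2) : ℝ × Eu m))
    u.1 ((contMDiffAt_reebMap hη hQ l₀ hu).mdifferentiableAt (by simp))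
    h1.differentiableAt.mdifferentiableAt
  rw [mD_eq_fderiv, h1.fderiv] at h2
  have h3 : mD 𝓘(ℝ, ℝ) (𝓡 (2 * m + 1)) (fun s : ℝ => reebMap η Q l₀ (s, u.2)) u.1 =
      (1 : ℝ →L[ℝ] ℝ).smulRight (fld R (reebMap η Q l₀ u)) :=
    (hη.integral (Q ((extChartAt (𝓡 m) l₀).symm u.2)) u.1).mfderiv
  rw [h3] at h2
  simpa using (congrArg (fun D : ℝ →L[ℝ] Eu (2 * m + 1) => D 1) h2).symm

theorem mD_coreMap (hη : IsFlow (𝓡 (2 * m + 1)) R η)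
    (hQ : IsSmoothEmb (𝓡 m) (𝓡 (2 * m + 1)) Q)
    (hc : IsFlowCollar (m + 1) (k := 2 * m + 1) U Z j ε₀ c) (l₀ : L) {v : ℝ × (ℝ × Eu m)}
    (hv : v.1 ∈ Ioo (-ε₀) ε₀) (hu : v.2.2 ∈ (extChartAt (𝓡 m) l₀).target) :
    mD 𝓘(ℝ, ℝ × (ℝ × Eu m)) (cotModel (m + 1)) (coreMap c η Q l₀) v (1, 0) =
      fld Z (coreMap c η Q l₀ v) := by
  have h1 : HasFDerivAt (fun s : ℝ => ((s, v.2) : ℝ × (ℝ × Eu m))) _ v.1 :=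
    hasFDerivAt_prodMk_left (𝕜 := ℝ) v.1 v.2
  have h2 := mD_comp (K := cotModel (m + 1)) (g := coreMap c η Q l₀)
    (f := fun s : ℝ => ((s, v.2) : ℝ × (ℝ × Eu m))) v.1
    ((contMDiffAt_coreMap hη hQ hc l₀ hv hu).mdifferentiableAt (by simp))
    h1.differentiableAt.mdifferentiableAt
  rw [mD_eq_fderiv, h1.fderiv] at h2
  have h3 : mD 𝓘(ℝ, ℝ) (cotModel (m + 1)) (fun s : ℝ => coreMap c η Q l₀ (s, v.2)) v.1 =
      (1 : ℝ →L[ℝ] ℝ).smulRight (fld Z (coreMap c η Q l₀ v)) :=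
    ((hc.integral (reebMap η Q l₀ v.2) v.1 hv).hasMFDerivAt (Ioo_mem_nhds hv.1 hv.2)).mfderiv
  rw [h3] at h2
  simpa using (congrArg (fun D : ℝ →L[ℝ] CotE (m + 1) => D 1) h2).symm

theorem coreMap_mem (hc : IsFlowCollar (m + 1) (k := 2 * m + 1) U Z j ε₀ c) (l₀ : L)
    {v : ℝ × (ℝ × Eu m)} (hv : v.1 ∈ Ioo (-ε₀) ε₀) : coreMap c η Q l₀ v ∈ U :=
  hc.mapsTo ⟨hv, mem_univ _⟩

theorem formSmoothAt_contractOmega_of_mem (hZ : IsLiouvilleField (m + 1) U Z)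
    {z : Cot (n := m + 1) M} (hz : z ∈ U) : FormSmoothAt (contractOmega (m + 1) Z) z :=
  formSmoothAt_contractOmega (hZ.contMDiffOn.contMDiffAt (hZ.isOpen.mem_nhds hz))

theorem formSmoothAt_contactForm (hZ : IsLiouvilleField (m + 1) U Z)
    (hj : IsSmoothEmb (𝓡 (2 * m + 1)) (cotModel (m + 1)) j) (hjU : ∀ x, j x ∈ U) (x : S) :
    FormSmoothAt (contactForm (m + 1) (k := 2 * m + 1) Z j) x := by
  have hy := mem_extChartAt_target (I := 𝓡 (2 * m + 1)) x
  have h1 := (hj.contMDiff.contMDiffAt).comp _ (contMDiffAt_extChartAt_symm' x hy)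
  refine (FormSmoothAt.contDiffAt_pb h1
    (formSmoothAt_contractOmega_of_mem hZ (hjU _))).congr_of_eventuallyEq ?_
  filter_upwards [(isOpen_extChartAt_target x).mem_nhds hy] with y hy
  rw [chartForm_eq_pb, pb, contactForm, frm_pullbackForm, ContinuousLinearMap.comp_assoc,
    ← mD_comp (I := 𝓘(ℝ, Eu (2 * m + 1))) y (hj.contMDiff.mdifferentiableAt (by simp))
      ((contMDiffAt_extChartAt_symm' x hy).mdifferentiableAt (by simp))]
  rfl

/-- The flow-out of a Legendrian by the Reeb flow pulls the contact form back to `ds`. -/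
theorem pb_reebMap (hZ : IsLiouvilleField (m + 1) U Z)
    (hj : IsSmoothEmb (𝓡 (2 * m + 1)) (cotModel (m + 1)) j) (hjU : ∀ x, j x ∈ U)
    (hR : IsReebField (𝓡 (2 * m + 1)) (contactForm (m + 1) (k := 2 * m + 1) Z j) R)
    (hη : IsFlow (𝓡 (2 * m + 1)) R η) (hQ : IsSmoothEmb (𝓡 m) (𝓡 (2 * m + 1)) Q)
    (hLeg : ∀ l, pullbackForm (𝓡 m) (𝓡 (2 * m + 1)) Q
      (contactForm (m + 1) (k := 2 * m + 1) Z j) l = 0) (l₀ : L) {u : ℝ × Eu m}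
    (hu : u.2 ∈ (extChartAt (𝓡 m) l₀).target) :
    pb (reebMap η Q l₀) (contactForm (m + 1) (k := 2 * m + 1) Z j) u =
      ContinuousLinearMap.fst ℝ ℝ (Eu m) := by
  have hone : ∀ p ∈ univ ×ˢ (extChartAt (𝓡 m) l₀).target,
      pb (reebMap η Q l₀) (contactForm (m + 1) (k := 2 * m + 1) Z j) p (1, 0) = 1 := by
    intro p hp
    rw [pb, ContinuousLinearMap.comp_apply, mD_reebMap hη hQ l₀ hp.2]
    exact hR.apply_eq_one _
  have hzero : ∀ w, pb (reebMap η Q l₀) (contactForm (m + 1) (k := 2 * m + 1) Z j) u (0, w) = 0 := by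
    intro w
    -- Here `c₀ = 1` because `λ(R) = 1`, and `μ = 0` because `i_R dλ = 0`: the restriction to the
    -- directions of `L` is constant in `s`.
    have h1 := transport_form isOpen_univ isPreconnected_univ (mem_univ 0)
      (isOpen_extChartAt_target l₀) (κ := pb (reebMap η Q l₀) (contactForm (m + 1) (k := 2 * m + 1) Z j))
      (c₀ := 1) (μ := 0) (fun p hp => (FormSmoothAt.contDiffAt_pb (contMDiffAt_reebMap hη hQ l₀ hp.2)
        (formSmoothAt_contactForm hZ hj hjU _)).differentiableAt (by simp)) hone
      (fun p hp w => by
        rw [fderiv_pb_antisymm (contMDiffAt_reebMap hη hQ l₀ hp.2)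
          (formSmoothAt_contactForm hZ hj hjU _), zero_mul]
        have h2 := hR.contract_eq_zero (reebMap η Q l₀ p)
          (mD 𝓘(ℝ, ℝ × Eu m) (𝓡 (2 * m + 1)) (reebMap η Q l₀) p (0, w))
        have h3 := mD_reebMap hη hQ l₀ hp.2
        exact (congrArg (fun r : Eu (2 * m + 1) => (extDer (𝓡 (2 * m + 1))
          (contactForm (m + 1) (k := 2 * m + 1) Z j) (reebMap η Q l₀ p) :
            Eu (2 * m + 1) →L[ℝ] Eu (2 * m + 1) →L[ℝ] ℝ) r
          (mD 𝓘(ℝ, ℝ × Eu m) (𝓡 (2 * m + 1)) (reebMap η Q l₀) p (0, w))) h3).trans h2)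
      (mem_univ u.1) hu w
    refine h1.trans ?_
    simp only [zero_mul, Real.exp_zero, one_mul]
    have h4 : HasFDerivAt (fun y : Eu m => ((0, y) : ℝ × Eu m)) _ u.2 := hasFDerivAt_prodMk_right (𝕜 := ℝ) (0 : ℝ) u.2
    have h5 := mD_comp (K := 𝓡 (2 * m + 1)) (g := reebMap η Q l₀)
      (f := fun y : Eu m => ((0, y) : ℝ × Eu m)) u.2
      ((contMDiffAt_reebMap (u := (0, u.2)) hη hQ l₀ hu).mdifferentiableAt (by simp))
      h4.differentiableAt.mdifferentiableAt
    rw [mD_eq_fderiv, h4.fderiv] at h5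
    -- At time zero the flow-out is `Q` itself, where `λ` vanishes by the Legendrian condition.
    have h6 : (fun y : Eu m => reebMap η Q l₀ (0, y)) =
        fun y => Q ((extChartAt (𝓡 m) l₀).symm y) := by
      funext y; exact hη.zero _
    rw [h6, mD_comp (J := 𝓡 m) u.2 (hQ.contMDiff.mdifferentiableAt (by simp))
      ((contMDiffAt_extChartAt_symm' l₀ hu).mdifferentiableAt (by simp))] at h5
    have h7 := congrArg (fun D : Eu m →L[ℝ] Eu (2 * m + 1) => D w) h5
    simp only [ContinuousLinearMap.comp_apply, ContinuousLinearMap.inr_apply] at h7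
    rw [pb, ContinuousLinearMap.comp_apply, ← h7, show reebMap η Q l₀ (0, u.2) = _ from
      congrFun h6 u.2]
    exact congrArg (fun D : Eu m →L[ℝ] ℝ => D _) (hLeg ((extChartAt (𝓡 m) l₀).symm u.2))
  refine ContinuousLinearMap.ext fun w => ?_
  have h8 : w = w.1 • ((1, 0) : ℝ × Eu m) + (0, w.2) := by ext <;> simp
  rw [h8, map_add, map_smul, hone u ⟨mem_univ _, hu⟩, hzero]
  simp

end Core
end FigureEight
end

noncomputable section

set_option linter.unusedSectionVars false

namespace FigureEight

/-! ### Exactness of `p dq - e^a ds` along the flow-out -/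

section CorePrimitive

open Filter Topology
open scoped CotInstances

variable {m : ℕ} {M : Type*} [TopologicalSpace M] [ChartedSpace (Eu (m + 1)) M]
  [IsManifold (𝓡 (m + 1)) ∞ M]
  {S : Type*} [TopologicalSpace S] [ChartedSpace (Eu (2 * m + 1)) S]
  [IsManifold (𝓡 (2 * m + 1)) ∞ S]
  {L : Type*} [TopologicalSpace L] [ChartedSpace (Eu m) L] [IsManifold (𝓡 m) ∞ L]
  {U : Set (Cot (n := m + 1) M)} {Z : ∀ z : Cot (n := m + 1) M, TangentSpace (cotModel (m + 1)) z}
  {j : S → Cot (n := m + 1) M} {R : ∀ x : S, TangentSpace (𝓡 (2 * m + 1)) x} {η : ℝ → S → S}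
  {Q : L → S} {ε₀ : ℝ} {c : ℝ × S → Cot (n := m + 1) M}

/-- The model space of `ℝ × (ℝ × L)`. -/
abbrev CoreE (m : ℕ) : Type := ℝ × (ℝ × Eu m)

theorem stdOmega_self {n : ℕ} (u : CotE n) : stdOmega n u u = 0 := by
  rw [stdOmega_apply, sub_self]

/-- The condition `L_Z ω = ω` makes `i_Z ω` a second primitive of `ω` besides `p dq`, so the
difference of the two is closed. -/
theorem fderiv_pb_contractOmega_antisymm (hZ : IsLiouvilleField (m + 1) U Z)
    {V : Type*} [NormedAddCommGroup V] [NormedSpace ℝ V]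
    {f : V → Cot (n := m + 1) M} {v₀ : V} (hf : ContMDiffAt 𝓘(ℝ, V) (cotModel (m + 1)) ∞ f v₀)
    (hU : f v₀ ∈ U) (u v : V) :
    fderiv ℝ (pb f (contractOmega (m + 1) Z)) v₀ u v - fderiv ℝ (pb f (contractOmega (m + 1) Z)) v₀ v u =
      stdOmega (m + 1) (mD 𝓘(ℝ, V) (cotModel (m + 1)) f v₀ u)
        (mD 𝓘(ℝ, V) (cotModel (m + 1)) f v₀ v) := by
  rw [fderiv_pb_antisymm hf (formSmoothAt_contractOmega_of_mem hZ hU), ← om_eq (f v₀),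
    hZ.lie_eq _ hU]
  rfl

theorem coreMap_zero (hc : IsFlowCollar (m + 1) (k := 2 * m + 1) U Z j ε₀ c) (l₀ : L)
    (u : ℝ × Eu m) : coreMap c η Q l₀ (0, u) = j (reebMap η Q l₀ u) := hc.zero _

theorem pos_of_mem_Ioo_neg {a e : ℝ} (h : a ∈ Ioo (-e) e) : 0 < e := by
  have := h.1.trans h.2; linarith

/-- The restriction to `a = 0` of the pull-back of a form by `coreMap`. -/
theorem pb_coreMap_zero (hη : IsFlow (𝓡 (2 * m + 1)) R η)
    (hQ : IsSmoothEmb (𝓡 m) (𝓡 (2 * m + 1)) Q)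
    (hj : IsSmoothEmb (𝓡 (2 * m + 1)) (cotModel (m + 1)) j)
    (hc : IsFlowCollar (m + 1) (k := 2 * m + 1) U Z j ε₀ c) (hε₀ : 0 < ε₀) (l₀ : L) {u : ℝ × Eu m}
    (hu : u.2 ∈ (extChartAt (𝓡 m) l₀).target)
    (ζ : OneForm (cotModel (m + 1)) (Cot (n := m + 1) M)) (w : ℝ × Eu m) :
    pb (coreMap c η Q l₀) ζ (0, u) (0, w) =
      pb (reebMap η Q l₀) (pullbackForm (𝓡 (2 * m + 1)) (cotModel (m + 1)) j ζ) u w := by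
  have h4 : HasFDerivAt (fun y : ℝ × Eu m => ((0, y) : CoreE m)) _ u :=
    hasFDerivAt_prodMk_right (𝕜 := ℝ) (0 : ℝ) u
  have h5 := mD_comp (K := cotModel (m + 1)) (g := coreMap c η Q l₀)
    (f := fun y : ℝ × Eu m => ((0, y) : CoreE m)) u
    ((contMDiffAt_coreMap (v := (0, u)) hη hQ hc l₀ ⟨by simpa, hε₀⟩ hu).mdifferentiableAt (by simp))
    h4.differentiableAt.mdifferentiableAt
  have h6 : (fun y : ℝ × Eu m => coreMap c η Q l₀ (0, y)) = fun y => j (reebMap η Q l₀ y) := by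
    funext y; exact hc.zero _
  rw [mD_eq_fderiv, h4.fderiv, h6, mD_comp (J := 𝓡 (2 * m + 1)) u
    (hj.contMDiff.mdifferentiableAt (by simp))
    ((contMDiffAt_reebMap hη hQ l₀ hu).mdifferentiableAt (by simp))] at h5
  have h7 := congrArg (fun D : ℝ × Eu m →L[ℝ] CotE (m + 1) => D w) h5
  simp only [ContinuousLinearMap.comp_apply, ContinuousLinearMap.inr_apply] at h7
  rw [pb, ContinuousLinearMap.comp_apply, ← h7, coreMap_zero hc]
  rfl

/-- The pull-back of `i_Z ω` by `coreMap` is `e^a ds`. -/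
theorem pb_coreMap_contractOmega (hZ : IsLiouvilleField (m + 1) U Z)
    (hj : IsSmoothEmb (𝓡 (2 * m + 1)) (cotModel (m + 1)) j) (hjU : ∀ x, j x ∈ U)
    (hR : IsReebField (𝓡 (2 * m + 1)) (contactForm (m + 1) (k := 2 * m + 1) Z j) R)
    (hη : IsFlow (𝓡 (2 * m + 1)) R η) (hQ : IsSmoothEmb (𝓡 m) (𝓡 (2 * m + 1)) Q)
    (hLeg : ∀ l, pullbackForm (𝓡 m) (𝓡 (2 * m + 1)) Q
      (contactForm (m + 1) (k := 2 * m + 1) Z j) l = 0)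
    (hc : IsFlowCollar (m + 1) (k := 2 * m + 1) U Z j ε₀ c) (l₀ : L) {v : CoreE m}
    (hv : v.1 ∈ Ioo (-ε₀) ε₀) (hu : v.2.2 ∈ (extChartAt (𝓡 m) l₀).target) :
    pb (coreMap c η Q l₀) (contractOmega (m + 1) Z) v = Real.exp v.1 •
      (ContinuousLinearMap.fst ℝ ℝ (Eu m)).comp (ContinuousLinearMap.snd ℝ ℝ (ℝ × Eu m)) := by
  have hε₀ := pos_of_mem_Ioo_neg hv
  have hone : ∀ p ∈ Ioo (-ε₀) ε₀ ×ˢ (univ ×ˢ (extChartAt (𝓡 m) l₀).target),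
      pb (coreMap c η Q l₀) (contractOmega (m + 1) Z) p (1, 0) = 0 := by
    intro p hp
    rw [pb, ContinuousLinearMap.comp_apply, mD_coreMap hη hQ hc l₀ hp.1 hp.2.2,
      frm_contractOmega, stdOmega_self]
  refine ContinuousLinearMap.ext fun w => ?_
  -- Here `c₀ = 0` because `ω(Z, Z) = 0`, and `μ = 1` because `i_Z d(i_Z ω) = i_Z ω`. The factor
  -- `e^a` comes from this `μ`, and the initial value at `a = 0` is `ds`.
  have h1 := transport_form isOpen_Ioo isPreconnected_Ioo (show (0 : ℝ) ∈ Ioo (-ε₀) ε₀ by simpa)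
    (isOpen_univ.prod (isOpen_extChartAt_target (I := 𝓡 m) l₀))
    (κ := pb (coreMap c η Q l₀) (contractOmega (m + 1) Z)) (c₀ := 0) (μ := 1)
    (fun p hp => (FormSmoothAt.contDiffAt_pb (contMDiffAt_coreMap hη hQ hc l₀ hp.1 hp.2.2)
      (formSmoothAt_contractOmega_of_mem hZ (coreMap_mem hc l₀ hp.1))).differentiableAt (by simp))
    hone (fun p hp w => by
      rw [fderiv_pb_contractOmega_antisymm hZ (contMDiffAt_coreMap hη hQ hc l₀ hp.1 hp.2.2)
        (coreMap_mem hc l₀ hp.1), mD_coreMap hη hQ hc l₀ hp.1 hp.2.2, pb,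
        frm_contractOmega, one_mul]
      rfl)
    hv (⟨mem_univ _, hu⟩ : v.2 ∈ univ ×ˢ (extChartAt (𝓡 m) l₀).target) w.2
  rw [pb_coreMap_zero hη hQ hj hc hε₀ l₀ hu] at h1
  have h2 := pb_reebMap hZ hj hjU hR hη hQ hLeg l₀ hu
  rw [contactForm] at h2
  rw [h2, one_mul] at h1
  have h8 : w = w.1 • ((1, 0) : CoreE m) + (0, w.2) := by ext <;> simp
  have h9 : pb (coreMap c η Q l₀) (contractOmega (m + 1) Z) v (0, w.2) = _ := h1
  rw [h8, map_add, map_smul, hone v ⟨hv, mem_univ _, hu⟩, h9]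
  simp

set_option maxHeartbeats 600000 in
/-- The pull-back of the Liouville form by `coreMap` is `e^a ds` plus an exact form. -/
theorem pb_coreMap_liouville (hZ : IsLiouvilleField (m + 1) U Z)
    (hj : IsSmoothEmb (𝓡 (2 * m + 1)) (cotModel (m + 1)) j) (hjU : ∀ x, j x ∈ U)
    {β : S → ℝ} (hβ : ContMDiff (𝓡 (2 * m + 1)) 𝓘(ℝ, ℝ) ∞ β)
    (hβ' : ∀ x, pullbackForm (𝓡 (2 * m + 1)) (cotModel (m + 1)) j (liouville (m + 1)) x -
        contactForm (m + 1) (k := 2 * m + 1) Z j x = dform (𝓡 (2 * m + 1)) β x)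
    (hR : IsReebField (𝓡 (2 * m + 1)) (contactForm (m + 1) (k := 2 * m + 1) Z j) R)
    (hη : IsFlow (𝓡 (2 * m + 1)) R η) (hQ : IsSmoothEmb (𝓡 m) (𝓡 (2 * m + 1)) Q)
    (hLeg : ∀ l, pullbackForm (𝓡 m) (𝓡 (2 * m + 1)) Q
      (contactForm (m + 1) (k := 2 * m + 1) Z j) l = 0)
    (hc : IsFlowCollar (m + 1) (k := 2 * m + 1) U Z j ε₀ c) (l₀ : L) {v : CoreE m}
    (hv : v.1 ∈ Ioo (-ε₀) ε₀) (hu : v.2.2 ∈ (extChartAt (𝓡 m) l₀).target) :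
    ContDiffAt ℝ ∞ (fun v : CoreE m => corePrimitive Z c β v.1 (reebMap η Q l₀ v.2)) v ∧
    pb (coreMap c η Q l₀) (liouville (m + 1)) v = Real.exp v.1 •
      (ContinuousLinearMap.fst ℝ ℝ (Eu m)).comp (ContinuousLinearMap.snd ℝ ℝ (ℝ × Eu m)) +
      fderiv ℝ (fun v : CoreE m => corePrimitive Z c β v.1 (reebMap η Q l₀ v.2)) v := by
  have hε₀ := pos_of_mem_Ioo_neg hv
  have h0 : (0 : ℝ) ∈ Ioo (-ε₀) ε₀ := by simpa
  -- The target of the chart is shrunk to a ball to obtain a convex domain for the Poincaré lemma.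
  obtain ⟨r, hr, hball⟩ := Metric.isOpen_iff.1 (isOpen_extChartAt_target (I := 𝓡 m) l₀) _ hu
  set B := Metric.ball v.2.2 r with hB
  set D : Set (CoreE m) := Ioo (-ε₀) ε₀ ×ˢ (univ ×ˢ B) with hD
  have hDo : IsOpen D := isOpen_Ioo.prod (isOpen_univ.prod Metric.isOpen_ball)
  have hDc : Convex ℝ D := (convex_Ioo _ _).prod (convex_univ.prod (convex_ball _ _))
  have hvD : v ∈ D := ⟨hv, mem_univ _, Metric.mem_ball_self hr⟩
  set P := pb (coreMap c η Q l₀) (liouville (m + 1)) with hP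
  set θ := pb (coreMap c η Q l₀) (contractOmega (m + 1) Z) with hθ
  have hf : ∀ p ∈ D, ContMDiffAt 𝓘(ℝ, CoreE m) (cotModel (m + 1)) ∞ (coreMap c η Q l₀) p :=
    fun p hp => contMDiffAt_coreMap hη hQ hc l₀ hp.1 (hball hp.2.2)
  have hPs : ∀ p ∈ D, ContDiffAt ℝ ∞ P p := fun p hp =>
    FormSmoothAt.contDiffAt_pb (hf p hp) (formSmoothAt_liouville _)
  have hθs : ∀ p ∈ D, ContDiffAt ℝ ∞ θ p := fun p hp =>
    FormSmoothAt.contDiffAt_pb (hf p hp)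
      (formSmoothAt_contractOmega_of_mem hZ (coreMap_mem hc l₀ hp.1))
  have hPd : ∀ p ∈ D, DifferentiableAt ℝ P p := fun p hp => (hPs p hp).differentiableAt (by simp)
  have hθd : ∀ p ∈ D, DifferentiableAt ℝ θ p := fun p hp => (hθs p hp).differentiableAt (by simp)
  have hPθ : DifferentiableOn ℝ (fun p => P p - θ p) D :=
    fun p hp => ((hPd p hp).sub (hθd p hp)).differentiableWithinAt
  -- `K` is only a local primitive, tied to the chart and the ball. It is compared below with
  -- `corePrimitive`, whose formula involves no chart of `L` and hence defines one function on the
  -- whole of the flow-out.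
  obtain ⟨K, hK⟩ := hDc.exists_forall_hasFDerivAt_of_fderiv_symmetric hDo hPθ (by
      intro p hp x y
      have h1 := fderiv_pb_liouville_antisymm (hf p hp) x y
      have h2 := fderiv_pb_contractOmega_antisymm hZ (hf p hp) (coreMap_mem hc l₀ hp.1) x y
      have h3 : fderiv ℝ (fun p => P p - θ p) p = fderiv ℝ P p - fderiv ℝ θ p :=
        fderiv_fun_sub (hPd p hp) (hθd p hp)
      rw [h3]
      simp only [sub_apply]
      linarith)
  have hθv : ∀ p ∈ D, θ p = _ := fun p hp =>
    pb_coreMap_contractOmega hZ hj hjU hR hη hQ hLeg hc l₀ hp.1 (hball hp.2.2)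
  have hθ1 : ∀ p ∈ D, θ p (1, 0) = 0 := by
    intro p hp
    rw [hθv p hp]
    simp
  -- along `a = 0` the primitive is `β` up to a constant
  have hK0 : ∀ u ∈ (univ : Set ℝ) ×ˢ B, HasFDerivAt (𝕜 := ℝ)
      (fun u : ℝ × Eu m => K (0, u) - β (reebMap η Q l₀ u)) (0 : ℝ × Eu m →L[ℝ] ℝ) u := by
    intro u hu
    have hp : ((0, u) : CoreE m) ∈ D := ⟨h0, hu⟩
    have h4 : HasFDerivAt (fun y : ℝ × Eu m => ((0, y) : CoreE m)) _ u :=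
      hasFDerivAt_prodMk_right (𝕜 := ℝ) (0 : ℝ) u
    have hr := contMDiffAt_reebMap hη hQ l₀ (hball hu.2)
    have h5 : HasFDerivAt (fun u => β (reebMap η Q l₀ u))
        ((mD (𝓡 (2 * m + 1)) 𝓘(ℝ, ℝ) β (reebMap η Q l₀ u)).comp
          (mD 𝓘(ℝ, ℝ × Eu m) (𝓡 (2 * m + 1)) (reebMap η Q l₀) u)) u := by
      rw [← mD_comp u (hβ.mdifferentiableAt (by simp)) (hr.mdifferentiableAt (by simp)), mD_eq_fderiv]
      exact (((hβ.contMDiffAt.comp u hr).contDiffAt).differentiableAt (by simp)).hasFDerivAt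
    have h6 := ((hK _ hp).comp u h4).sub h5
    refine h6.congr_fderiv ?_
    refine ContinuousLinearMap.ext fun w => ?_
    have h7 := pb_coreMap_zero hη hQ hj hc hε₀ l₀ (hball hu.2) (liouville (m + 1)) w
    have h8 := pb_coreMap_zero hη hQ hj hc hε₀ l₀ (hball hu.2) (contractOmega (m + 1) Z) w
    have h9 := congrArg (fun D : Eu (2 * m + 1) →L[ℝ] ℝ =>
      D (mD 𝓘(ℝ, ℝ × Eu m) (𝓡 (2 * m + 1)) (reebMap η Q l₀) u w)) (hβ' (reebMap η Q l₀ u))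
    have h10 : P (0, u) (0, w) - θ (0, u) (0, w) = mD (𝓡 (2 * m + 1)) 𝓘(ℝ, ℝ) β (reebMap η Q l₀ u)
        (mD 𝓘(ℝ, ℝ × Eu m) (𝓡 (2 * m + 1)) (reebMap η Q l₀) u w) := by
      rw [hP, hθ, h7, h8]; exact h9
    simp [h10]
  have hK0' : ∀ u ∈ (univ : Set ℝ) ×ˢ B, K (0, u) - β (reebMap η Q l₀ u) =
      K (0, v.2) - β (reebMap η Q l₀ v.2) := by
    intro u hu
    have hBo : IsOpen ((univ : Set ℝ) ×ˢ B) := isOpen_univ.prod Metric.isOpen_ball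
    have hBc : IsPreconnected ((univ : Set ℝ) ×ˢ B) :=
      isPreconnected_univ.prod (convex_ball v.2.2 r).isPreconnected
    have hGd : DifferentiableOn ℝ (fun u : ℝ × Eu m => K (0, u) - β (reebMap η Q l₀ u))
        ((univ : Set ℝ) ×ˢ B) := fun u hu => (hK0 u hu).differentiableAt.differentiableWithinAt
    have hG0 : EqOn (fderiv ℝ (fun u : ℝ × Eu m => K (0, u) - β (reebMap η Q l₀ u))) 0
        ((univ : Set ℝ) ×ˢ B) := fun u hu => (hK0 u hu).fderiv
    exact hBo.is_const_of_fderiv_eq_zero hBc hGd hG0 hu hvD.2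
  -- along the flow of `Z` it is given by an integral
  have hKB : ∀ p ∈ D, corePrimitive Z c β p.1 (reebMap η Q l₀ p.2) =
      K p - (K (0, v.2) - β (reebMap η Q l₀ v.2)) := by
    intro p hp
    have hseg : ∀ b ∈ uIcc 0 p.1, ((b, p.2) : CoreE m) ∈ D := fun b hb =>
      ⟨(convex_Ioo _ _).ordConnected.uIcc_subset h0 hp.1 hb, hp.2⟩
    -- The contraction of `i_Z ω` with `Z` is zero, so along the flow of `Z` the derivative of `K`
    -- is `p dq (Z)`, the integrand of `corePrimitive`.
    have hd : ∀ b ∈ uIcc 0 p.1, HasDerivAt (fun b => K (b, p.2))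
        (frm (liouville (m + 1)) (coreMap c η Q l₀ (b, p.2)) (fld Z (coreMap c η Q l₀ (b, p.2)))) b := by
      intro b hb
      have h5 : HasDerivAt (fun t : ℝ => ((t, p.2) : CoreE m)) (1, 0) b :=
        (hasDerivAt_id b).prodMk (hasDerivAt_const b p.2)
      refine ((hK _ (hseg b hb)).comp_hasDerivAt b h5).congr_deriv ?_
      have h6 := hseg b hb
      rw [sub_apply, hθ1 _ h6, sub_zero, hP, pb, ContinuousLinearMap.comp_apply,
        mD_coreMap hη hQ hc l₀ h6.1 (hball h6.2.2)]
    have hcont : ContinuousOn (fun b => frm (liouville (m + 1)) (coreMap c η Q l₀ (b, p.2))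
        (fld Z (coreMap c η Q l₀ (b, p.2)))) (uIcc 0 p.1) := by
      have h7 : ContinuousOn (fun b : ℝ => P (b, p.2) (1, 0)) (uIcc 0 p.1) := by
        intro b hb
        have h5 : ContinuousAt (fun t : ℝ => ((t, p.2) : CoreE m)) b := by fun_prop
        have h6 : ContinuousAt (fun t : ℝ => P (t, p.2)) b :=
          ContinuousAt.comp (f := fun t : ℝ => ((t, p.2) : CoreE m)) (g := P)
            (hPs _ (hseg b hb)).continuousAt h5
        exact (h6.clm_apply continuousAt_const).continuousWithinAt
      refine h7.congr fun b hb => ?_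
      have h6 := hseg b hb
      change _ = P (b, p.2) (1, 0)
      rw [hP, pb, ContinuousLinearMap.comp_apply, mD_coreMap hη hQ hc l₀ h6.1 (hball h6.2.2)]
    have hint := intervalIntegral.integral_eq_sub_of_hasDerivAt hd hcont.intervalIntegrable
    have h8 := hK0' p.2 hp.2
    have h9 : corePrimitive Z c β p.1 (reebMap η Q l₀ p.2) = β (reebMap η Q l₀ p.2) +
        (K (p.1, p.2) - K (0, p.2)) := by rw [← hint]; rfl
    rw [h9]
    linarith
  have hev : (fun v : CoreE m => corePrimitive Z c β v.1 (reebMap η Q l₀ v.2)) =ᶠ[𝓝 v]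
      fun p => K p - (K (0, v.2) - β (reebMap η Q l₀ v.2)) := by
    filter_upwards [hDo.mem_nhds hvD] with p hp using hKB p hp
  have hKs : ContDiffOn ℝ ∞ K D := by
    rw [contDiffOn_infty_iff_fderiv_of_isOpen hDo]
    refine ⟨fun p hp => (hK p hp).differentiableAt.differentiableWithinAt, fun p hp => ?_⟩
    refine (((hPs p hp).sub (hθs p hp)).contDiffWithinAt).congr_of_eventuallyEq ?_ (hK p hp).fderiv
    filter_upwards [self_mem_nhdsWithin] with q hq using (hK q hq).fderiv
  refine ⟨((hKs.contDiffAt (hDo.mem_nhds hvD)).sub contDiffAt_const).congr_of_eventuallyEq hev, ?_⟩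
  rw [hev.fderiv_eq, fderiv_sub_const, (hK v hvD).fderiv, hθv v hvD]
  abel

end CorePrimitive
end FigureEight
end

noncomputable section

set_option linter.unusedSectionVars false

namespace FigureEight

/-! ### The figure eight and its area preserving thickening -/

section PlaneCurve

open Real Filter Topology

/-- The squared speed of the curve `(sin πt, sin 2πt)`. -/
def eightA (t : ℝ) : ℝ := (2 * π * cos (2 * π * t)) ^ 2 + (π * cos (π * t)) ^ 2

/-- The determinant of the velocity and the acceleration of the curve `(sin πt, sin 2πt)`. -/
def eightB (t : ℝ) : ℝ :=
  2 * π * cos (2 * π * t) * (π ^ 2 * sin (π * t)) -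
    π * cos (π * t) * (4 * π ^ 2 * sin (2 * π * t))

/-- The small root `r` of `A r + B r² / 2 = φ`. -/
def eightR (p : ℝ × ℝ) : ℝ :=
  2 * p.2 / (eightA p.1 + √(eightA p.1 ^ 2 + 2 * eightB p.1 * p.2))

/-- First coordinate of the area preserving thickening of the figure eight. -/
def eightX (p : ℝ × ℝ) : ℝ := sin (π * p.1) + eightR p * (2 * π * cos (2 * π * p.1))

/-- Second coordinate of the area preserving thickening of the figure eight. -/
def eightY (p : ℝ × ℝ) : ℝ := sin (2 * π * p.1) - eightR p * (π * cos (π * p.1))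

/-- With `u = cos² πt` the squared speed is `π² (16 u² - 15 u + 4)`. Completing the square leaves
the minimum `31 π² / 64`, which exceeds `4`. -/
theorem four_le_eightA (t : ℝ) : 4 ≤ eightA t := by
  have h1 : cos (2 * π * t) = 2 * cos (π * t) ^ 2 - 1 := by
    rw [mul_assoc, cos_two_mul]
  have h2 : eightA t = π ^ 2 * (16 * (cos (π * t) ^ 2 - 15 / 32) ^ 2 + 31 / 64) := by
    rw [eightA, h1]; ring
  rw [h2]
  nlinarith [pi_gt_three, sq_nonneg (cos (π * t) ^ 2 - 15 / 32)]

theorem abs_eightB_le (t : ℝ) : |eightB t| ≤ 200 := by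
  have h1 := abs_cos_le_one (2 * π * t)
  have h2 := abs_sin_le_one (π * t)
  have h3 := abs_cos_le_one (π * t)
  have h4 := abs_sin_le_one (2 * π * t)
  have h5 : |cos (2 * π * t) * sin (π * t)| ≤ 1 := by
    rw [abs_mul]; exact mul_le_one₀ h1 (abs_nonneg _) h2
  have h6 : |cos (π * t) * sin (2 * π * t)| ≤ 1 := by
    rw [abs_mul]; exact mul_le_one₀ h3 (abs_nonneg _) h4
  have h7 : π ^ 3 ≤ 32 := by
    calc π ^ 3 ≤ 3.15 ^ 3 := by gcongr; exact pi_lt_d2.le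
      _ ≤ 32 := by norm_num
  have h8 : 0 < π ^ 3 := by positivity
  have h9 : eightB t = π ^ 3 * (2 * (cos (2 * π * t) * sin (π * t)) -
      4 * (cos (π * t) * sin (2 * π * t))) := by rw [eightB]; ring
  rw [abs_le] at h5 h6
  rw [h9, abs_le]
  constructor <;> nlinarith

/-- The bound `1/100` is chosen so that `|2Bφ| ≤ 4`, which is less than `16 ≤ A²`. -/
theorem eight_discr_pos {p : ℝ × ℝ} (hp : |p.2| < 1 / 100) :
    0 < eightA p.1 ^ 2 + 2 * eightB p.1 * p.2 := by
  have h1 := four_le_eightA p.1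
  have h2 : |eightB p.1 * p.2| ≤ 2 := by
    rw [abs_mul]
    nlinarith [abs_eightB_le p.1, abs_nonneg p.2, abs_nonneg (eightB p.1)]
  nlinarith [(abs_le.1 h2).1]

/-- `eightR` is the quadratic formula with rationalised numerator, so that zeros of `B` need no
separate treatment. -/
theorem eightR_eq {p : ℝ × ℝ} (hp : |p.2| < 1 / 100) :
    eightA p.1 * eightR p + eightB p.1 * eightR p ^ 2 / 2 = p.2 := by
  have h1 := four_le_eightA p.1
  have h2 := (eight_discr_pos hp).le
  have h3 := sq_sqrt h2
  have h4 := sqrt_nonneg (eightA p.1 ^ 2 + 2 * eightB p.1 * p.2)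
  have h5 : eightA p.1 + √(eightA p.1 ^ 2 + 2 * eightB p.1 * p.2) ≠ 0 := by positivity
  rw [eightR]
  set q := √(eightA p.1 ^ 2 + 2 * eightB p.1 * p.2)
  field_simp
  linear_combination (-p.2) * h3

theorem contDiff_eightA : ContDiff ℝ ∞ eightA := by unfold eightA; fun_prop

theorem contDiff_eightB : ContDiff ℝ ∞ eightB := by unfold eightB; fun_prop

theorem contDiffAt_eightR {p : ℝ × ℝ} (hp : |p.2| < 1 / 100) : ContDiffAt ℝ ∞ eightR p := by
  have hA : ContDiffAt ℝ ∞ (fun p : ℝ × ℝ => eightA p.1) p := contDiff_eightA.contDiffAt.comp p contDiffAt_fst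
  have hB : ContDiffAt ℝ ∞ (fun p : ℝ × ℝ => eightB p.1) p := contDiff_eightB.contDiffAt.comp p contDiffAt_fst
  have h1 := four_le_eightA p.1
  have h4 := sqrt_nonneg (eightA p.1 ^ 2 + 2 * eightB p.1 * p.2)
  refine (contDiffAt_const.mul contDiffAt_snd).div (hA.add (ContDiffAt.sqrt
    ((hA.pow 2).add ((contDiffAt_const.mul hB).mul contDiffAt_snd)) (eight_discr_pos hp).ne')) ?_
  positivity

theorem abs_eightR_le {p : ℝ × ℝ} (hp : |p.2| < 1 / 100) : |eightR p| ≤ 1 := by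
  have h1 := four_le_eightA p.1
  have h4 := sqrt_nonneg (eightA p.1 ^ 2 + 2 * eightB p.1 * p.2)
  rw [eightR, abs_div, abs_mul, abs_of_pos (by positivity :
    0 < eightA p.1 + √(eightA p.1 ^ 2 + 2 * eightB p.1 * p.2)), div_le_one (by positivity)]
  norm_num
  linarith

theorem hasDerivAt_sin_mul (k t : ℝ) : HasDerivAt (fun t => sin (k * t)) (k * cos (k * t)) t := by
  have := ((hasDerivAt_id t).const_mul k).sin
  simpa [mul_comm] using this

theorem hasDerivAt_cos_mul (k t : ℝ) : HasDerivAt (fun t => cos (k * t)) (-(k * sin (k * t))) t := by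
  have := ((hasDerivAt_id t).const_mul k).cos
  simpa [mul_comm] using this

theorem fderiv_eightX {p : ℝ × ℝ} (hp : |p.2| < 1 / 100) (u : ℝ × ℝ) :
    fderiv ℝ eightX p u = π * cos (π * p.1) * u.1 + fderiv ℝ eightR p u * (2 * π * cos (2 * π * p.1)) +
      eightR p * (-(4 * π ^ 2 * sin (2 * π * p.1)) * u.1) := by
  have hr := ((contDiffAt_eightR hp).differentiableAt (by simp)).hasFDerivAt
  have h1 := (hasDerivAt_sin_mul Real.pi p.1).hasFDerivAt.comp p hasFDerivAt_fst
  have h2 := (((hasDerivAt_cos_mul (2 * π) p.1).hasFDerivAt.comp p hasFDerivAt_fst).const_mul (2 * π))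
  have h3 : HasFDerivAt eightX _ p := h1.add (hr.mul h2)
  rw [h3.fderiv]
  simp
  ring

theorem fderiv_eightY {p : ℝ × ℝ} (hp : |p.2| < 1 / 100) (u : ℝ × ℝ) :
    fderiv ℝ eightY p u = 2 * π * cos (2 * π * p.1) * u.1 - fderiv ℝ eightR p u * (π * cos (π * p.1)) +
      eightR p * (π ^ 2 * sin (π * p.1) * u.1) := by
  have hr := ((contDiffAt_eightR hp).differentiableAt (by simp)).hasFDerivAt
  have h1 := (hasDerivAt_sin_mul (2 * π) p.1).hasFDerivAt.comp p hasFDerivAt_fst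
  have h2 := (((hasDerivAt_cos_mul Real.pi p.1).hasFDerivAt.comp p hasFDerivAt_fst).const_mul π)
  have h3 : HasFDerivAt eightY _ p := h1.sub (hr.mul h2)
  rw [h3.fderiv]
  simp
  ring

/-- Implicit differentiation of `eightR_eq`. -/
theorem fderiv_eightR {p : ℝ × ℝ} (hp : |p.2| < 1 / 100) (u : ℝ × ℝ) :
    (eightA p.1 + eightB p.1 * eightR p) * fderiv ℝ eightR p u =
      u.2 - (deriv eightA p.1 * eightR p + deriv eightB p.1 * eightR p ^ 2 / 2) * u.1 := by
  have hr := ((contDiffAt_eightR hp).differentiableAt (by simp)).hasFDerivAt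
  have hA := ((contDiff_eightA.differentiable (by simp)) p.1).hasDerivAt.hasFDerivAt.comp p
    (hasFDerivAt_fst (𝕜 := ℝ))
  have hB := ((contDiff_eightB.differentiable (by simp)) p.1).hasDerivAt.hasFDerivAt.comp p
    (hasFDerivAt_fst (𝕜 := ℝ))
  have h1 := (hA.mul hr).add ((hB.mul (hr.mul hr)).mul_const (1 / 2 : ℝ))
  have h2 : (fun p : ℝ × ℝ => p.2) =ᶠ[𝓝 p] fun p => eightA p.1 * eightR p +
      eightB p.1 * (eightR p * eightR p) * (1 / 2) := by
    have : {p : ℝ × ℝ | |p.2| < 1 / 100} ∈ 𝓝 p :=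
      (isOpen_lt (by fun_prop) continuous_const).mem_nhds hp
    filter_upwards [this] with q hq
    rw [← eightR_eq hq]; ring
  have h3 : HasFDerivAt (fun p : ℝ × ℝ => p.2) _ p := h1.congr_of_eventuallyEq h2
  have h4 := congrArg (fun D : ℝ × ℝ →L[ℝ] ℝ => D u) (h3.unique hasFDerivAt_snd)
  simp at h4
  linear_combination h4

/-- The thickening of the figure eight preserves area. -/
theorem eight_area {p : ℝ × ℝ} (hp : |p.2| < 1 / 100) (u v : ℝ × ℝ) :
    fderiv ℝ eightX p u * fderiv ℝ eightY p v - fderiv ℝ eightY p u * fderiv ℝ eightX p v =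
      u.2 * v.1 - v.2 * u.1 := by
  have h1 := fderiv_eightR hp u
  have h2 := fderiv_eightR hp v
  rw [eightA, eightB] at h1 h2
  rw [fderiv_eightX hp, fderiv_eightX hp, fderiv_eightY hp, fderiv_eightY hp]
  -- With `γ = (x, y)` the curve and `n = (y', -x')` the normal, `det(n, γ') = A` and `det(n, n') =
  -- B`. Thus the area form in the coordinates `(t, r)` is `(A + B r) dr ∧ dt`. By `h1` and `h2`,
  -- `(A + B r) dr` equals `dφ` up to a multiple of `dt`, which drops out of the wedge product.
  linear_combination v.1 * h1 - u.1 * h2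

end PlaneCurve
end FigureEight
end

noncomputable section

set_option linter.unusedSectionVars false

namespace FigureEight

/-! ### Double points of the thickened figure eight -/

section PlaneAnnulus

open Real Filter Topology

theorem eightA_add_two (t : ℝ) : eightA (t + 2) = eightA t := by
  have h1 : cos (2 * π * (t + 2)) = cos (2 * π * t) := by
    rw [show 2 * π * (t + 2) = 2 * π * t + (2 : ℕ) * (2 * π) by push_cast; ring, cos_add_nat_mul_two_pi]
  have h2 : cos (π * (t + 2)) = cos (π * t) := by
    rw [show π * (t + 2) = π * t + 2 * π by ring, cos_add_two_pi]
  rw [eightA, eightA, h1, h2]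

theorem eightXY_add_two (t φ : ℝ) : eightX (t + 2, φ) = eightX (t, φ) ∧
    eightY (t + 2, φ) = eightY (t, φ) := by
  have h1 : cos (2 * π * (t + 2)) = cos (2 * π * t) := by
    rw [show 2 * π * (t + 2) = 2 * π * t + (2 : ℕ) * (2 * π) by push_cast; ring, cos_add_nat_mul_two_pi]
  have h2 : cos (π * (t + 2)) = cos (π * t) := by
    rw [show π * (t + 2) = π * t + 2 * π by ring, cos_add_two_pi]
  have h3 : sin (2 * π * (t + 2)) = sin (2 * π * t) := by
    rw [show 2 * π * (t + 2) = 2 * π * t + (2 : ℕ) * (2 * π) by push_cast; ring, sin_add_nat_mul_two_pi]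
  have h4 : sin (π * (t + 2)) = sin (π * t) := by
    rw [show π * (t + 2) = π * t + 2 * π by ring, sin_add_two_pi]
  have h5 : eightB (t + 2) = eightB t := by rw [eightB, eightB, h1, h2, h3, h4]
  have h6 : eightR (t + 2, φ) = eightR (t, φ) := by
    simp only [eightR, h5, eightA_add_two]
  simp only [eightX, eightY, h1, h2, h3, h4, h6, and_self]

/-- The area preserving thickening of the figure eight, as a map of the annulus. -/
def eightMap (q : S1 × ℝ) : ℝ × ℝ :=
  Function.Periodic.lift (f := fun t : ℝ => (eightX (t, q.2), eightY (t, q.2))) (c := 2)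
    (fun t => Prod.ext (eightXY_add_two t q.2).1 (eightXY_add_two t q.2).2) q.1

theorem eightMap_coe (t φ : ℝ) : eightMap ((t : S1), φ) = (eightX (t, φ), eightY (t, φ)) := rfl

theorem eightR_zero (t : ℝ) : eightR (t, 0) = 0 := by simp [eightR]

theorem eightMap_coe_zero (t : ℝ) : eightMap ((t : S1), 0) = (sin (π * t), sin (2 * π * t)) := by
  simp [eightMap_coe, eightX, eightY, eightR_zero]

theorem coe_eq_zero_or_one_of_sin {t : ℝ} (h : sin (π * t) = 0) :
    (t : S1) = 0 ∨ (t : S1) = ((1 : ℝ) : S1) := by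
  obtain ⟨n, hn⟩ := sin_eq_zero_iff.1 h
  have ht : (n : ℝ) = t := by
    have := pi_pos
    rw [mul_comm] at hn
    exact mul_left_cancel₀ this.ne' hn
  rcases Int.even_or_odd' n with ⟨k, hk | hk⟩
  · left
    rw [← ht, hk]
    exact (AddCircle.coe_eq_zero_iff (2 : ℝ)).2 ⟨k, by push_cast; simp [mul_comm]⟩
  · right
    rw [← ht, hk]
    have : ((2 * k + 1 : ℤ) : ℝ) - 1 = k • (2 : ℝ) := by push_cast; simp [mul_comm]
    rw [← sub_eq_zero, ← AddCircle.coe_sub, this]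
    exact (AddCircle.coe_eq_zero_iff (2 : ℝ)).2 ⟨k, rfl⟩

/-- As `sin 2πt = 2 sin πt cos πt`, off the zeros of `sin πt` the point of the curve determines both
the sine and the cosine of `πt`, hence `t` modulo `2`. The zeros of `sin πt` are the classes of `0`
and `1`. -/
theorem eightMap_double {Θ Θ' : S1} (h : eightMap (Θ, 0) = eightMap (Θ', 0)) : Θ = Θ' ∨
    (Θ ∈ ({0, ((1 : ℝ) : S1)} : Set S1) ∧ Θ' ∈ ({0, ((1 : ℝ) : S1)} : Set S1)) := by
  induction Θ using QuotientAddGroup.induction_on with | _ s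
  induction Θ' using QuotientAddGroup.induction_on with | _ t
  rw [eightMap_coe_zero, eightMap_coe_zero, Prod.mk.injEq, mul_assoc, mul_assoc, sin_two_mul,
    sin_two_mul] at h
  obtain ⟨h1, h2⟩ := h
  by_cases hs : sin (π * s) = 0
  · right
    exact ⟨by simpa using coe_eq_zero_or_one_of_sin hs,
      by simpa using coe_eq_zero_or_one_of_sin (h1 ▸ hs)⟩
  · left
    have h3 : cos (π * s) = cos (π * t) := by
      rw [← h1] at h2
      have : (2 * sin (π * s)) ≠ 0 := by simpa using hs
      exact mul_left_cancel₀ this h2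
    have h4 : cos (π * s - π * t) = 1 := by
      rw [cos_sub, ← h1, ← h3, ← sq, ← sq, cos_sq_add_sin_sq]
    obtain ⟨n, hn⟩ := (cos_eq_one_iff _).1 h4
    have h5 : s - t = n • (2 : ℝ) := by
      have := pi_pos
      refine mul_left_cancel₀ this.ne' ?_
      simp only [zsmul_eq_mul]
      linarith
    rw [← sub_eq_zero]
    change ((s : S1) - (t : S1)) = 0
    rw [← AddCircle.coe_sub, h5]
    exact (AddCircle.coe_eq_zero_iff (2 : ℝ)).2 ⟨n, rfl⟩

theorem contDiffAt_eightXY {p : ℝ × ℝ} (hp : |p.2| < 1 / 100) :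
    ContDiffAt ℝ ∞ eightX p ∧ ContDiffAt ℝ ∞ eightY p := by
  have hr := contDiffAt_eightR hp
  constructor
  · unfold eightX; fun_prop
  · unfold eightY; fun_prop

theorem isOpenQuotientMap_annulus :
    IsOpenQuotientMap (Prod.map (fun t : ℝ => (t : S1)) (id : ℝ → ℝ)) :=
  QuotientAddGroup.isOpenQuotientMap_mk.prodMap IsOpenQuotientMap.id

theorem continuousAt_eightMap (Θ : S1) : ContinuousAt eightMap (Θ, 0) := by
  induction Θ using QuotientAddGroup.induction_on with | _ t
  have h := contDiffAt_eightXY (p := (t, 0)) (by norm_num)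
  exact (isOpenQuotientMap_annulus.continuousAt_comp_iff (g := eightMap) (x := (t, 0))).1
    (h.1.continuousAt.prodMk h.2.continuousAt)

/-- The thickened figure eight is locally injective. -/
theorem eventually_eightMap_inj (Θ : S1) : ∀ᶠ z : (S1 × ℝ) × (S1 × ℝ) in 𝓝 ((Θ, 0), (Θ, 0)),
    eightMap z.1 = eightMap z.2 → z.1 = z.2 := by
  induction Θ using QuotientAddGroup.induction_on with | _ t
  have hp : |((t, 0) : ℝ × ℝ).2| < 1 / 100 := by norm_num
  have h := contDiffAt_eightXY hp
  have hs : HasStrictFDerivAt (fun p => (eightX p, eightY p))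
      ((fderiv ℝ eightX (t, 0)).prod (fderiv ℝ eightY (t, 0))) (t, 0) :=
    (h.1.hasStrictFDerivAt (by simp)).prodMk (h.2.hasStrictFDerivAt (by simp))
  -- A vector killed by the differential pairs to zero, in the nondegenerate form `dφ ∧ dt`, with
  -- both basis vectors.
  have hinj : Function.Injective ((fderiv ℝ eightX (t, 0)).prod (fderiv ℝ eightY (t, 0))) := by
    refine (injective_iff_map_eq_zero _).2 fun u hu => ?_
    have h1 : fderiv ℝ eightX (t, 0) u = 0 := congrArg Prod.fst hu
    have h2 : fderiv ℝ eightY (t, 0) u = 0 := congrArg Prod.snd hu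
    have h3 := eight_area hp u (1, 0)
    have h4 := eight_area hp u (0, 1)
    rw [h1, h2] at h3 h4
    simp at h3 h4
    exact Prod.ext h4 h3.symm
  obtain ⟨K, -, hK⟩ := LinearMap.exists_antilipschitzWith
    ((fderiv ℝ eightX (t, 0)).prod (fderiv ℝ eightY (t, 0))).toLinearMap
    (LinearMap.ker_eq_bot.2 hinj)
  have hO : ∀ᶠ z : (ℝ × ℝ) × (ℝ × ℝ) in 𝓝 ((t, 0), (t, 0)),
      (eightX z.1, eightY z.1) = (eightX z.2, eightY z.2) → z.1 = z.2 := by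
    -- With this error constant, `K` times the error of the linear approximation is at most half the
    -- distance of the two points, so equal values force distance zero.
    have hc : (0 : ℝ) < 1 / (2 * (K + 1)) := by positivity
    filter_upwards [hs.isLittleO.bound hc] with z hz hz'
    have h5 := hK.le_mul_dist z.1 z.2
    rw [dist_eq_norm, dist_eq_norm, ← map_sub] at h5
    change (eightX z.1, eightY z.1) = (eightX z.2, eightY z.2) at hz'
    simp only [hz', sub_self, zero_sub, norm_neg] at hz
    have h6 : (K : ℝ) * (1 / (2 * (K + 1)) * ‖z.1 - z.2‖) ≤ 1 / 2 * ‖z.1 - z.2‖ := by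
      rw [← mul_assoc]
      gcongr
      rw [mul_one_div, div_le_div_iff₀ (by positivity) (by norm_num)]
      linarith
    have h7 := h5.trans ((mul_le_mul_of_nonneg_left hz K.coe_nonneg).trans h6)
    have h8 : ‖z.1 - z.2‖ ≤ 0 := by linarith
    exact sub_eq_zero.1 (norm_le_zero_iff.1 h8)
  -- The covering map is open, so a neighbourhood upstairs on which injectivity holds projects to
  -- one on the annulus.
  have hq := (isOpenQuotientMap_annulus.prodMap isOpenQuotientMap_annulus).isOpenMap.image_mem_nhds hO
  refine mem_of_superset hq ?_
  rintro _ ⟨z, hz, rfl⟩ hz'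
  have h5 : z.1 = z.2 := hz hz'
  exact congrArg (Prod.map (fun t : ℝ => (t : S1)) (id : ℝ → ℝ)) h5

theorem isOpen_I0 (δ : ℝ) : IsOpen (I0 δ) := isOpen_lt continuous_norm continuous_const

theorem isOpen_I1 (δ : ℝ) : IsOpen (I1 δ) :=
  isOpen_lt (continuous_id.sub continuous_const).norm continuous_const

/-- In a thin annulus, double points of the figure eight are close to the crossing. -/
theorem exists_eightMap_double {δ : ℝ} (hδ : 0 < δ) : ∃ κ : ℝ, 0 < κ ∧ κ < 1 / 100 ∧
    ∀ z z' : S1 × ℝ, |z.2| < κ → |z'.2| < κ → eightMap z = eightMap z' → z = z' ∨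
      (z.1 ∈ I0 δ ∪ I1 δ ∧ z'.1 ∈ I0 δ ∪ I1 δ) := by
  by_contra! hcon
  have hlim : Tendsto (fun n : ℕ => 1 / ((n : ℝ) + 1) / 101) atTop (𝓝 0) := by
    simpa using tendsto_one_div_add_atTop_nhds_zero_nat.div_const (101 : ℝ)
  have h1 : ∀ n : ℕ, ∃ z z' : S1 × ℝ, |z.2| < 1 / ((n : ℝ) + 1) / 101 ∧
      |z'.2| < 1 / ((n : ℝ) + 1) / 101 ∧ eightMap z = eightMap z' ∧ z ≠ z' ∧
      (z.1 ∈ I0 δ ∪ I1 δ → z'.1 ∉ I0 δ ∪ I1 δ) := by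
    intro n
    -- The factor `101` keeps all these widths below `1/100`.
    refine hcon _ (by positivity) ?_
    rw [div_div, div_lt_div_iff₀ (by positivity) (by norm_num)]
    have : (0 : ℝ) ≤ n := by positivity
    linarith
  choose z z' hz hz' heq hne hN using h1
  have : Fact ((0 : ℝ) < 2) := ⟨by norm_num⟩
  let F : Ultrafilter ℕ := hyperfilter ℕ
  have hF : (F : Filter ℕ) ≤ atTop := Nat.hyperfilter_le_atTop
  obtain ⟨Θ, -, hΘ⟩ := isCompact_univ.ultrafilter_le_nhds (F.map fun n => (z n).1) (by simp)
  obtain ⟨Θ', -, hΘ'⟩ := isCompact_univ.ultrafilter_le_nhds (F.map fun n => (z' n).1) (by simp)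
  replace hΘ : Tendsto (fun n => (z n).1) F (𝓝 Θ) := hΘ
  replace hΘ' : Tendsto (fun n => (z' n).1) F (𝓝 Θ') := hΘ'
  have hφ : Tendsto (fun n => (z n).2) F (𝓝 0) :=
    (squeeze_zero_norm (fun n => (hz n).le) hlim).mono_left hF
  have hφ' : Tendsto (fun n => (z' n).2) F (𝓝 0) :=
    (squeeze_zero_norm (fun n => (hz' n).le) hlim).mono_left hF
  have hzt : Tendsto z F (𝓝 (Θ, 0)) := hΘ.prodMk_nhds hφ
  have hzt' : Tendsto z' F (𝓝 (Θ', 0)) := hΘ'.prodMk_nhds hφ'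
  have h2 : eightMap (Θ, 0) = eightMap (Θ', 0) := by
    refine tendsto_nhds_unique ((continuousAt_eightMap Θ).tendsto.comp hzt) ?_
    refine ((continuousAt_eightMap Θ').tendsto.comp hzt').congr fun n => (heq n).symm
  have h3 : ∀ Θ ∈ ({0, ((1 : ℝ) : S1)} : Set S1), Θ ∈ I0 δ ∪ I1 δ := by
    rintro Θ (rfl | rfl)
    · left; simpa [I0] using hδ
    · right; simpa [I1] using hδ
  have hopen : IsOpen (I0 δ ∪ I1 δ) := (isOpen_I0 δ).union (isOpen_I1 δ)
  -- In the limit the double points lie on the core. If the limits agree, local injectivity is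
  -- contradicted. If both limits are among the parameters of the crossing, the approximating points
  -- lie over the arcs, again a contradiction.
  rcases eightMap_double h2 with rfl | ⟨ha, hb⟩
  · have h4 := (hzt.prodMk_nhds hzt').eventually (eventually_eightMap_inj Θ)
    obtain ⟨n, hn⟩ := h4.exists
    exact hne n (hn (heq n))
  · obtain ⟨n, hn1, hn2⟩ := ((hΘ.eventually (hopen.mem_nhds (h3 _ ha))).and
      (hΘ'.eventually (hopen.mem_nhds (h3 _ hb)))).exists
    exact hN n hn1 hn2

end PlaneAnnulus
end FigureEight
end

noncomputable section

set_option linter.unusedSectionVars false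

namespace FigureEight

/-! ### Rescaling, and the primitive of `α^*(x dy) - Φ dΘ` -/

section FigureEightMap

open Real Filter Topology

theorem fderiv_euclidean_apply {V : Type*} [NormedAddCommGroup V] [NormedSpace ℝ V] {n : ℕ}
    {F : V → Eu n} {p : V} (hF : DifferentiableAt ℝ F p) (i : Fin n) (u : V) :
    fderiv ℝ F p u i = fderiv ℝ (fun p => F p i) p u := by
  have h : HasFDerivAt (fun p => F p i) _ p :=
    (EuclideanSpace.proj (𝕜 := ℝ) i).hasFDerivAt.comp p hF.hasFDerivAt
  rw [h.fderiv]
  rfl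

/-- The thickened figure eight, scaled so as to be defined on a larger annulus. -/
def scaledEight (N : ℝ) (q : S1 × ℝ) : Eu 2 :=
  !₂[√N * (eightMap (q.1, q.2 / N)).1, √N * (eightMap (q.1, q.2 / N)).2]

theorem contDiffAt_scaledEight {N : ℝ} {p : ℝ × ℝ} (hp : |p.2 / N| < 1 / 100) :
    ContDiffAt ℝ ∞ (fun p : ℝ × ℝ => scaledEight N ((p.1 : S1), p.2)) p := by
  have h := contDiffAt_eightXY (p := (p.1, p.2 / N)) hp
  have h1 : ContDiffAt ℝ ∞ (fun p : ℝ × ℝ => (p.1, p.2 / N)) p := by fun_prop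
  have hx : ContDiffAt ℝ ∞ (fun p : ℝ × ℝ => √N * eightX (p.1, p.2 / N)) p :=
    contDiffAt_const.mul
      (ContDiffAt.comp (g := eightX) (f := fun p : ℝ × ℝ => (p.1, p.2 / N)) p h.1 h1)
  have hy : ContDiffAt ℝ ∞ (fun p : ℝ × ℝ => √N * eightY (p.1, p.2 / N)) p :=
    contDiffAt_const.mul
      (ContDiffAt.comp (g := eightY) (f := fun p : ℝ × ℝ => (p.1, p.2 / N)) p h.2 h1)
  rw [contDiffAt_euclidean]
  intro i
  fin_cases i
  · exact hx
  · exact hy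

/-- The homothety by `√N` multiplies area by `N`, which compensates for the substitution of `φ / N`
for `φ`. -/
theorem scaledEight_area {N : ℝ} (hN : 0 < N) {p : ℝ × ℝ} (hp : |p.2 / N| < 1 / 100) (u v : ℝ × ℝ) :
    let D := fderiv ℝ (fun p : ℝ × ℝ => scaledEight N ((p.1 : S1), p.2)) p
    D u 0 * D v 1 - D u 1 * D v 0 = u.2 * v.1 - v.2 * u.1 := by
  intro D
  have hd := (contDiffAt_scaledEight hp).differentiableAt (by simp)
  have h := contDiffAt_eightXY (p := (p.1, p.2 / N)) hp
  have h1 : HasFDerivAt (fun p : ℝ × ℝ => (p.1, p.2 / N))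
      ((ContinuousLinearMap.fst ℝ ℝ ℝ).prod (N⁻¹ • ContinuousLinearMap.snd ℝ ℝ ℝ)) p := by
    refine hasFDerivAt_fst.prodMk ?_
    simpa [div_eq_inv_mul] using (hasFDerivAt_snd (𝕜 := ℝ) (p := p)).const_mul N⁻¹
  have h2 : HasFDerivAt (fun p : ℝ × ℝ => √N * eightX (p.1, p.2 / N)) _ p :=
    ((h.1.differentiableAt (by simp)).hasFDerivAt.comp p h1).const_mul √N
  have h3 : HasFDerivAt (fun p : ℝ × ℝ => √N * eightY (p.1, p.2 / N)) _ p :=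
    ((h.2.differentiableAt (by simp)).hasFDerivAt.comp p h1).const_mul √N
  have h4 : ∀ u, D u 0 = √N * fderiv ℝ eightX (p.1, p.2 / N) (u.1, N⁻¹ * u.2) := by
    intro u
    rw [fderiv_euclidean_apply hd]
    exact congrArg (fun D : ℝ × ℝ →L[ℝ] ℝ => D u) h2.fderiv
  have h5 : ∀ u, D u 1 = √N * fderiv ℝ eightY (p.1, p.2 / N) (u.1, N⁻¹ * u.2) := by
    intro u
    rw [fderiv_euclidean_apply hd]
    exact congrArg (fun D : ℝ × ℝ →L[ℝ] ℝ => D u) h3.fderiv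
  have h6 := eight_area (p := (p.1, p.2 / N)) hp (u.1, N⁻¹ * u.2) (v.1, N⁻¹ * v.2)
  have h7 := mul_self_sqrt hN.le
  have h8 : N * N⁻¹ = 1 := mul_inv_cancel₀ hN.ne'
  rw [h4, h4, h5, h5]
  simp only at h6
  linear_combination (√N * √N) * h6 + (u.2 * v.1 - v.2 * u.1) * N⁻¹ * h7 + (u.2 * v.1 - v.2 * u.1) * h8

theorem scaledEight_eq_iff {N : ℝ} (hN : 0 < N) (q q' : S1 × ℝ) :
    scaledEight N q = scaledEight N q' ↔ eightMap (q.1, q.2 / N) = eightMap (q'.1, q'.2 / N) := by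
  have hs : √N ≠ 0 := (sqrt_pos.2 hN).ne'
  constructor
  · intro h
    have h0 := congrArg (fun v : Eu 2 => v 0) h
    have h1 := congrArg (fun v : Eu 2 => v 1) h
    exact Prod.ext (mul_left_cancel₀ hs h0) (mul_left_cancel₀ hs h1)
  · intro h
    rw [scaledEight, scaledEight, h]

theorem norm_scaledEight_le (N : ℝ) {q : S1 × ℝ} (hq : |q.2 / N| < 1 / 100) :
    ‖scaledEight N q‖ ≤ √N * 20 := by
  obtain ⟨Θ, φ⟩ := q
  induction Θ using QuotientAddGroup.induction_on with | _ t
  have hR := abs_eightR_le (p := (t, φ / N)) hq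
  have hπ := pi_pos
  have hπ' := pi_lt_four
  -- Each coordinate is at most `1 + 2π < 9` in absolute value, and `9√2 < 20`.
  have hX : |eightX (t, φ / N)| ≤ 9 := by
    refine (abs_add_le _ _).trans ?_
    have h1 := abs_sin_le_one (π * t)
    have h2 := abs_cos_le_one (2 * π * t)
    have h3 : |eightR (t, φ / N) * (2 * π * cos (2 * π * t))| ≤ 1 * (2 * π * 1) := by
      rw [abs_mul, abs_mul, abs_of_pos (by positivity : 0 < 2 * π)]
      gcongr
    have h4 : |sin (π * (t, φ / N).1)| ≤ 1 := h1
    have h5 : |eightR (t, φ / N) * (2 * π * cos (2 * π * (t, φ / N).1))| ≤ 1 * (2 * π * 1) := h3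
    linarith
  have hY : |eightY (t, φ / N)| ≤ 9 := by
    refine (abs_sub _ _).trans ?_
    have h1 := abs_sin_le_one (2 * π * t)
    have h2 := abs_cos_le_one (π * t)
    have h3 : |eightR (t, φ / N) * (π * cos (π * t))| ≤ 1 * (π * 1) := by
      rw [abs_mul, abs_mul, abs_of_pos hπ]
      gcongr
    have h4 : |sin (2 * π * (t, φ / N).1)| ≤ 1 := h1
    have h5 : |eightR (t, φ / N) * (π * cos (π * (t, φ / N).1))| ≤ 1 * (π * 1) := h3
    linarith
  have h1 : scaledEight N ((t : S1), φ) =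
      !₂[√N * eightX (t, φ / N), √N * eightY (t, φ / N)] := rfl
  change ‖scaledEight N ((t : S1), φ)‖ ≤ _
  rw [h1, EuclideanSpace.norm_eq]
  refine sqrt_le_iff.2 ⟨by positivity, ?_⟩
  have hs := sq_nonneg √N
  simp only [Fin.sum_univ_two, Fin.isValue, Matrix.cons_val_zero,
    Matrix.cons_val_one, norm_eq_abs, sq_abs, mul_pow]
  have hX2 : eightX (t, φ / N) ^ 2 ≤ 81 := by
    rw [← sq_abs]; nlinarith [abs_nonneg (eightX (t, φ / N))]
  have hY2 : eightY (t, φ / N) ^ 2 ≤ 81 := by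
    rw [← sq_abs]; nlinarith [abs_nonneg (eightY (t, φ / N))]
  nlinarith

/-- The integrand is odd: the two lobes have opposite signed areas. -/
theorem integral_figureEight_zero (N : ℝ) : ∫ Θ in (-1 : ℝ)..1,
    scaledEight N ((Θ : S1), 0) 0 * deriv (fun t : ℝ => scaledEight N ((t : S1), 0) 1) Θ = 0 := by
  have h1 : ∀ t : ℝ, scaledEight N ((t : S1), 0) 0 = √N * sin (π * t) := by
    intro t
    simp [scaledEight, eightMap_coe_zero]
  have h2 : (fun t : ℝ => scaledEight N ((t : S1), 0) 1) = fun t => √N * sin (2 * π * t) := by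
    funext t
    simp [scaledEight, eightMap_coe_zero]
  have h3 : ∀ t : ℝ, deriv (fun t : ℝ => scaledEight N ((t : S1), 0) 1) t =
      √N * (2 * π * cos (2 * π * t)) := by
    intro t
    rw [h2]
    exact ((hasDerivAt_sin_mul (2 * π) t).const_mul √N).deriv
  simp only [h1, h3]
  set f : ℝ → ℝ := fun t => √N * sin (π * t) * (√N * (2 * π * cos (2 * π * t))) with hf
  have h4 : ∫ t in (-1 : ℝ)..1, f (-t) = ∫ t in (-1 : ℝ)..1, f t := by
    rw [intervalIntegral.integral_comp_neg]; simp
  have h5 : ∀ t, f (-t) = - f t := by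
    intro t
    simp only [hf, mul_neg, sin_neg, cos_neg]
    ring
  simp only [h5, intervalIntegral.integral_neg] at h4
  linarith

/-- There is a bounded figure eight map on an annulus of any width. -/
theorem exists_isFigureEight {δ : ℝ} (hδ : 0 < δ) {P : ℝ} (hP : 0 < P) :
    ∃ (α : S1 × ℝ → Eu 2) (r : ℝ), 0 < r ∧ IsFigureEight δ (-P) P α ∧
      (∀ q : S1 × ℝ, q.2 ∈ Ioo (-P) P → ‖α q‖ < r) ∧
      ∀ q q' : S1 × ℝ, q.2 ∈ Ioo (-P) P → q'.2 ∈ Ioo (-P) P → α q = α q' → q = q' ∨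
        (q.1 ∈ I0 δ ∪ I1 δ ∧ q'.1 ∈ I0 δ ∪ I1 δ) := by
  -- Half of `δ` confines the double points to smaller arcs. The complement of these is closed, `α`
  -- is injective over it, and together with `I0 δ` and `I1 δ` it covers the circle.
  obtain ⟨κ, hκ, hκ', hdouble⟩ := exists_eightMap_double (half_pos hδ)
  -- Scaling by `N = P / κ` turns the annulus of half-width `κ` into one of half-width `P`.
  have hN : 0 < P / κ := by positivity
  have hmem : ∀ φ ∈ Ioo (-P) P, |φ / (P / κ)| < κ := by
    intro φ hφ
    rw [abs_div, abs_of_pos hN, div_lt_iff₀ hN, mul_div_cancel₀ _ hκ.ne']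
    exact abs_lt.2 hφ
  have hmem' : ∀ φ ∈ Ioo (-P) P, |φ / (P / κ)| < 1 / 100 := fun φ hφ => (hmem φ hφ).trans hκ'
  have hinj : ∀ q q' : S1 × ℝ, q.2 ∈ Ioo (-P) P → q'.2 ∈ Ioo (-P) P →
      scaledEight (P / κ) q = scaledEight (P / κ) q' → q = q' ∨
        (q.1 ∈ I0 (δ / 2) ∪ I1 (δ / 2) ∧ q'.1 ∈ I0 (δ / 2) ∪ I1 (δ / 2)) := by
    intro q q' hq hq' h
    rcases hdouble _ _ (hmem _ hq) (hmem _ hq') ((scaledEight_eq_iff hN q q').1 h) with h1 | h1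
    · left
      have h2 := congrArg Prod.fst h1
      have h3 := congrArg Prod.snd h1
      simp only at h2 h3
      exact Prod.ext h2 ((div_left_inj' hN.ne').1 h3)
    · exact Or.inr h1
  have hsub : I0 (δ / 2) ∪ I1 (δ / 2) ⊆ I0 δ ∪ I1 δ :=
    union_subset_union (fun Θ (h : ‖Θ‖ < δ / 2) => h.trans (half_lt_self hδ))
      (fun Θ (h : ‖Θ - _‖ < δ / 2) => h.trans (half_lt_self hδ))
  have h0 : (0 : ℝ) ∈ Ioo (-P) P := ⟨by linarith, hP⟩
  refine ⟨scaledEight (P / κ), √(P / κ) * 20 + 1, by positivity, ?_,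
    fun q hq => (norm_scaledEight_le _ (hmem' _ hq)).trans_lt (lt_add_one _),
    fun q q' hq hq' h => (hinj q q' hq hq' h).imp_right fun h => ⟨hsub h.1, hsub h.2⟩⟩
  refine ⟨by linarith, hP, ?_, ?_, ?_, ?_, ?_, ?_, integral_figureEight_zero _⟩
  · exact fun p hp => (contDiffAt_scaledEight (hmem' _ hp.2)).contDiffWithinAt
  · intro Θ φ hφ u v
    exact scaledEight_area hN (p := (Θ, φ)) (hmem' _ hφ) u v
  · refine ⟨(I0 (δ / 2) ∪ I1 (δ / 2))ᶜ, ((isOpen_I0 _).union (isOpen_I1 _)).isClosed_compl, ?_, ?_⟩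
    · rw [union_assoc]
      exact eq_univ_of_univ_subset fun Θ _ => by
        by_cases h : Θ ∈ I0 (δ / 2) ∪ I1 (δ / 2)
        · exact Or.inr (hsub h)
        · exact Or.inl h
    · intro q hq q' hq' h
      exact (hinj q q' hq.2 hq'.2 h).resolve_right fun h1 => hq.1 h1.1
  · have := eightMap_coe_zero 0
    simp only [mul_zero, sin_zero] at this
    simp only [scaledEight, zero_div]
    rw [show (0 : S1) = ((0 : ℝ) : S1) from rfl, this]
    ext i; fin_cases i <;> simp
  · have := eightMap_coe_zero 1
    simp only [mul_one, sin_pi, sin_two_pi] at this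
    simp only [scaledEight, zero_div]
    rw [this]
    ext i; fin_cases i <;> simp
  · intro Θ Θ' h
    have h1 := (scaledEight_eq_iff hN _ _).1 h
    simp only [zero_div] at h1
    exact eightMap_double h1

/-- On the annulus, `α^* (x dy) - Φ dΘ` is exact. -/
theorem IsFigureEight.exists_primitive {δ Φm Φp : ℝ} {α : S1 × ℝ → Eu 2}
    (h : IsFigureEight δ Φm Φp α) : ∃ k : S1 × ℝ → ℝ,
      ContDiffOn ℝ ∞ (fun p : ℝ × ℝ => k ((p.1 : S1), p.2)) (univ ×ˢ Ioo Φm Φp) ∧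
      ∀ p : ℝ × ℝ, p.2 ∈ Ioo Φm Φp → ∀ u : ℝ × ℝ, α ((p.1 : S1), p.2) 0 *
          fderiv ℝ (fun p : ℝ × ℝ => α ((p.1 : S1), p.2)) p u 1 =
        p.2 * u.1 + fderiv ℝ (fun p : ℝ × ℝ => k ((p.1 : S1), p.2)) p u := by
  set D : Set (ℝ × ℝ) := univ ×ˢ Ioo Φm Φp with hD
  have hDo : IsOpen D := isOpen_univ.prod isOpen_Ioo
  have hDc : Convex ℝ D := convex_univ.prod (convex_Ioo _ _)
  have h0 : (0 : ℝ) ∈ Ioo Φm Φp := ⟨h.neg, h.pos⟩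
  set F : ℝ × ℝ → Eu 2 := fun p => α ((p.1 : S1), p.2) with hF
  set X : ℝ × ℝ → ℝ := fun p => F p 0 with hX
  set Y : ℝ × ℝ → ℝ := fun p => F p 1 with hY
  have hFs : ∀ p ∈ D, ContDiffAt ℝ ∞ F p := fun p hp => h.smooth.contDiffAt (hDo.mem_nhds hp)
  have hFd : ∀ p ∈ D, DifferentiableAt ℝ F p := fun p hp => (hFs p hp).differentiableAt (by simp)
  have hXs : ∀ p ∈ D, ContDiffAt ℝ ∞ X p := fun p hp => contDiffAt_euclidean.1 (hFs p hp) 0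
  have hYs : ∀ p ∈ D, ContDiffAt ℝ ∞ Y p := fun p hp => contDiffAt_euclidean.1 (hFs p hp) 1
  have hYs' : ∀ p ∈ D, ContDiffAt ℝ ∞ (fderiv ℝ Y) p :=
    fun p hp => (hYs p hp).fderiv_right (m := ∞) (by simp)
  -- `ν` is the lift of `α^*(x dy) - Φ dΘ` to the strip. It is closed because `α^*(dx ∧ dy) = dΦ ∧
  -- dΘ`.
  set ν : ℝ × ℝ → ℝ × ℝ →L[ℝ] ℝ := fun p => X p • fderiv ℝ Y p - p.2 • ContinuousLinearMap.fst ℝ ℝ ℝ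
    with hν
  have hνs : ∀ p ∈ D, ContDiffAt ℝ ∞ ν p := fun p hp =>
    ((hXs p hp).smul (hYs' p hp)).sub (contDiffAt_snd.smul contDiffAt_const)
  have hν1 : ∀ p u, ν p u = X p * fderiv ℝ Y p u - p.2 * u.1 := fun p u => by simp [hν]
  have hsymm : ∀ p ∈ D, ∀ x y, fderiv ℝ ν p x y = fderiv ℝ ν p y x := by
    intro p hp x y
    have h1 := ((hXs p hp).differentiableAt (by simp)).hasFDerivAt.smul
      ((hYs' p hp).differentiableAt (by simp)).hasFDerivAt
    have h2 := (hasFDerivAt_snd (𝕜 := ℝ) (p := p)).smul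
      (hasFDerivAt_const (ContinuousLinearMap.fst ℝ ℝ ℝ) p)
    have h3 : HasFDerivAt ν _ p := h1.sub h2
    have h4 : fderiv ℝ (fderiv ℝ Y) p x y = fderiv ℝ (fderiv ℝ Y) p y x :=
      ((hYs p hp).isSymmSndFDerivAt (by
        simpa [minSmoothness_of_isRCLikeNormedField] using two_le_infty)) x y
    have h5 := h.area p.1 p.2 hp.2 x y
    simp only at h5
    change fderiv ℝ F p x 0 * fderiv ℝ F p y 1 - fderiv ℝ F p x 1 * fderiv ℝ F p y 0 = _ at h5
    simp only [fderiv_euclidean_apply (hFd p hp)] at h5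
    rw [h3.fderiv]
    simp [h4]
    change fderiv ℝ X p x * fderiv ℝ Y p y - fderiv ℝ Y p x * fderiv ℝ X p y = _ at h5
    linear_combination h5
  obtain ⟨K, hK⟩ := hDc.exists_forall_hasFDerivAt_of_fderiv_symmetric hDo
    (fun p hp => ((hνs p hp).differentiableAt (by simp)).differentiableWithinAt) hsymm
  have hFper : ∀ p : ℝ × ℝ, F (p + (2, 0)) = F p := by
    intro p
    simp only [hF, Prod.fst_add, Prod.snd_add, add_zero, AddCircle.coe_add_period]
  have hνper : ∀ p, ν (p + (2, 0)) = ν p := by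
    intro p
    have h1 : fderiv ℝ Y (p + (2, 0)) = fderiv ℝ Y p := by
      rw [← fderiv_comp_add_right]
      congr 1
      funext q
      simp only [hY, hFper]
    simp only [hν, hX, h1, hFper, Prod.snd_add, add_zero]
  -- On the core `Φ = 0`, so the period of `ν` is the integral of `x dy`, and this is the zero area
  -- condition.
  have hKint : K (1, 0) - K (-1, 0) = 0 := by
    have hd : ∀ t ∈ uIcc (-1 : ℝ) 1, HasDerivAt (fun t : ℝ => K (t, 0)) (ν (t, 0) (1, 0)) t := by
      intro t _
      have h5 : HasDerivAt (fun t : ℝ => ((t, 0) : ℝ × ℝ)) (1, 0) t :=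
        (hasDerivAt_id t).prodMk (hasDerivAt_const t 0)
      exact (hK (t, 0) ⟨mem_univ _, h0⟩).comp_hasDerivAt t h5
    have hcont : ContinuousOn (fun t : ℝ => ν (t, 0) (1, 0)) (uIcc (-1) 1) := by
      intro t _
      have h5 : ContinuousAt (fun t : ℝ => ((t, 0) : ℝ × ℝ)) t := by fun_prop
      have h6 : ContinuousAt (fun t : ℝ => ν (t, 0)) t :=
        ContinuousAt.comp (f := fun t : ℝ => ((t, 0) : ℝ × ℝ)) (g := ν)
          (hνs _ ⟨mem_univ _, h0⟩).continuousAt h5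
      exact (h6.clm_apply continuousAt_const).continuousWithinAt
    rw [← intervalIntegral.integral_eq_sub_of_hasDerivAt hd hcont.intervalIntegrable]
    refine Eq.trans ?_ h.area_zero
    refine intervalIntegral.integral_congr fun t _ => ?_
    have h5 : HasDerivAt (fun t : ℝ => ((t, 0) : ℝ × ℝ)) (1, 0) t :=
      (hasDerivAt_id t).prodMk (hasDerivAt_const t 0)
    have h6 : HasDerivAt (fun t : ℝ => α ((t : S1), 0) 1) (fderiv ℝ Y (t, 0) (1, 0)) t :=
      HasFDerivAt.comp_hasDerivAt (l := Y) (f := fun t : ℝ => ((t, 0) : ℝ × ℝ)) t ((hYs (t, 0) ⟨mem_univ _, h0⟩).differentiableAt (by simp)).hasFDerivAt h5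
    simp only [hν1, h6.deriv]
    simp [hX, hF]
  -- As `ν` is periodic, `K (p + (2, 0)) - K p` is constant on the connected strip. The constant is
  -- the period of `ν`, read off at `(-1, 0)`.
  have hKper : ∀ p ∈ D, K (p + (2, 0)) = K p := by
    intro p hp
    have hshift : ∀ p ∈ D, p + (2, 0) ∈ D := fun p hp => ⟨mem_univ _, by simpa using hp.2⟩
    have hG : ∀ p ∈ D, HasFDerivAt (fun p => K (p + (2, 0)) - K p) (0 : ℝ × ℝ →L[ℝ] ℝ) p := by
      intro p hp
      have h1 : HasFDerivAt (fun p => K (p + (2, 0))) (ν (p + (2, 0))) p :=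
        (hasFDerivAt_comp_add_right _).2 (hK _ (hshift p hp))
      have h2 := h1.sub (hK p hp)
      rwa [hνper, sub_self] at h2
    have hGd : DifferentiableOn ℝ (fun p => K (p + (2, 0)) - K p) D :=
      fun u hu => (hG u hu).differentiableAt.differentiableWithinAt
    have hG0 : EqOn (fderiv ℝ (fun p => K (p + (2, 0)) - K p)) 0 D := fun u hu => (hG u hu).fderiv
    have h3 := hDo.is_const_of_fderiv_eq_zero hDc.isPreconnected hGd hG0 hp
      (show ((-1, 0) : ℝ × ℝ) ∈ D from ⟨mem_univ _, h0⟩)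
    simp only [Prod.mk_add_mk, add_zero] at h3
    norm_num at h3
    linarith
  classical
  -- Periodicity of `K` is known only on the strip; the value `0` elsewhere makes the function
  -- descend to the quotient everywhere.
  let k : S1 × ℝ → ℝ := fun q => Function.Periodic.lift
    (f := fun t : ℝ => if q.2 ∈ Ioo Φm Φp then K (t, q.2) else 0) (c := 2) (fun t => by
      by_cases hq : q.2 ∈ Ioo Φm Φp
      · have := hKper (t, q.2) ⟨mem_univ _, hq⟩
        simpa [hq] using this
      · simp [hq]) q.1
  have hk : ∀ p ∈ D, k ((p.1 : S1), p.2) = K p := fun p hp => if_pos hp.2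
  have hkev : ∀ p ∈ D, (fun p : ℝ × ℝ => k ((p.1 : S1), p.2)) =ᶠ[𝓝 p] K := fun p hp => by
    filter_upwards [hDo.mem_nhds hp] with q hq using hk q hq
  refine ⟨k, ?_, ?_⟩
  · have hKs : ContDiffOn ℝ ∞ K D := by
      rw [contDiffOn_infty_iff_fderiv_of_isOpen hDo]
      refine ⟨fun p hp => (hK p hp).differentiableAt.differentiableWithinAt, fun p hp => ?_⟩
      refine ((hνs p hp).contDiffWithinAt).congr_of_eventuallyEq ?_ (hK p hp).fderiv
      filter_upwards [self_mem_nhdsWithin] with q hq using (hK q hq).fderiv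
    exact hKs.congr hk
  · intro p hp u
    have hpD : p ∈ D := ⟨mem_univ _, hp⟩
    rw [(hkev p hpD).fderiv_eq, (hK p hpD).fderiv, hν1, fderiv_euclidean_apply (hFd p hpD)]
    ring

end FigureEightMap
end FigureEight
end

noncomputable section

set_option linter.unusedSectionVars false

namespace FigureEight

/-! ### Functions on the circle -/

section Circle

open Filter Topology

theorem SmoothOnS1.hasDerivAt {f : S1 → ℝ} (hf : SmoothOnS1 f) (t : ℝ) :
    HasDerivAt (fun t : ℝ => f (t : S1)) (derivS1 f t) t :=
  (hf.differentiable (by simp) t).hasDerivAt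

theorem SmoothOnS1.contDiff_derivS1 {f : S1 → ℝ} (hf : SmoothOnS1 f) :
    ContDiff ℝ ∞ (derivS1 f) :=
  (contDiff_infty_iff_deriv.1 hf).2

theorem SmoothOnS1.continuous_primeS1 {f : S1 → ℝ} (hf : SmoothOnS1 f) : Continuous (primeS1 f) :=
  (QuotientAddGroup.isOpenQuotientMap_mk (N := AddSubgroup.zmultiples (2 : ℝ))
    ).isQuotientMap.continuous_iff.2 hf.contDiff_derivS1.continuous

theorem compactSpace_S1 : CompactSpace S1 := by
  have : Fact ((0 : ℝ) < 2) := ⟨two_pos⟩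
  infer_instance

theorem SmoothOnS1.exists_bound_primeS1 {f : S1 → ℝ} (hf : SmoothOnS1 f) :
    ∃ C : ℝ, 0 ≤ C ∧ ∀ Θ, |primeS1 f Θ| ≤ C := by
  have := compactSpace_S1
  obtain ⟨C, hC⟩ := (isCompact_range hf.continuous_primeS1).isBounded.exists_norm_le
  have h : ∀ Θ, |primeS1 f Θ| ≤ C := fun Θ => hC _ (mem_range_self Θ)
  exact ⟨C, (abs_nonneg _).trans (h 0), h⟩

theorem primeS1_eq_zero_of_isOpen {f : S1 → ℝ} {A : Set S1} (hA : IsOpen A) {b : ℝ}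
    (h : ∀ Θ ∈ A, f Θ = b) {Θ : S1} (hΘ : Θ ∈ A) : primeS1 f Θ = 0 := by
  induction Θ using QuotientAddGroup.induction_on with | _ t
  have h1 : (fun t : ℝ => f (t : S1)) =ᶠ[𝓝 t] fun _ => b := by
    have h2 : Continuous (fun t : ℝ => (t : S1)) := AddCircle.continuous_mk' 2
    filter_upwards [(hA.preimage h2).mem_nhds hΘ] with u hu using h _ hu
  change deriv (fun t : ℝ => f (t : S1)) t = 0
  rw [h1.deriv_eq, deriv_const]

/-- Consequently `Φ` vanishes over the arcs `I₀` and `I₁`, where `F` meets `α` only along its core.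
-/
theorem IsCutoff.primeS1_eq_zero {δ : ℝ} {ρ : S1 → ℝ} (hρ : IsCutoff δ ρ) {Θ : S1}
    (hΘ : Θ ∈ I0 δ ∪ I1 δ) : primeS1 ρ Θ = 0 :=
  hΘ.elim (primeS1_eq_zero_of_isOpen (isOpen_I0 δ) hρ.eq_zero)
    (primeS1_eq_zero_of_isOpen (isOpen_I1 δ) hρ.eq_one)

end Circle

/-! ### The group law of the Reeb flow and Reeb chords -/

section ReebFlow

open Filter Topology

variable {k : ℕ} {S : Type*} [TopologicalSpace S] [ChartedSpace (Eu k) S]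
  [IsManifold (𝓡 k) ∞ S] [T2Space S] {R : ∀ x : S, TangentSpace (𝓡 k) x} {η : ℝ → S → S}

/-- Uniqueness of integral curves, for which the Hausdorff property is needed. -/
theorem IsFlow.add (hη : IsFlow (𝓡 k) R η) (t s : ℝ) (x : S) : η (t + s) x = η t (η s x) := by
  have : IsManifold (𝓡 k) 1 S := isManifold_one
  have h1 : IsMIntegralCurve (I := 𝓡 k) ((fun t => η t x) ∘ (· + s)) R := (hη.integral x).comp_add s
  exact congrFun (isMIntegralCurve_Ioo_eq_of_contMDiff_boundaryless (t₀ := 0)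
    (hη.contMDiff_field.of_le (by simp)) h1 (hη.integral (η s x)) (by simp [hη.zero])) t

theorem IsFlow.neg_comp (hη : IsFlow (𝓡 k) R η) (s : ℝ) (x : S) : η (-s) (η s x) = x := by
  rw [← hη.add, neg_add_cancel, hη.zero]

/-- Two Reeb trajectories from the Legendrian that meet in times differing by at most `ℓ` are
equal, if there are no Reeb chords of length at most `ℓ`. -/
theorem NoReebChord.eq_time {L : Type*} {Q : L → S} {ℓ : ℝ≥0∞} (h : NoReebChord η Q ℓ)
    (hη : IsFlow (𝓡 k) R η) {s s' : ℝ} (h1 : ENNReal.ofReal (s - s') ≤ ℓ)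
    (h2 : ENNReal.ofReal (s' - s) ≤ ℓ) {l l' : L} (he : η s (Q l) = η s' (Q l')) : s = s' := by
  have key : ∀ s s' : ℝ, ∀ l l' : L, ENNReal.ofReal (s - s') ≤ ℓ → η s (Q l) = η s' (Q l') →
      s ≤ s' := by
    intro s s' l l' h1 he
    by_contra! hlt
    -- Flowing back by the smaller time turns the coincidence into a chord of length `s - s'`.
    refine h (s - s') (sub_pos.2 hlt) h1 l l' ?_
    rw [show s - s' = -s' + s by ring, hη.add, he, hη.neg_comp]
  exact le_antisymm (key _ _ _ _ h1 he) (key _ _ _ _ h2 he.symm)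

end ReebFlow

/-! ### Injectivity of the suspension -/

section Injectivity

open Filter Topology
open scoped CotInstances

variable {m : ℕ} {M : Type*} [TopologicalSpace M] [ChartedSpace (Eu (m + 1)) M]
  [IsManifold (𝓡 (m + 1)) ∞ M]
  {S : Type*} [TopologicalSpace S] [ChartedSpace (Eu (2 * m + 1)) S]
  [IsManifold (𝓡 (2 * m + 1)) ∞ S]
  {L : Type*} [TopologicalSpace L] [ChartedSpace (Eu m) L] [IsManifold (𝓡 m) ∞ L]
  {U : Set (Cot (n := m + 1) M)} {Z : ∀ z : Cot (n := m + 1) M, TangentSpace (cotModel (m + 1)) z}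
  {j : S → Cot (n := m + 1) M} {R : ∀ x : S, TangentSpace (𝓡 (2 * m + 1)) x} {η : ℝ → S → S}
  {Q : L → S} {ε₀ ε : ℝ} {c : ℝ × S → Cot (n := m + 1) M} {g : M → ℝ} {T : ℝ} {s a : S1 → ℝ}
  {δ Φm Φp : ℝ} {ρ : S1 → ℝ} {α : S1 × ℝ → Eu 2}

theorem mem_Ioo_of_mem_Icc (hε : 0 < ε) (hεε₀ : ε < ε₀) {b : ℝ} (hb : b ∈ Icc 0 ε) :
    b ∈ Ioo (-ε₀) ε₀ :=
  ⟨by linarith [hb.1], by linarith [hb.2]⟩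

theorem IsFlowCollar.isCompact_image [CompactSpace S]
    (hc : IsFlowCollar (m + 1) (k := 2 * m + 1) U Z j ε₀ c)
    (hε : 0 < ε) (hεε₀ : ε < ε₀) : IsCompact (c '' (Icc 0 ε ×ˢ univ)) :=
  (isCompact_Icc.prod isCompact_univ).image_of_continuousOn
    (hc.contMDiffOn.continuousOn.mono
      (prod_mono (fun _ hb => mem_Ioo_of_mem_Icc hε hεε₀ hb) Subset.rfl))

theorem IsStripCurve.baseMap_mem (hE : IsStripCurve ε s a) (w : L × S1) :
    baseMap c η Q s a w ∈ c '' (Icc 0 ε ×ˢ univ) :=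
  ⟨_, ⟨hE.mem_strip _, mem_univ _⟩, rfl⟩

/-- A common bound for the functions `ψ` of all strip curves. -/
theorem IsFlowCollar.exists_bound_psi [CompactSpace S]
    (hc : IsFlowCollar (m + 1) (k := 2 * m + 1) U Z j ε₀ c) (hg : ContMDiff (𝓡 (m + 1)) 𝓘(ℝ, ℝ) ∞ g)
    (hε : 0 < ε) (hεε₀ : ε < ε₀) (η : ℝ → S → S) (Q : L → S) (T : ℝ) :
    ∃ C : ℝ, 0 ≤ C ∧ ∀ s a : S1 → ℝ, IsStripCurve ε s a →
      ∀ w : L × S1, |psi c η Q s a g T w| ≤ C := by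
  have hcont : Continuous (fun z : Cot (n := m + 1) M => T * g z.1) :=
    continuous_const.mul (hg.continuous.comp contMDiff_cot_proj.continuous)
  obtain ⟨C, hC⟩ := ((hc.isCompact_image hε hεε₀).image hcont).isBounded.exists_norm_le
  exact ⟨max C 0, le_max_right _ _, fun s a hE w =>
    (hC _ (mem_image_of_mem _ (hE.baseMap_mem w))).trans (le_max_left _ _)⟩

/-- Injectivity of the collar gives equal `a` and a common point of two Reeb trajectories. Different
times would produce a Reeb chord of length at most `ℓ`, so the times agree, and the embeddedness of
the curve and of `Q` does the rest. -/
theorem baseMap_injective [T2Space S] (hc : IsFlowCollar (m + 1) (k := 2 * m + 1) U Z j ε₀ c)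
    (hη : IsFlow (𝓡 (2 * m + 1)) R η) (hQ : Function.Injective Q) (hε : 0 < ε) (hεε₀ : ε < ε₀)
    {ℓ : ℝ≥0∞} (hℓ : NoReebChord η Q ℓ) (hE : IsStripCurve ε s a)
    (hs : ∀ t t' : S1, ENNReal.ofReal (s t - s t') ≤ ℓ) :
    Function.Injective (baseMap c η Q s a) := by
  rintro ⟨l, t⟩ ⟨l', t'⟩ h
  have h1 := hc.injOn ⟨mem_Ioo_of_mem_Icc hε hεε₀ (hE.mem_strip t), mem_univ _⟩
    ⟨mem_Ioo_of_mem_Icc hε hεε₀ (hE.mem_strip t'), mem_univ _⟩ h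
  have ha : a t = a t' := congrArg Prod.fst h1
  have he : η (s t) (Q l) = η (s t') (Q l') := congrArg Prod.snd h1
  have hst : s t = s t' := hℓ.eq_time hη (hs _ _) (hs _ _) he
  have ht : t = t' := hE.injective (Prod.ext hst ha)
  subst ht
  have h2 := congrArg (η (-s t)) he
  rw [hη.neg_comp, hη.neg_comp] at h2
  rw [hQ h2]

theorem translate_injective (g : M → ℝ) (τ : ℝ) :
    Function.Injective (translate (m + 1) g τ : Cot (n := m + 1) M → Cot (n := m + 1) M) :=
  Function.LeftInverse.injective (g := translate (m + 1) g (-τ)) fun z => by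
    rw [translate_add, neg_add_cancel, translate_zero]

theorem zero_mem_I0 (hδ : 0 < δ) : (0 : S1) ∈ I0 δ := by simpa [I0] using hδ

theorem one_mem_I1 (hδ : 0 < δ) : ((1 : ℝ) : S1) ∈ I1 δ := by simpa [I1] using hδ

/-- The plane component determines `Θ` except at the crossing, where the cotangent component
distinguishes `ρ = 0` from `ρ = 1` by displacement. Once `Θ` is known, the translation can be undone
and `baseMap` is injective. -/
theorem figureEightMap_injective (hbase : Function.Injective (baseMap c η Q s a))
    (hE : IsStripCurve ε s a) (hT : Displaces c ε g T) (hδ : 0 < δ) (hρ : IsCutoff δ ρ)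
    (hα : IsFigureEight δ Φm Φp α)
    (hαinj : ∀ q q' : S1 × ℝ, q.2 ∈ Ioo Φm Φp → q'.2 ∈ Ioo Φm Φp → α q = α q' → q = q' ∨
      (q.1 ∈ I0 δ ∪ I1 δ ∧ q'.1 ∈ I0 δ ∪ I1 δ))
    (hΦ : ∀ (w : L × S1) (Θ : S1), Phi c η Q s a g T ρ w Θ ∈ Ioo Φm Φp) :
    Function.Injective (figureEightMap c η Q s a g T ρ α) := by
  have hdisp : ∀ w w' : L × S1, isotopy c η Q s a g T w 0 ≠ isotopy c η Q s a g T w' 1 := by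
    intro w w' h
    simp only [isotopy, zero_mul, one_mul, translate_zero] at h
    exact Set.disjoint_iff.1 hT ⟨hE.baseMap_mem w, _, hE.baseMap_mem w', h.symm⟩
  have h0 := hρ.eq_zero _ (zero_mem_I0 hδ)
  have h1 := hρ.eq_one _ (one_mem_I1 hδ)
  rintro ⟨w, Θ⟩ ⟨w', Θ'⟩ h
  have hF : isotopy c η Q s a g T w (ρ Θ) = isotopy c η Q s a g T w' (ρ Θ') := congrArg Prod.fst h
  have hA : α (Θ, Phi c η Q s a g T ρ w Θ) = α (Θ', Phi c η Q s a g T ρ w' Θ') :=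
    congrArg Prod.snd h
  have hΘ : Θ = Θ' := by
    rcases hαinj _ _ (hΦ w Θ) (hΦ w' Θ') hA with h2 | ⟨h2, h3⟩
    · exact congrArg Prod.fst h2
    -- Both points lie over the arcs where `Φ = 0`, so only the double point of the core remains:
    -- `Θ` and `Θ'` are equal, or one is `0` and the other `±1`.
    · simp only [Phi, hρ.primeS1_eq_zero h2, hρ.primeS1_eq_zero h3, mul_zero] at hA
      rcases hα.double _ _ hA with h4 | ⟨h4 | h4, h5 | h5⟩
      · exact h4
      · rw [h4, h5]
      · rw [mem_singleton_iff.1 h5, h4, h0, h1] at hF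
        exact absurd hF (hdisp _ _)
      · rw [mem_singleton_iff.1 h4, h5, h0, h1] at hF
        exact absurd hF.symm (hdisp _ _)
      · rw [mem_singleton_iff.1 h4, mem_singleton_iff.1 h5]
  subst hΘ
  rw [hbase (translate_injective g _ hF)]

end Injectivity
end FigureEight
end

noncomputable section

set_option linter.unusedSectionVars false

namespace FigureEight

/-! ### Smoothness and differentials read in the chart at a point -/

section ChartAtPoint

open Filter Topology

variable {E : Type*} [NormedAddCommGroup E] [NormedSpace ℝ E]
  {H : Type*} [TopologicalSpace H] {I : ModelWithCorners ℝ E H}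
  {X : Type*} [TopologicalSpace X] [ChartedSpace H X]
  {E' : Type*} [NormedAddCommGroup E'] [NormedSpace ℝ E']
  {H' : Type*} [TopologicalSpace H'] {J : ModelWithCorners ℝ E' H'}
  {Y : Type*} [TopologicalSpace Y] [ChartedSpace H' Y]
  {E'' : Type*} [NormedAddCommGroup E''] [NormedSpace ℝ E'']
  {H'' : Type*} [TopologicalSpace H''] {K : ModelWithCorners ℝ E'' H''}
  {W : Type*} [TopologicalSpace W] [ChartedSpace H'' W]

theorem mD_prodMk {f : X → Y} {g : X → W} {x : X} (hf : MDifferentiableAt I J f x)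
    (hg : MDifferentiableAt I K g x) :
    mD I (J.prod K) (fun x => (f x, g x)) x = (mD I J f x).prod (mD I K g x) :=
  mfderiv_prodMk hf hg

variable [IsManifold I ∞ X]

theorem contMDiffAt_of_comp_extChartAt_symm {f : X → Y} {x : X}
    (h : ContMDiffAt 𝓘(ℝ, E) J ∞ (fun v => f ((extChartAt I x).symm v)) (extChartAt I x x)) :
    ContMDiffAt I J ∞ f x := by
  refine (h.comp x (contMDiffAt_extChartAt (I := I))).congr_of_eventuallyEq ?_
  filter_upwards [extChartAt_source_mem_nhds (I := I) x] with y hy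
  exact (congrArg f ((extChartAt I x).left_inv hy)).symm

variable [I.Boundaryless]

theorem mD_comp_extChartAt_symm {f : X → Y} {x : X} (hf : MDifferentiableAt I J f x) :
    mD 𝓘(ℝ, E) J (fun v => f ((extChartAt I x).symm v)) (extChartAt I x x) = mD I J f x := by
  rw [mD_comp (J := I) _ (by rwa [extChartAt_to_inv])
    ((contMDiffAt_extChartAt_symm' x (mem_extChartAt_target x)).mdifferentiableAt (by simp)),
    mD_extChartAt_symm_self, extChartAt_to_inv, ContinuousLinearMap.comp_id]

end ChartAtPoint

/-! ### Local expressions of the suspension and its Liouville form -/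

section LocalExpression

open Filter Topology
open scoped CotInstances

variable {m : ℕ} {M : Type*} [TopologicalSpace M] [ChartedSpace (Eu (m + 1)) M]
  [IsManifold (𝓡 (m + 1)) ∞ M]
  {S : Type*} [TopologicalSpace S] [ChartedSpace (Eu (2 * m + 1)) S]
  [IsManifold (𝓡 (2 * m + 1)) ∞ S]
  {L : Type*} [TopologicalSpace L] [ChartedSpace (Eu m) L] [IsManifold (𝓡 m) ∞ L]
  {U : Set (Cot (n := m + 1) M)} {Z : ∀ z : Cot (n := m + 1) M, TangentSpace (cotModel (m + 1)) z}
  {j : S → Cot (n := m + 1) M} {R : ∀ x : S, TangentSpace (𝓡 (2 * m + 1)) x} {η : ℝ → S → S}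
  {Q : L → S} {ε₀ ε : ℝ} {c : ℝ × S → Cot (n := m + 1) M} {g : M → ℝ} {T : ℝ} {s a : S1 → ℝ}
  {δ Φm Φp : ℝ} {ρ : S1 → ℝ} {α : S1 × ℝ → Eu 2} {l₀ : L}

/-- The model space of `(L × ℝ) × ℝ`. -/
abbrev LiftE (m : ℕ) : Type := (Eu m × ℝ) × ℝ

/-- The circle factors have been lifted to `ℝ`, so only `L` contributes a nontrivial chart and the
local formulas depend only on a point `l₀` of `L`. -/
theorem extChartAt_lift_symm (p : (L × ℝ) × ℝ) (v : LiftE m) :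
    (extChartAt (liftModel m) p).symm v =
      (((extChartAt (𝓡 m) p.1.1).symm v.1.1, v.1.2), v.2) := by
  simp only [extChartAt_prod, extChartAt_model_space_eq_id]
  rfl

theorem extChartAt_lift_self (p : (L × ℝ) × ℝ) :
    extChartAt (liftModel m) p p = ((extChartAt (𝓡 m) p.1.1 p.1.1, p.1.2), p.2) := by
  simp only [extChartAt_prod, extChartAt_model_space_eq_id]
  rfl

/-- The coordinates `(a, s, y)` along the curve. -/
def curveCoord (s a : S1 → ℝ) (v : LiftE m) : CoreE m :=
  (a (v.1.2 : S1), (s (v.1.2 : S1), v.1.1))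

/-- The map `baseMap` in the chart of `L` at `l₀`. -/
def localBase (c : ℝ × S → Cot (n := m + 1) M) (η : ℝ → S → S) (Q : L → S) (s a : S1 → ℝ) (l₀ : L)
    (v : LiftE m) : Cot (n := m + 1) M :=
  coreMap c η Q l₀ (curveCoord s a v)

/-- The function `psi` in the chart of `L` at `l₀`. -/
def localPsi (c : ℝ × S → Cot (n := m + 1) M) (η : ℝ → S → S) (Q : L → S) (s a : S1 → ℝ)
    (g : M → ℝ) (T : ℝ) (l₀ : L) (v : LiftE m) : ℝ :=
  T * g (localBase c η Q s a l₀ v).1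

/-- The function `Phi` in the chart of `L` at `l₀`. -/
def localPhi (c : ℝ × S → Cot (n := m + 1) M) (η : ℝ → S → S) (Q : L → S) (s a : S1 → ℝ)
    (g : M → ℝ) (T : ℝ) (ρ : S1 → ℝ) (l₀ : L) (v : LiftE m) : ℝ :=
  localPsi c η Q s a g T l₀ v * derivS1 ρ v.2

/-- The first component of `figureEightMap` in the chart of `L` at `l₀`. -/
def localIsotopy (c : ℝ × S → Cot (n := m + 1) M) (η : ℝ → S → S) (Q : L → S) (s a : S1 → ℝ)
    (g : M → ℝ) (T : ℝ) (ρ : S1 → ℝ) (l₀ : L) (v : LiftE m) : Cot (n := m + 1) M :=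
  translate (m + 1) g (ρ (v.2 : S1) * T) (localBase c η Q s a l₀ v)

/-- The second component of `figureEightMap` in the chart of `L` at `l₀`. -/
def localPlane (c : ℝ × S → Cot (n := m + 1) M) (η : ℝ → S → S) (Q : L → S) (s a : S1 → ℝ)
    (g : M → ℝ) (T : ℝ) (ρ : S1 → ℝ) (α : S1 × ℝ → Eu 2) (l₀ : L) (v : LiftE m) : Eu 2 :=
  α ((v.2 : S1), localPhi c η Q s a g T ρ l₀ v)

theorem lift_figureEightMap_extChartAt_symm (p : (L × ℝ) × ℝ) (v : LiftE m) :
    lift (figureEightMap c η Q s a g T ρ α) ((extChartAt (liftModel m) p).symm v) =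
      (localIsotopy c η Q s a g T ρ p.1.1 v, localPlane c η Q s a g T ρ α p.1.1 v) := by
  rw [extChartAt_lift_symm]
  rfl

theorem localPhi_mem
    (hΦ : ∀ (w : L × S1) (Θ : S1), Phi c η Q s a g T ρ w Θ ∈ Ioo Φm Φp) (l₀ : L) (v : LiftE m) :
    localPhi c η Q s a g T ρ l₀ v ∈ Ioo Φm Φp :=
  hΦ ((extChartAt (𝓡 m) l₀).symm v.1.1, (v.1.2 : S1)) (v.2 : S1)

theorem hasFDerivAt_circle {f : S1 → ℝ} (hf : SmoothOnS1 f) (v : LiftE m) :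
    HasFDerivAt (fun v : LiftE m => f (v.2 : S1))
      (derivS1 f v.2 • ContinuousLinearMap.snd ℝ (Eu m × ℝ) ℝ) v :=
  (hf.hasDerivAt v.2).comp_hasFDerivAt v hasFDerivAt_snd

theorem hasFDerivAt_curve {f : S1 → ℝ} (hf : SmoothOnS1 f) (v : LiftE m) :
    HasFDerivAt (fun v : LiftE m => f (v.1.2 : S1))
      (derivS1 f v.1.2 • (ContinuousLinearMap.snd ℝ (Eu m) ℝ).comp
        (ContinuousLinearMap.fst ℝ (Eu m × ℝ) ℝ)) v :=
  HasDerivAt.comp_hasFDerivAt (h₂ := fun t : ℝ => f (t : S1)) v (hf.hasDerivAt v.1.2)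
    (hasFDerivAt_snd.comp v hasFDerivAt_fst)

theorem contDiff_curveCoord (hs : SmoothOnS1 s) (ha : SmoothOnS1 a) :
    ContDiff ℝ ∞ (curveCoord (m := m) s a) := by
  have h1 : ContDiff ℝ ∞ (fun v : LiftE m => v.1.2) := by fun_prop
  have h2 : ContDiff ℝ ∞ (fun v : LiftE m => v.1.1) := by fun_prop
  exact (ContDiff.comp (g := fun t : ℝ => a (t : S1)) ha h1).prodMk
    ((ContDiff.comp (g := fun t : ℝ => s (t : S1)) hs h1).prodMk h2)

theorem hasFDerivAt_curveCoord (hs : SmoothOnS1 s) (ha : SmoothOnS1 a) (v : LiftE m) :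
    HasFDerivAt (curveCoord (m := m) s a)
      ((derivS1 a v.1.2 • (ContinuousLinearMap.snd ℝ (Eu m) ℝ).comp
        (ContinuousLinearMap.fst ℝ (Eu m × ℝ) ℝ)).prod
        ((derivS1 s v.1.2 • (ContinuousLinearMap.snd ℝ (Eu m) ℝ).comp
        (ContinuousLinearMap.fst ℝ (Eu m × ℝ) ℝ)).prod
          ((ContinuousLinearMap.fst ℝ (Eu m) ℝ).comp (ContinuousLinearMap.fst ℝ (Eu m × ℝ) ℝ)))) v :=
  (hasFDerivAt_curve ha v).prodMk ((hasFDerivAt_curve hs v).prodMk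
    (hasFDerivAt_fst.comp v hasFDerivAt_fst))

/-- The data of the construction, for a given curve in the strip. -/
structure IsStripData (U : Set (Cot (n := m + 1) M))
    (Z : ∀ z : Cot (n := m + 1) M, TangentSpace (cotModel (m + 1)) z) (j : S → Cot (n := m + 1) M)
    (β : S → ℝ) (R : ∀ x : S, TangentSpace (𝓡 (2 * m + 1)) x) (η : ℝ → S → S) (Q : L → S)
    (ε₀ ε : ℝ) (c : ℝ × S → Cot (n := m + 1) M) (g : M → ℝ) (s a : S1 → ℝ) : Prop where
  liouville : IsLiouvilleField (m + 1) U Z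
  emb : IsSmoothEmb (𝓡 (2 * m + 1)) (cotModel (m + 1)) j
  emb_mem : ∀ x, j x ∈ U
  smooth_β : ContMDiff (𝓡 (2 * m + 1)) 𝓘(ℝ, ℝ) ∞ β
  exact_β : ∀ x, pullbackForm (𝓡 (2 * m + 1)) (cotModel (m + 1)) j (FigureEight.liouville (m + 1)) x -
    contactForm (m + 1) (k := 2 * m + 1) Z j x = dform (𝓡 (2 * m + 1)) β x
  reeb : IsReebField (𝓡 (2 * m + 1)) (contactForm (m + 1) (k := 2 * m + 1) Z j) R
  flow : IsFlow (𝓡 (2 * m + 1)) R η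
  leg_emb : IsSmoothEmb (𝓡 m) (𝓡 (2 * m + 1)) Q
  leg : ∀ l, pullbackForm (𝓡 m) (𝓡 (2 * m + 1)) Q
    (contactForm (m + 1) (k := 2 * m + 1) Z j) l = 0
  pos : 0 < ε
  lt : ε < ε₀
  collar : IsFlowCollar (m + 1) (k := 2 * m + 1) U Z j ε₀ c
  smooth_g : ContMDiff (𝓡 (m + 1)) 𝓘(ℝ, ℝ) ∞ g
  curve : IsStripCurve ε s a

namespace IsStripData

variable {β : S → ℝ}

theorem mem_Ioo (D : IsStripData U Z j β R η Q ε₀ ε c g s a) (t : S1) : a t ∈ Ioo (-ε₀) ε₀ :=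
  mem_Ioo_of_mem_Icc D.pos D.lt (D.curve.mem_strip t)

theorem contMDiffAt_localBase (D : IsStripData U Z j β R η Q ε₀ ε c g s a) {v : LiftE m}
    (hv : v.1.1 ∈ (extChartAt (𝓡 m) l₀).target) :
    ContMDiffAt 𝓘(ℝ, LiftE m) (cotModel (m + 1)) ∞ (localBase c η Q s a l₀) v :=
  ContMDiffAt.comp (g := coreMap c η Q l₀) v
    (contMDiffAt_coreMap (v := curveCoord s a v) D.flow D.leg_emb D.collar l₀ (D.mem_Ioo _) hv)
    (contDiff_curveCoord D.curve.smooth_s D.curve.smooth_a).contDiffAt.contMDiffAt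

theorem contDiffAt_localPsi (D : IsStripData U Z j β R η Q ε₀ ε c g s a) {v : LiftE m}
    (hv : v.1.1 ∈ (extChartAt (𝓡 m) l₀).target) :
    ContDiffAt ℝ ∞ (localPsi c η Q s a g T l₀) v :=
  contDiffAt_const.mul (contMDiffAt_iff_contDiffAt.1
    (D.smooth_g.contMDiffAt.comp v (contMDiff_cot_proj.contMDiffAt.comp v (D.contMDiffAt_localBase hv))))

theorem contDiffAt_localPhi (D : IsStripData U Z j β R η Q ε₀ ε c g s a) (hρ : SmoothOnS1 ρ)
    {v : LiftE m} (hv : v.1.1 ∈ (extChartAt (𝓡 m) l₀).target) :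
    ContDiffAt ℝ ∞ (localPhi c η Q s a g T ρ l₀) v :=
  (D.contDiffAt_localPsi hv).mul (hρ.contDiff_derivS1.contDiffAt.comp v contDiffAt_snd)

theorem contMDiffAt_localIsotopy (D : IsStripData U Z j β R η Q ε₀ ε c g s a) (hρ : SmoothOnS1 ρ)
    {v : LiftE m} (hv : v.1.1 ∈ (extChartAt (𝓡 m) l₀).target) :
    ContMDiffAt 𝓘(ℝ, LiftE m) (cotModel (m + 1)) ∞ (localIsotopy c η Q s a g T ρ l₀) v := by
  have h1 : ContDiffAt ℝ ∞ (fun v : LiftE m => ρ (v.2 : S1) * T) v :=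
    (ContDiffAt.comp (g := fun t : ℝ => ρ (t : S1)) v hρ.contDiffAt contDiffAt_snd).mul
      contDiffAt_const
  exact (contMDiff_translate D.smooth_g).contMDiffAt.comp v
    (h1.contMDiffAt.prodMk (D.contMDiffAt_localBase hv))

/-- A smooth function on the annulus, along the second component of `figureEightMap`. -/
theorem contDiffAt_annulus (D : IsStripData U Z j β R η Q ε₀ ε c g s a) (hρ : SmoothOnS1 ρ)
    (hΦ : ∀ (w : L × S1) (Θ : S1), Phi c η Q s a g T ρ w Θ ∈ Ioo Φm Φp)
    {G : Type*} [NormedAddCommGroup G] [NormedSpace ℝ G] {f : ℝ × ℝ → G}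
    (hf : ContDiffOn ℝ ∞ f (univ ×ˢ Ioo Φm Φp))
    {v : LiftE m} (hv : v.1.1 ∈ (extChartAt (𝓡 m) l₀).target) :
    ContDiffAt ℝ ∞ (fun v : LiftE m => f (v.2, localPhi c η Q s a g T ρ l₀ v)) v :=
  ContDiffAt.comp (g := f) v (hf.contDiffAt
    ((isOpen_univ.prod isOpen_Ioo).mem_nhds ⟨mem_univ _, localPhi_mem hΦ l₀ v⟩))
    (contDiffAt_snd.prodMk (D.contDiffAt_localPhi hρ hv))

theorem fderiv_annulus (D : IsStripData U Z j β R η Q ε₀ ε c g s a) (hρ : SmoothOnS1 ρ)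
    (hΦ : ∀ (w : L × S1) (Θ : S1), Phi c η Q s a g T ρ w Θ ∈ Ioo Φm Φp)
    {G : Type*} [NormedAddCommGroup G] [NormedSpace ℝ G] {f : ℝ × ℝ → G}
    (hf : ContDiffOn ℝ ∞ f (univ ×ˢ Ioo Φm Φp))
    {v : LiftE m} (hv : v.1.1 ∈ (extChartAt (𝓡 m) l₀).target) (w : LiftE m) :
    fderiv ℝ (fun v : LiftE m => f (v.2, localPhi c η Q s a g T ρ l₀ v)) v w =
      fderiv ℝ f (v.2, localPhi c η Q s a g T ρ l₀ v)
        (w.2, fderiv ℝ (localPhi c η Q s a g T ρ l₀) v w) := by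
  have h1 := (hasFDerivAt_snd (𝕜 := ℝ) (p := v)).prodMk
    ((D.contDiffAt_localPhi (T := T) hρ hv).differentiableAt (by simp)).hasFDerivAt
  have h2 : HasFDerivAt f _ (v.2, localPhi c η Q s a g T ρ l₀ v) :=
    ((hf.contDiffAt ((isOpen_univ.prod isOpen_Ioo).mem_nhds
      ⟨mem_univ _, localPhi_mem hΦ l₀ v⟩)).differentiableAt (by simp)).hasFDerivAt
  have h3 := HasFDerivAt.comp (g := f) v h2 h1
  exact congrArg (fun A : LiftE m →L[ℝ] G => A w) h3.fderiv

theorem contDiffAt_localPlane (D : IsStripData U Z j β R η Q ε₀ ε c g s a) (hρ : SmoothOnS1 ρ)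
    (hα : IsFigureEight δ Φm Φp α)
    (hΦ : ∀ (w : L × S1) (Θ : S1), Phi c η Q s a g T ρ w Θ ∈ Ioo Φm Φp)
    {v : LiftE m} (hv : v.1.1 ∈ (extChartAt (𝓡 m) l₀).target) :
    ContDiffAt ℝ ∞ (localPlane c η Q s a g T ρ α l₀) v :=
  D.contDiffAt_annulus hρ hΦ hα.smooth hv

/-- `figureEightMap` is smooth. -/
theorem contMDiff_lift (D : IsStripData U Z j β R η Q ε₀ ε c g s a) (hρ : SmoothOnS1 ρ)
    (hα : IsFigureEight δ Φm Φp α)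
    (hΦ : ∀ (w : L × S1) (Θ : S1), Phi c η Q s a g T ρ w Θ ∈ Ioo Φm Φp) :
    ContMDiff (liftModel m) (cotPlaneModel (m + 1)) ∞ (lift (figureEightMap c η Q s a g T ρ α)) := by
  intro p
  refine contMDiffAt_of_comp_extChartAt_symm ?_
  simp only [lift_figureEightMap_extChartAt_symm]
  rw [extChartAt_lift_self]
  have hv := mem_extChartAt_target (I := 𝓡 m) p.1.1
  exact (D.contMDiffAt_localIsotopy hρ (by exact hv)).prodMk
    (D.contDiffAt_localPlane hρ hα hΦ (by exact hv)).contMDiffAt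

/-- The primitive in the definition of relative exactness. -/
def primitive (Z : ∀ z : Cot (n := m + 1) M, TangentSpace (cotModel (m + 1)) z) (β : S → ℝ)
    (c : ℝ × S → Cot (n := m + 1) M) (η : ℝ → S → S) (Q : L → S) (s a : S1 → ℝ)
    (g : M → ℝ) (T : ℝ) (ρ : S1 → ℝ) (k : S1 × ℝ → ℝ) (p : (L × S1) × S1) : ℝ :=
  corePrimitive Z c β (a p.1.2) (η (s p.1.2) (Q p.1.1)) + ρ p.2 * psi c η Q s a g T p.1 +
    k (p.2, Phi c η Q s a g T ρ p.1 p.2)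

/-- `primitive` in the chart of `L` at `l₀`. -/
def localPrimitive (Z : ∀ z : Cot (n := m + 1) M, TangentSpace (cotModel (m + 1)) z) (β : S → ℝ)
    (c : ℝ × S → Cot (n := m + 1) M) (η : ℝ → S → S) (Q : L → S) (s a : S1 → ℝ)
    (g : M → ℝ) (T : ℝ) (ρ : S1 → ℝ) (k : S1 × ℝ → ℝ) (l₀ : L) (v : LiftE m) : ℝ :=
  corePrimitive Z c β (curveCoord s a v).1 (reebMap η Q l₀ (curveCoord s a v).2) +
    ρ (v.2 : S1) * localPsi c η Q s a g T l₀ v + k ((v.2 : S1), localPhi c η Q s a g T ρ l₀ v)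

theorem lift_primitive_extChartAt_symm {k : S1 × ℝ → ℝ} (p : (L × ℝ) × ℝ) (v : LiftE m) :
    lift (primitive Z β c η Q s a g T ρ k) ((extChartAt (liftModel m) p).symm v) =
      localPrimitive Z β c η Q s a g T ρ k p.1.1 v := by
  rw [extChartAt_lift_symm]
  rfl

theorem mD_proj_translate (D : IsStripData U Z j β R η Q ε₀ ε c g s a) {v : LiftE m}
    (hv : v.1.1 ∈ (extChartAt (𝓡 m) l₀).target) :
    T • (mD (𝓡 (m + 1)) 𝓘(ℝ, ℝ) g (localBase c η Q s a l₀ v).1).comp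
      (mD 𝓘(ℝ, LiftE m) (𝓡 (m + 1)) (fun v => (localBase c η Q s a l₀ v).1) v) =
      fderiv ℝ (localPsi c η Q s a g T l₀) v := by
  have h1 : ContMDiffAt 𝓘(ℝ, LiftE m) (𝓡 (m + 1)) ∞ (fun v => (localBase c η Q s a l₀ v).1) v :=
    contMDiff_cot_proj.contMDiffAt.comp v (D.contMDiffAt_localBase hv)
  have h2 : ContDiffAt ℝ ∞ (fun v => g (localBase c η Q s a l₀ v).1) v :=
    contMDiffAt_iff_contDiffAt.1 (D.smooth_g.contMDiffAt.comp v h1)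
  rw [← mD_comp (J := 𝓡 (m + 1)) v (D.smooth_g.mdifferentiableAt (by simp))
    (h1.mdifferentiableAt (by simp)), mD_eq_fderiv]
  exact ((h2.differentiableAt (by simp)).hasFDerivAt.const_mul T).fderiv.symm

/-- The translation changes the covector and leaves the base point fixed. So the dependence of the
translation time on `Θ` produces no term with `ρ'`. -/
theorem pb_localIsotopy (D : IsStripData U Z j β R η Q ε₀ ε c g s a) (hρ : SmoothOnS1 ρ) {v : LiftE m}
    (hv : v.1.1 ∈ (extChartAt (𝓡 m) l₀).target) :
    pb (localIsotopy c η Q s a g T ρ l₀) (FigureEight.liouville (m + 1)) v =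
      pb (localBase c η Q s a l₀) (FigureEight.liouville (m + 1)) v +
        ρ (v.2 : S1) • fderiv ℝ (localPsi c η Q s a g T l₀) v := by
  rw [pb_liouville ((D.contMDiffAt_localIsotopy hρ hv).mdifferentiableAt (by simp)),
    pb_liouville ((D.contMDiffAt_localBase hv).mdifferentiableAt (by simp)), localIsotopy,
    covec_translate, ← D.mD_proj_translate hv, ContinuousLinearMap.add_comp, mul_smul]
  rfl

/-- The chain rule applied to `pb_coreMap_liouville` along `t' ↦ (a(t'), s(t'))`. -/
theorem localBase_primitive (D : IsStripData U Z j β R η Q ε₀ ε c g s a) {v : LiftE m}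
    (hv : v.1.1 ∈ (extChartAt (𝓡 m) l₀).target) :
    ContDiffAt ℝ ∞ (fun v : LiftE m =>
      corePrimitive Z c β (curveCoord s a v).1 (reebMap η Q l₀ (curveCoord s a v).2)) v ∧
    pb (localBase c η Q s a l₀) (FigureEight.liouville (m + 1)) v =
      (Real.exp (a (v.1.2 : S1)) * derivS1 s v.1.2) •
        (ContinuousLinearMap.snd ℝ (Eu m) ℝ).comp (ContinuousLinearMap.fst ℝ (Eu m × ℝ) ℝ) +
      fderiv ℝ (fun v : LiftE m =>
        corePrimitive Z c β (curveCoord s a v).1 (reebMap η Q l₀ (curveCoord s a v).2)) v := by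
  obtain ⟨h1, h2⟩ := pb_coreMap_liouville (v := curveCoord s a v) D.liouville D.emb D.emb_mem
    D.smooth_β D.exact_β D.reeb D.flow D.leg_emb D.leg D.collar l₀ (D.mem_Ioo _) hv
  have h3 := hasFDerivAt_curveCoord D.curve.smooth_s D.curve.smooth_a v
  have h4 := (contDiff_curveCoord (m := m) D.curve.smooth_s D.curve.smooth_a).contDiffAt (x := v)
  refine ⟨ContDiffAt.comp (g := fun v : CoreE m => corePrimitive Z c β v.1 (reebMap η Q l₀ v.2))
    v h1 h4, ?_⟩
  have h5 := HasFDerivAt.comp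
    (g := fun v : CoreE m => corePrimitive Z c β v.1 (reebMap η Q l₀ v.2)) v
    (h1.differentiableAt (by simp)).hasFDerivAt h3
  have h6 : fderiv ℝ (fun v : LiftE m =>
      corePrimitive Z c β (curveCoord s a v).1 (reebMap η Q l₀ (curveCoord s a v).2)) v = _ :=
    h5.fderiv
  have h7 : mD 𝓘(ℝ, LiftE m) (cotModel (m + 1)) (localBase c η Q s a l₀) v = _ :=
    mD_comp (J := 𝓘(ℝ, CoreE m)) (g := coreMap c η Q l₀) v
    ((contMDiffAt_coreMap D.flow D.leg_emb D.collar l₀ (D.mem_Ioo _) hv).mdifferentiableAt (by simp))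
    h3.differentiableAt.mdifferentiableAt
  have h8 : pb (localBase c η Q s a l₀) (FigureEight.liouville (m + 1)) v =
      (pb (coreMap c η Q l₀) (FigureEight.liouville (m + 1)) (curveCoord s a v)).comp
        (fderiv ℝ (curveCoord s a) v) := by
    rw [pb, h7, mD_eq_fderiv]
    rfl
  rw [h8, h2, h6, h3.fderiv, ContinuousLinearMap.add_comp]
  congr 1
  refine ContinuousLinearMap.ext fun w => ?_
  simp [curveCoord]
  ring

/-- The pull-back of `p dq + x dy` by `figureEightMap`, in the chart of `L` at `l₀`. -/
theorem exact_local (D : IsStripData U Z j β R η Q ε₀ ε c g s a) (hρ : SmoothOnS1 ρ)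
    (hα : IsFigureEight δ Φm Φp α)
    (hΦ : ∀ (w : L × S1) (Θ : S1), Phi c η Q s a g T ρ w Θ ∈ Ioo Φm Φp) {k : S1 × ℝ → ℝ}
    (hk : ContDiffOn ℝ ∞ (fun p : ℝ × ℝ => k ((p.1 : S1), p.2)) (univ ×ˢ Ioo Φm Φp))
    (hk' : ∀ p : ℝ × ℝ, p.2 ∈ Ioo Φm Φp → ∀ u : ℝ × ℝ, α ((p.1 : S1), p.2) 0 *
          fderiv ℝ (fun p : ℝ × ℝ => α ((p.1 : S1), p.2)) p u 1 =
        p.2 * u.1 + fderiv ℝ (fun p : ℝ × ℝ => k ((p.1 : S1), p.2)) p u)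
    {v : LiftE m} (hv : v.1.1 ∈ (extChartAt (𝓡 m) l₀).target) :
    ContDiffAt ℝ ∞ (localPrimitive Z β c η Q s a g T ρ k l₀) v ∧
    pb (localIsotopy c η Q s a g T ρ l₀) (FigureEight.liouville (m + 1)) v +
        localPlane c η Q s a g T ρ α l₀ v 0 •
          fderiv ℝ (fun v => localPlane c η Q s a g T ρ α l₀ v 1) v =
      (Real.exp (a (v.1.2 : S1)) * derivS1 s v.1.2) •
        (ContinuousLinearMap.snd ℝ (Eu m) ℝ).comp (ContinuousLinearMap.fst ℝ (Eu m × ℝ) ℝ) +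
      fderiv ℝ (localPrimitive Z β c η Q s a g T ρ k l₀) v := by
  obtain ⟨h1, h2⟩ := D.localBase_primitive hv
  have h3 := D.contDiffAt_localPsi (T := T) hv
  have h4 := D.contDiffAt_annulus hρ hΦ hk hv
  have h5 : ContDiffAt ℝ ∞ (fun v : LiftE m => ρ (v.2 : S1)) v :=
    ContDiffAt.comp (g := fun t : ℝ => ρ (t : S1)) v hρ.contDiffAt contDiffAt_snd
  refine ⟨(h1.add (h5.mul h3)).add h4, ?_⟩
  have h6 : HasFDerivAt (localPrimitive Z β c η Q s a g T ρ k l₀) _ v :=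
    ((h1.differentiableAt (by simp)).hasFDerivAt.add ((hasFDerivAt_circle hρ v).mul
      (h3.differentiableAt (by simp)).hasFDerivAt)).add (h4.differentiableAt (by simp)).hasFDerivAt
  have h7 := (D.contDiffAt_localPlane hρ hα hΦ hv).differentiableAt (by simp)
  rw [h6.fderiv, D.pb_localIsotopy hρ hv, h2]
  refine ContinuousLinearMap.ext fun w => ?_
  have h8 := hk' (v.2, localPhi c η Q s a g T ρ l₀ v) (localPhi_mem hΦ l₀ v)
    (w.2, fderiv ℝ (localPhi c η Q s a g T ρ l₀) v w)
  rw [← D.fderiv_annulus hρ hΦ hk hv, ← D.fderiv_annulus hρ hΦ hα.smooth hv] at h8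
  have h9 : localPlane c η Q s a g T ρ α l₀ v 0 *
      fderiv ℝ (fun v => localPlane c η Q s a g T ρ α l₀ v 1) v w =
      localPhi c η Q s a g T ρ l₀ v * w.2 +
        fderiv ℝ (fun v : LiftE m => k ((v.2 : S1), localPhi c η Q s a g T ρ l₀ v)) v w := by
    rw [← fderiv_euclidean_apply h7]
    exact h8
  simp only [add_apply, smul_apply, smul_eq_mul, h9, ContinuousLinearMap.comp_apply,
    ContinuousLinearMap.coe_snd', ContinuousLinearMap.coe_fst']
  -- With `Φ = ψ ρ'`, the terms `ρ dψ` from the translation and `Φ dΘ` from the plane add up to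
  -- `d(ρψ)`.
  simp only [localPhi]
  ring

end IsStripData

end LocalExpression
end FigureEight
end

noncomputable section

set_option linter.unusedSectionVars false

namespace FigureEight

/-! ### Isotropy and relative exactness -/

section LagrangianEmbedding

open Filter Topology
open scoped CotInstances

variable {m : ℕ} {M : Type*} [TopologicalSpace M] [ChartedSpace (Eu (m + 1)) M]
  [IsManifold (𝓡 (m + 1)) ∞ M]
  {S : Type*} [TopologicalSpace S] [ChartedSpace (Eu (2 * m + 1)) S]
  [IsManifold (𝓡 (2 * m + 1)) ∞ S]
  {L : Type*} [TopologicalSpace L] [ChartedSpace (Eu m) L] [IsManifold (𝓡 m) ∞ L]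
  {U : Set (Cot (n := m + 1) M)} {Z : ∀ z : Cot (n := m + 1) M, TangentSpace (cotModel (m + 1)) z}
  {j : S → Cot (n := m + 1) M} {R : ∀ x : S, TangentSpace (𝓡 (2 * m + 1)) x} {η : ℝ → S → S}
  {Q : L → S} {ε₀ ε : ℝ} {c : ℝ × S → Cot (n := m + 1) M} {g : M → ℝ} {T : ℝ} {s a : S1 → ℝ}
  {δ Φm Φp : ℝ} {ρ : S1 → ℝ} {α : S1 × ℝ → Eu 2} {l₀ : L} {β : S → ℝ}

namespace IsStripData

/-- The exterior derivative of the relation in `exact_local`: its left side gives the pull-back of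
the symplectic form, while on the right `dh` is closed and `e^{a(t')} ds(t')` is a function of `t'`
times `dt'`. -/
theorem isotropic_local (D : IsStripData U Z j β R η Q ε₀ ε c g s a) (hρ : SmoothOnS1 ρ)
    (hα : IsFigureEight δ Φm Φp α)
    (hΦ : ∀ (w : L × S1) (Θ : S1), Phi c η Q s a g T ρ w Θ ∈ Ioo Φm Φp)
    {v : LiftE m} (hv : v.1.1 ∈ (extChartAt (𝓡 m) l₀).target) (x y : LiftE m) :
    stdOmega (m + 1) (mD 𝓘(ℝ, LiftE m) (cotModel (m + 1)) (localIsotopy c η Q s a g T ρ l₀) v x)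
        (mD 𝓘(ℝ, LiftE m) (cotModel (m + 1)) (localIsotopy c η Q s a g T ρ l₀) v y) +
      (fderiv ℝ (localPlane c η Q s a g T ρ α l₀) v x 0 *
          fderiv ℝ (localPlane c η Q s a g T ρ α l₀) v y 1 -
        fderiv ℝ (localPlane c η Q s a g T ρ α l₀) v x 1 *
          fderiv ℝ (localPlane c η Q s a g T ρ α l₀) v y 0) = 0 := by
  obtain ⟨k, hk, hk'⟩ := hα.exists_primitive
  set P := localPlane c η Q s a g T ρ α l₀ with hPdef
  set h := localPrimitive Z β c η Q s a g T ρ k l₀ with hhdef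
  have hP := D.contDiffAt_localPlane hρ hα hΦ hv
  have hPd : DifferentiableAt ℝ P v := hP.differentiableAt (by simp)
  have hX : ContDiffAt ℝ ∞ (fun v => P v 0) v := contDiffAt_euclidean.1 hP 0
  have hY : ContDiffAt ℝ ∞ (fun v => P v 1) v := contDiffAt_euclidean.1 hP 1
  have hh : ContDiffAt ℝ ∞ h v := (D.exact_local hρ hα hΦ hk hk' hv).1
  have hsymm : ∀ {f : LiftE m → ℝ}, ContDiffAt ℝ ∞ f v →
      fderiv ℝ (fderiv ℝ f) v x y = fderiv ℝ (fderiv ℝ f) v y x := fun {f} hf =>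
    (hf.isSymmSndFDerivAt (by
      simpa [minSmoothness_of_isRCLikeNormedField] using two_le_infty)) x y
  have hd2 : ∀ {f : LiftE m → ℝ}, ContDiffAt ℝ ∞ f v →
      HasFDerivAt (fderiv ℝ f) (fderiv ℝ (fderiv ℝ f) v) v := fun {f} hf =>
    ((hf.fderiv_right (m := 1) two_le_infty).differentiableAt (by simp)).hasFDerivAt
  have hL := D.contMDiffAt_localIsotopy (T := T) hρ hv
  have h1 : HasFDerivAt (pb (localIsotopy c η Q s a g T ρ l₀) (FigureEight.liouville (m + 1))) _ v :=
    ((FormSmoothAt.contDiffAt_pb hL (formSmoothAt_liouville _)).differentiableAt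
      (by simp)).hasFDerivAt
  have h2 := h1.add (((hX.differentiableAt (by simp)).hasFDerivAt).smul (hd2 hY))
  have hf : ContDiff ℝ ∞ (fun t : ℝ => Real.exp (a (t : S1)) * derivS1 s t) :=
    (Real.contDiff_exp.comp (show ContDiff ℝ ∞ (fun t : ℝ => a (t : S1)) from
      D.curve.smooth_a)).mul D.curve.smooth_s.contDiff_derivS1
  have h0 : HasFDerivAt (fun v : LiftE m => v.1.2) ((ContinuousLinearMap.snd ℝ (Eu m) ℝ).comp
      (ContinuousLinearMap.fst ℝ (Eu m × ℝ) ℝ)) v :=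
    hasFDerivAt_snd.comp v hasFDerivAt_fst
  have h3 := HasDerivAt.comp_hasFDerivAt (h₂ := fun t : ℝ => Real.exp (a (t : S1)) * derivS1 s t)
    (f := fun v : LiftE m => v.1.2) v (hf.differentiable (by simp) v.1.2).hasDerivAt h0
  have h4 := (h3.smul (hasFDerivAt_const ((ContinuousLinearMap.snd ℝ (Eu m) ℝ).comp
    (ContinuousLinearMap.fst ℝ (Eu m × ℝ) ℝ)) v)).add (hd2 hh)
  have hnhds : ∀ᶠ w : LiftE m in 𝓝 v, w.1.1 ∈ (extChartAt (𝓡 m) l₀).target :=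
    (continuous_fst.comp continuous_fst).continuousAt.preimage_mem_nhds
      ((isOpen_extChartAt_target l₀).mem_nhds hv)
  -- The relation holds on a neighbourhood of `v`, so both sides have the same derivative there.
  have h5 := h2.unique (h4.congr_of_eventuallyEq (hnhds.mono fun w hw =>
    (D.exact_local hρ hα hΦ hk hk' hw).2))
  have h6 := congrArg (fun A : LiftE m →L[ℝ] LiftE m →L[ℝ] ℝ => A x y - A y x) h5
  rw [← fderiv_pb_liouville_antisymm hL]
  simp only [fderiv_euclidean_apply hPd]
  have h7 := hsymm hY
  have h8 := hsymm hh
  simp only [add_apply, smul_apply, ContinuousLinearMap.smulRight_apply, smul_eq_mul, h7, h8,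
    ContinuousLinearMap.comp_apply, ContinuousLinearMap.coe_snd', ContinuousLinearMap.coe_fst',
    zero_apply, smul_zero] at h6
  linear_combination h6

theorem mdifferentiableAt_lift (D : IsStripData U Z j β R η Q ε₀ ε c g s a) (hρ : SmoothOnS1 ρ)
    (hα : IsFigureEight δ Φm Φp α)
    (hΦ : ∀ (w : L × S1) (Θ : S1), Phi c η Q s a g T ρ w Θ ∈ Ioo Φm Φp) (p : (L × ℝ) × ℝ) :
    MDifferentiableAt (liftModel m) (cotPlaneModel (m + 1))
      (lift (figureEightMap c η Q s a g T ρ α)) p :=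
  (D.contMDiff_lift hρ hα hΦ).mdifferentiableAt (by simp)

theorem target_mem (p : (L × ℝ) × ℝ) :
    (extChartAt (liftModel m) p p).1.1 ∈ (extChartAt (𝓡 m) p.1.1).target := by
  rw [extChartAt_lift_self]
  exact mem_extChartAt_target (I := 𝓡 m) p.1.1

/-- The differential of `figureEightMap`. -/
theorem mD_lift (D : IsStripData U Z j β R η Q ε₀ ε c g s a) (hρ : SmoothOnS1 ρ)
    (hα : IsFigureEight δ Φm Φp α)
    (hΦ : ∀ (w : L × S1) (Θ : S1), Phi c η Q s a g T ρ w Θ ∈ Ioo Φm Φp) (p : (L × ℝ) × ℝ) :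
    mD (liftModel m) (cotPlaneModel (m + 1)) (lift (figureEightMap c η Q s a g T ρ α)) p =
      (mD 𝓘(ℝ, LiftE m) (cotModel (m + 1)) (localIsotopy c η Q s a g T ρ p.1.1)
        (extChartAt (liftModel m) p p)).prod
        (fderiv ℝ (localPlane c η Q s a g T ρ α p.1.1) (extChartAt (liftModel m) p p)) := by
  have hv := target_mem (m := m) p
  rw [← mD_comp_extChartAt_symm (D.mdifferentiableAt_lift hρ hα hΦ p)]
  simp only [lift_figureEightMap_extChartAt_symm]
  rw [mD_prodMk ((D.contMDiffAt_localIsotopy hρ hv).mdifferentiableAt (by simp))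
    ((D.contDiffAt_localPlane hρ hα hΦ hv).contMDiffAt.mdifferentiableAt (by simp)), mD_eq_fderiv]

theorem isotropic (D : IsStripData U Z j β R η Q ε₀ ε c g s a) (hρ : SmoothOnS1 ρ)
    (hα : IsFigureEight δ Φm Φp α)
    (hΦ : ∀ (w : L × S1) (Θ : S1), Phi c η Q s a g T ρ w Θ ∈ Ioo Φm Φp) (p : (L × ℝ) × ℝ)
    (x y : LiftE m) :
    omegaPlane (m + 1) (lift (figureEightMap c η Q s a g T ρ α) p)
      (mD (liftModel m) (cotPlaneModel (m + 1)) (lift (figureEightMap c η Q s a g T ρ α)) p x)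
      (mD (liftModel m) (cotPlaneModel (m + 1)) (lift (figureEightMap c η Q s a g T ρ α)) p y) =
      0 := by
  rw [D.mD_lift hρ hα hΦ]
  have h := D.isotropic_local hρ hα hΦ (target_mem p) x y
  rw [← om_eq (lift (figureEightMap c η Q s a g T ρ α) p).1] at h
  exact h

/-- `figureEightMap` is exact relative to `W'`. -/
theorem isExactRel (D : IsStripData U Z j β R η Q ε₀ ε c g s a) (hρ : SmoothOnS1 ρ)
    (hα : IsFigureEight δ Φm Φp α)
    (hΦ : ∀ (w : L × S1) (Θ : S1), Phi c η Q s a g T ρ w Θ ∈ Ioo Φm Φp) :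
    IsExactRel s a (figureEightMap c η Q s a g T ρ α) := by
  obtain ⟨k, hk, hk'⟩ := hα.exists_primitive
  have hsm : ContMDiff (liftModel m) 𝓘(ℝ, ℝ) ∞ (lift (primitive Z β c η Q s a g T ρ k)) := by
    intro p
    refine contMDiffAt_of_comp_extChartAt_symm ?_
    simp only [lift_primitive_extChartAt_symm]
    exact (D.exact_local hρ hα hΦ hk hk' (target_mem p)).1.contMDiffAt
  refine ⟨primitive Z β c η Q s a g T ρ k, hsm, fun p => ?_⟩
  have hv := target_mem (m := m) p
  have h1 := (D.exact_local hρ hα hΦ hk hk' hv).2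
  have h2 : fderiv ℝ (localPrimitive Z β c η Q s a g T ρ k p.1.1) (extChartAt (liftModel m) p p) =
      mD (liftModel m) 𝓘(ℝ, ℝ) (lift (primitive Z β c η Q s a g T ρ k)) p := by
    rw [← mD_comp_extChartAt_symm (hsm.mdifferentiableAt (by simp))]
    simp only [lift_primitive_extChartAt_symm]
    rw [mD_eq_fderiv]
  have h3 := lift_figureEightMap_extChartAt_symm (c := c) (η := η) (Q := Q) (s := s) (a := a)
    (g := g) (T := T) (ρ := ρ) (α := α) p (extChartAt (liftModel m) p p)
  rw [extChartAt_to_inv] at h3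
  rw [h2] at h1
  have h4 : frm (pullbackForm (liftModel m) (cotPlaneModel (m + 1))
      (lift (figureEightMap c η Q s a g T ρ α)) (liouvillePlane (m + 1))) p =
      pb (localIsotopy c η Q s a g T ρ p.1.1) (FigureEight.liouville (m + 1))
          (extChartAt (liftModel m) p p) +
        localPlane c η Q s a g T ρ α p.1.1 (extChartAt (liftModel m) p p) 0 •
          fderiv ℝ (fun v => localPlane c η Q s a g T ρ α p.1.1 v 1)
            (extChartAt (liftModel m) p p) := by
    rw [frm_pullbackForm, D.mD_lift hρ hα hΦ, h3]
    refine ContinuousLinearMap.ext fun w => ?_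
    have h7 := (D.contDiffAt_localPlane hρ hα hΦ hv).differentiableAt (by simp)
    rw [add_apply, smul_apply, ← fderiv_euclidean_apply h7]
    rfl
  refine Eq.trans h4 (h1.trans ?_)
  rw [extChartAt_lift_self]
  rfl

end IsStripData

end LagrangianEmbedding
end FigureEight
end

noncomputable section

set_option linter.unusedSectionVars false

namespace FigureEight

/-! ### The immersion property and the embedding -/

section Immersion

open Filter Topology
open scoped CotInstances

variable {m : ℕ} {M : Type*} [TopologicalSpace M] [ChartedSpace (Eu (m + 1)) M]
  [IsManifold (𝓡 (m + 1)) ∞ M]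
  {S : Type*} [TopologicalSpace S] [ChartedSpace (Eu (2 * m + 1)) S]
  [IsManifold (𝓡 (2 * m + 1)) ∞ S]
  {L : Type*} [TopologicalSpace L] [ChartedSpace (Eu m) L] [IsManifold (𝓡 m) ∞ L]
  {U : Set (Cot (n := m + 1) M)} {Z : ∀ z : Cot (n := m + 1) M, TangentSpace (cotModel (m + 1)) z}
  {j : S → Cot (n := m + 1) M} {R : ∀ x : S, TangentSpace (𝓡 (2 * m + 1)) x} {η : ℝ → S → S}
  {Q : L → S} {ε₀ ε : ℝ} {c : ℝ × S → Cot (n := m + 1) M} {g : M → ℝ} {T : ℝ} {s a : S1 → ℝ}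
  {δ Φm Φp : ℝ} {ρ : S1 → ℝ} {α : S1 × ℝ → Eu 2} {l₀ : L} {β : S → ℝ}

namespace IsStripData

/-- The base map is recovered by the inverse translation. Its time depends only on `Θ`, so it
contributes nothing in a direction with vanishing `Θ` component. -/
theorem mD_localBase_eq_zero (D : IsStripData U Z j β R η Q ε₀ ε c g s a) (hρ : SmoothOnS1 ρ)
    {v : LiftE m} (hv : v.1.1 ∈ (extChartAt (𝓡 m) l₀).target) {w : LiftE m} (hw : w.2 = 0)
    (h : mD 𝓘(ℝ, LiftE m) (cotModel (m + 1)) (localIsotopy c η Q s a g T ρ l₀) v w = 0) :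
    mD 𝓘(ℝ, LiftE m) (cotModel (m + 1)) (localBase c η Q s a l₀) v w = 0 := by
  have h1 : localBase c η Q s a l₀ = fun v : LiftE m =>
      translate (m + 1) g (-(ρ (v.2 : S1) * T)) (localIsotopy c η Q s a g T ρ l₀ v) := by
    funext v
    rw [localIsotopy, translate_add, neg_add_cancel, translate_zero]
  have h2 := ((hasFDerivAt_circle hρ v).mul_const T).fun_neg
  have h3 := (D.contMDiffAt_localIsotopy (T := T) hρ hv).mdifferentiableAt (by simp)
  have h4 : mD 𝓘(ℝ, LiftE m) (cotModel (m + 1)) (fun v : LiftE m =>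
      translate (m + 1) g (-(ρ (v.2 : S1) * T)) (localIsotopy c η Q s a g T ρ l₀ v)) v = _ :=
    mD_comp (J := 𝓘(ℝ, ℝ).prod (cotModel (m + 1)))
    (g := fun p : ℝ × Cot (n := m + 1) M => translate (m + 1) g p.1 p.2)
    (f := fun v => (-(ρ (v.2 : S1) * T), localIsotopy c η Q s a g T ρ l₀ v)) v
    ((contMDiff_translate D.smooth_g).mdifferentiableAt (by simp))
    (h2.differentiableAt.mdifferentiableAt.prodMk h3)
  have h5 : -(T • derivS1 ρ v.2 • ContinuousLinearMap.snd ℝ (Eu m × ℝ) ℝ) w = 0 := by simp [hw]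
  rw [h1, h4, mD_prodMk h2.differentiableAt.mdifferentiableAt h3, mD_eq_fderiv, h2.fderiv,
    ContinuousLinearMap.comp_apply, ContinuousLinearMap.prod_apply, h, neg_apply, h5]
  exact map_zero (mD (𝓘(ℝ, ℝ).prod (cotModel (m + 1))) (cotModel (m + 1))
    (fun p : ℝ × Cot (n := m + 1) M => translate (m + 1) g p.1 p.2)
    (-(ρ (v.2 : S1) * T), localIsotopy c η Q s a g T ρ l₀ v))

/-- The collar is an immersion, so the components along `a` and along the hypersurface vanish
separately. The first gives `a' dt' = 0`; `λ` applied to the second gives `s' dt' = 0`, since `λ`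
pulls back to `ds`. Regularity of the curve then gives `dt' = 0`. -/
theorem curve_eq_zero (D : IsStripData U Z j β R η Q ε₀ ε c g s a) {v : LiftE m}
    (hv : v.1.1 ∈ (extChartAt (𝓡 m) l₀).target) {w : LiftE m}
    (h : mD 𝓘(ℝ, LiftE m) (cotModel (m + 1)) (localBase c η Q s a l₀) v w = 0) :
    w.1.2 = 0 ∧ mD 𝓘(ℝ, ℝ × Eu m) (𝓡 (2 * m + 1)) (reebMap η Q l₀) (curveCoord s a v).2
      (0, w.1.1) = 0 := by
  have hs := hasFDerivAt_curve (m := m) D.curve.smooth_s v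
  have ha := hasFDerivAt_curve (m := m) D.curve.smooth_a v
  have h1 : HasFDerivAt (fun v : LiftE m => (s (v.1.2 : S1), v.1.1)) _ v :=
    hs.prodMk (hasFDerivAt_fst.comp v hasFDerivAt_fst)
  have h2 := (contMDiffAt_reebMap (u := (curveCoord s a v).2) D.flow D.leg_emb l₀ hv
    ).mdifferentiableAt (by simp)
  have h3 : mD 𝓘(ℝ, LiftE m) (𝓡 (2 * m + 1))
      (fun v : LiftE m => reebMap η Q l₀ (s (v.1.2 : S1), v.1.1)) v = _ :=
    mD_comp (J := 𝓘(ℝ, ℝ × Eu m)) (g := reebMap η Q l₀)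
      (f := fun v : LiftE m => (s (v.1.2 : S1), v.1.1)) v h2 h1.differentiableAt.mdifferentiableAt
  have h4 : MDifferentiableAt 𝓘(ℝ, LiftE m) (𝓡 (2 * m + 1))
      (fun v : LiftE m => reebMap η Q l₀ (s (v.1.2 : S1), v.1.1)) v :=
    h2.comp v h1.differentiableAt.mdifferentiableAt
  have hmem : (a (v.1.2 : S1), reebMap η Q l₀ (s (v.1.2 : S1), v.1.1)) ∈
      Ioo (-ε₀) ε₀ ×ˢ (univ : Set S) := ⟨D.mem_Ioo _, mem_univ _⟩
  have h5 : mD 𝓘(ℝ, LiftE m) (cotModel (m + 1)) (localBase c η Q s a l₀) v = _ :=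
    mD_comp (J := 𝓘(ℝ, ℝ).prod (𝓡 (2 * m + 1))) (g := c)
      (f := fun v : LiftE m => (a (v.1.2 : S1), reebMap η Q l₀ (s (v.1.2 : S1), v.1.1))) v
      ((D.collar.contMDiffOn.contMDiffAt
        ((isOpen_Ioo.prod isOpen_univ).mem_nhds hmem)).mdifferentiableAt (by simp))
      (ha.differentiableAt.mdifferentiableAt.prodMk h4)
  have hinj : ∀ x, mD (𝓘(ℝ, ℝ).prod (𝓡 (2 * m + 1))) (cotModel (m + 1)) c
      (a (v.1.2 : S1), reebMap η Q l₀ (s (v.1.2 : S1), v.1.1)) x = 0 → x = 0 := fun x hx =>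
    D.collar.injective_mfderiv _ hmem (hx.trans (map_zero (mD (𝓘(ℝ, ℝ).prod (𝓡 (2 * m + 1)))
      (cotModel (m + 1)) c (a (v.1.2 : S1), reebMap η Q l₀ (s (v.1.2 : S1), v.1.1)))).symm)
  rw [h5, mD_prodMk ha.differentiableAt.mdifferentiableAt h4, ContinuousLinearMap.comp_apply] at h
  have h6 := hinj _ h
  rw [ContinuousLinearMap.prod_apply, mD_eq_fderiv, ha.fderiv, h3, mD_eq_fderiv, h1.fderiv] at h6
  have h7 : derivS1 a v.1.2 * w.1.2 = 0 := congrArg Prod.fst h6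
  have h8 : mD 𝓘(ℝ, ℝ × Eu m) (𝓡 (2 * m + 1)) (reebMap η Q l₀) (curveCoord s a v).2
      (derivS1 s v.1.2 * w.1.2, w.1.1) = 0 := congrArg Prod.snd h6
  have h9 := congrArg (fun A : ℝ × Eu m →L[ℝ] ℝ => A (derivS1 s v.1.2 * w.1.2, w.1.1))
    (pb_reebMap (u := (curveCoord s a v).2) D.liouville D.emb D.emb_mem D.reeb D.flow D.leg_emb
      D.leg l₀ hv)
  simp only [pb, ContinuousLinearMap.comp_apply, ContinuousLinearMap.coe_fst', h8, map_zero] at h9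
  have h10 : w.1.2 = 0 := by
    rcases D.curve.regular v.1.2 with h | h
    · exact (mul_eq_zero.1 h9.symm).resolve_left h
    · exact (mul_eq_zero.1 h7).resolve_left h
  refine ⟨h10, ?_⟩
  rw [h10, mul_zero] at h8
  exact h8

/-- Flowing back by `η (-t)` turns the map into `Q`, which is an immersion. -/
theorem mD_reebMap_injective [T2Space S] (D : IsStripData U Z j β R η Q ε₀ ε c g s a) {t : ℝ}
    {y : Eu m}
    (h : mD 𝓘(ℝ, ℝ × Eu m) (𝓡 (2 * m + 1)) (reebMap η Q l₀) (t, extChartAt (𝓡 m) l₀ l₀) (0, y) = 0) :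
    y = 0 := by
  set y₀ := extChartAt (𝓡 m) l₀ l₀ with hy₀
  have hy : y₀ ∈ (extChartAt (𝓡 m) l₀).target := mem_extChartAt_target l₀
  have h1 : HasFDerivAt (fun y : Eu m => ((t, y) : ℝ × Eu m)) _ y₀ :=
    hasFDerivAt_prodMk_right (𝕜 := ℝ) t y₀
  have h2 := (contMDiffAt_reebMap (u := (t, y₀)) D.flow D.leg_emb l₀ hy).mdifferentiableAt (by simp)
  have h3 : mD 𝓘(ℝ, Eu m) (𝓡 (2 * m + 1)) (fun y : Eu m => reebMap η Q l₀ (t, y)) y₀ = _ :=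
    mD_comp (J := 𝓘(ℝ, ℝ × Eu m)) (g := reebMap η Q l₀) (f := fun y : Eu m => ((t, y) : ℝ × Eu m)) y₀
      h2 h1.differentiableAt.mdifferentiableAt
  have h4 : ContMDiff (𝓡 (2 * m + 1)) (𝓡 (2 * m + 1)) ∞ (η (-t)) :=
    D.flow.contMDiff.comp (contMDiff_const.prodMk contMDiff_id)
  have h5 : (fun y : Eu m => Q ((extChartAt (𝓡 m) l₀).symm y)) =
      fun y => η (-t) (reebMap η Q l₀ (t, y)) := by
    funext y
    exact (D.flow.neg_comp t _).symm
  have h6 := mD_comp (I := 𝓘(ℝ, Eu m)) (J := 𝓡 (2 * m + 1)) (K := 𝓡 (2 * m + 1)) (g := η (-t))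
    (f := fun y => reebMap η Q l₀ (t, y)) y₀ (h4.mdifferentiableAt (by simp))
    (h2.comp y₀ h1.differentiableAt.mdifferentiableAt)
  rw [← h5, mD_comp_extChartAt_symm (D.leg_emb.contMDiff.mdifferentiableAt (by simp)), h3,
    mD_eq_fderiv, h1.fderiv] at h6
  have h7 := congrArg (fun A : Eu m →L[ℝ] Eu (2 * m + 1) => A y) h6
  simp only [ContinuousLinearMap.comp_apply, ContinuousLinearMap.inr_apply, h, map_zero] at h7
  exact D.leg_emb.injective_mfderiv l₀ (h7.trans (map_zero (mD (𝓡 m) (𝓡 (2 * m + 1)) Q l₀)).symm)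

/-- `figureEightMap` is an immersion. -/
theorem injective_mD_lift [T2Space S] (D : IsStripData U Z j β R η Q ε₀ ε c g s a)
    (hρ : SmoothOnS1 ρ) (hα : IsFigureEight δ Φm Φp α)
    (hΦ : ∀ (w : L × S1) (Θ : S1), Phi c η Q s a g T ρ w Θ ∈ Ioo Φm Φp) (p : (L × ℝ) × ℝ) :
    Function.Injective (mD (liftModel m) (cotPlaneModel (m + 1))
      (lift (figureEightMap c η Q s a g T ρ α)) p) := by
  rw [injective_iff_map_eq_zero]
  intro w hw
  have hv := target_mem (m := m) p
  rw [D.mD_lift hρ hα hΦ] at hw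
  have h1 := congrArg Prod.fst hw
  have h2 : fderiv ℝ (localPlane c η Q s a g T ρ α p.1.1) (extChartAt (liftModel m) p p) w = 0 :=
    congrArg Prod.snd hw
  -- The vector `(dΘ(w), dΦ(w))` is killed by the differential of `α`. Pairing it with `∂_Φ` in the
  -- area form isolates the `Θ` component.
  have hw2 : w.2 = 0 := by
    have h3 := D.fderiv_annulus hρ hΦ hα.smooth hv w
    have h4 := hα.area (extChartAt (liftModel m) p p).2 _ (localPhi_mem hΦ p.1.1
      (extChartAt (liftModel m) p p)) (w.2, fderiv ℝ (localPhi c η Q s a g T ρ p.1.1)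
        (extChartAt (liftModel m) p p) w) (0, 1)
    simp only at h4
    rw [← h3] at h4
    change fderiv ℝ (localPlane c η Q s a g T ρ α p.1.1) (extChartAt (liftModel m) p p) w 0 * _ -
      fderiv ℝ (localPlane c η Q s a g T ρ α p.1.1) (extChartAt (liftModel m) p p) w 1 * _ = _ at h4
    rw [h2] at h4
    simpa using h4
  obtain ⟨hw1, h3⟩ := D.curve_eq_zero hv (D.mD_localBase_eq_zero hρ hv hw2 h1)
  rw [extChartAt_lift_self] at h3
  have h4 := D.mD_reebMap_injective h3
  exact Prod.ext (Prod.ext h4 hw1) hw2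

theorem continuous_of_continuous_lift {Y : Type*} [TopologicalSpace Y] {F : (L × S1) × S1 → Y}
    (hF : Continuous (lift F)) : Continuous F := by
  have h : IsOpenQuotientMap (fun t : ℝ => (t : S1)) := QuotientAddGroup.isOpenQuotientMap_mk
  exact ((IsOpenQuotientMap.id.prodMap h).prodMap h).isQuotientMap.continuous_iff.2 hF

/-- The domain is compact and the target Hausdorff, so a continuous injection is a topological
embedding. -/
theorem isLagrangianEmb [T2Space M] [T2Space S] [CompactSpace L]
    (D : IsStripData U Z j β R η Q ε₀ ε c g s a)
    (hρ : SmoothOnS1 ρ) (hα : IsFigureEight δ Φm Φp α)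
    (hΦ : ∀ (w : L × S1) (Θ : S1), Phi c η Q s a g T ρ w Θ ∈ Ioo Φm Φp)
    (hinj : Function.Injective (figureEightMap c η Q s a g T ρ α)) :
    IsLagrangianEmb (figureEightMap c η Q s a g T ρ α) := by
  have := compactSpace_S1
  exact ⟨((continuous_of_continuous_lift (D.contMDiff_lift hρ hα hΦ).continuous).isClosedEmbedding
      hinj).isEmbedding, D.contMDiff_lift hρ hα hΦ, D.injective_mD_lift hρ hα hΦ,
    D.isotropic hρ hα hΦ⟩

end IsStripData

end Immersion
end FigureEight
end

/-! ### The theorem: choice of the constants -/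

open FigureEight in
theorem mainTheorem6 (m : ℕ)
    {M : Type*} [TopologicalSpace M] [ChartedSpace (Eu (m + 1)) M]
    [IsManifold (𝓡 (m + 1)) ∞ M] [T2Space M] [SigmaCompactSpace M]
    {S : Type*} [TopologicalSpace S] [ChartedSpace (Eu (2 * m + 1)) S]
    [IsManifold (𝓡 (2 * m + 1)) ∞ S] [T2Space S] [CompactSpace S]
    {L : Type*} [TopologicalSpace L] [ChartedSpace (Eu m) L]
    [IsManifold (𝓡 m) ∞ L] [T2Space L] [CompactSpace L]
    -- a function on `M` without critical points
    (g : M → ℝ) (hg : ContMDiff (𝓡 (m + 1)) 𝓘(ℝ, ℝ) ∞ g)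
    (hg_crit : ∀ q, mfderiv (𝓡 (m + 1)) 𝓘(ℝ, ℝ) g q ≠ 0)
    -- a closed hypersurface of induced contact type in the cotangent bundle
    (U : Set (Cot (n := m + 1) M))
    (Z : ∀ z : Cot (n := m + 1) M, TangentSpace (cotModel (m + 1)) z)
    (hZ : IsLiouvilleField (m + 1) U Z)
    (j : S → Cot (n := m + 1) M) (hj : IsSmoothEmb (𝓡 (2 * m + 1)) (cotModel (m + 1)) j)
    (hjU : ∀ x, j x ∈ U)
    (hjZ : ∀ x, Z (j x) ∉ range (mfderiv (𝓡 (2 * m + 1)) (cotModel (m + 1)) j x))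
    -- the class of `p dq - λ` vanishes in the first cohomology of the hypersurface
    (hexact : ∃ β : S → ℝ, ContMDiff (𝓡 (2 * m + 1)) 𝓘(ℝ, ℝ) ∞ β ∧ ∀ x,
      pullbackForm (𝓡 (2 * m + 1)) (cotModel (m + 1)) j (liouville (m + 1)) x -
        contactForm (m + 1) (k := 2 * m + 1) Z j x = dform (𝓡 (2 * m + 1)) β x)
    -- the Reeb vector field and its flow
    (R : ∀ x : S, TangentSpace (𝓡 (2 * m + 1)) x) (η : ℝ → S → S)
    (hR : IsReebField (𝓡 (2 * m + 1)) (contactForm (m + 1) (k := 2 * m + 1) Z j) R)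
    (hη : IsFlow (𝓡 (2 * m + 1)) R η)
    -- a closed Legendrian submanifold
    (Q : L → S) (hQ : IsSmoothEmb (𝓡 m) (𝓡 (2 * m + 1)) Q)
    (hLeg : ∀ l, pullbackForm (𝓡 m) (𝓡 (2 * m + 1)) Q (contactForm (m + 1) (k := 2 * m + 1) Z j) l = 0)
    -- the neighbourhood of the hypersurface given by the flow of `Z`
    (ε₀ ε : ℝ) (hε : 0 < ε) (hεε₀ : ε < ε₀) (c : ℝ × S → Cot (n := m + 1) M)
    (hc : IsFlowCollar (m + 1) (k := 2 * m + 1) U Z j ε₀ c) :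
    (∃ T : ℝ, 0 < T ∧ Displaces c ε g T) ∧
    ∀ T : ℝ, Displaces c ε g T →
    ∀ δ : ℝ, 0 < δ → δ < 1 → ∀ ρ : S1 → ℝ, IsCutoff δ ρ →
    ∃ M₀ : ℝ, 0 < M₀ ∧
    ∀ ℓ : ℝ≥0∞, NoReebChord η Q ℓ →
    ∀ s a : S1 → ℝ, IsStripCurve ε s a →
    (∀ t t' : S1, ENNReal.ofReal (s t - s t') ≤ ℓ) →
      (∀ w : L × S1, |psi c η Q s a g T w| ≤ M₀) ∧
      ∃ (Φm Φp : ℝ) (α : S1 × ℝ → Eu 2),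
        (∀ (w : L × S1) (Θ : S1), Phi c η Q s a g T ρ w Θ ∈ Ioo Φm Φp) ∧
        IsFigureEight δ Φm Φp α ∧
        IsLagrangianEmb (figureEightMap c η Q s a g T ρ α) ∧
        IsExactRel s a (figureEightMap c η Q s a g T ρ α) ∧
        ∀ r₀ : ℝ, 0 < r₀ → 4 * Real.pi * r₀ ^ 2 = 8 * M₀ →
          range (figureEightMap c η Q s a g T ρ α) ⊆ univ ×ˢ Metric.ball (0 : Eu 2) r₀ := by
  obtain ⟨β, hβ, hβ'⟩ := hexact
  refine ⟨exists_disjoint_translate hg hg_crit (hc.isCompact_image hε hεε₀),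
    fun T hT δ hδ _ ρ hρ => ?_⟩
  obtain ⟨C, hC, hψ⟩ := hc.exists_bound_psi hg hε hεε₀ η Q T
  obtain ⟨C', hC', hρ'⟩ := hρ.smooth.exists_bound_primeS1
  -- `C` bounds `|Tg|` on the whole collar and `C'` bounds `|ρ'|`, so `|Φ| ≤ C C' < (C + 1)(C' + 1)`
  -- for every curve in the strip. In this way `α` is fixed before `ℓ` and the curve are given.
  obtain ⟨α, r, hr, hα, hαr, hαinj⟩ := exists_isFigureEight hδ
    (show 0 < (C + 1) * (C' + 1) by positivity)
  -- The second summand makes `4π r₀² = 8 M₀` imply `r₀ ≥ r`, where `r` bounds the image of `α`; the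
  -- first provides the bound for `ψ`.
  refine ⟨C + Real.pi * r ^ 2 / 2, by positivity, fun ℓ hℓ s a hE hs =>
    ⟨fun w => (hψ s a hE w).trans (le_add_of_nonneg_right (by positivity)), ?_⟩⟩
  have hΦ : ∀ (w : L × S1) (Θ : S1), Phi c η Q s a g T ρ w Θ ∈
      Ioo (-((C + 1) * (C' + 1))) ((C + 1) * (C' + 1)) := by
    intro w Θ
    refine abs_lt.1 ?_
    rw [Phi, abs_mul]
    have := mul_le_mul (hψ s a hE w) (hρ' Θ) (abs_nonneg _) hC
    nlinarith
  have D : IsStripData U Z j β R η Q ε₀ ε c g s a :=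
    ⟨hZ, hj, hjU, hβ, hβ', hR, hη, hQ, hLeg, hε, hεε₀, hc, hg, hE⟩
  have hinj := figureEightMap_injective
    (baseMap_injective hc hη hQ.isEmbedding.injective hε hεε₀ hℓ hE hs) hE hT hδ hρ hα hαinj hΦ
  refine ⟨_, _, α, hΦ, hα, D.isLagrangianEmb hρ.smooth hα hΦ hinj, D.isExactRel hρ.smooth hα hΦ, ?_⟩
  rintro r₀ hr₀ h _ ⟨p, rfl⟩
  refine ⟨mem_univ _, mem_ball_zero_iff.2 ((hαr _ (hΦ p.1 p.2)).trans_le ?_)⟩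
  have h1 : Real.pi * r ^ 2 ≤ Real.pi * r₀ ^ 2 := by linarith
  exact (sq_le_sq₀ hr.le hr₀.le).1 (le_of_mul_le_mul_left h1 Real.pi_pos)
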